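/- Throughout $1<\alpha\le 2$, $T\ge 1$, $N\ge 0$, all random variables are complex and live on one probability space, and $z^{<\beta>}=|z|^{\beta-1}\bar z$ (coordinatewise for vectors, $0^{<\beta>}=0$). Complex random variables $X_1,\dots,X_n$ are jointly symmetric $\alpha$-stable (S$\alpha$S) if there is a finite symmetric measure $\Gamma$ on the unit sphere of $\mathbb C^n=\mathbb R^{2n}$ with $E\exp(i\,\mathrm{Re}\sum_k\bar t_kX_k)=\exp\{-\int|\mathrm{Re}\sum_k\bar t_kx_k|^\alpha\,d\Gamma(x)\}$ for all $t\in\mathbb C^n$. For jointly S$\alpha$S $X,Y$ with such a measure $\Gamma_{X,Y}$ put $[X,Y]_\alpha=\int x\,y^{<\alpha-1>}\,d\Gamma_{X,Y}(x,y)$ and $\|X\|_\alpha=[X,X]_\alpha^{1/\alpha}$. Let $\vec Z(\theta)$, $\theta\in[-\pi,\pi]$, be a $\mathbb C^T$-valued S$\alpha$S process (all finite families of its coordinates are jointly S$\alpha$S) with independent increments. It has (absolutely continuous, finite, matrix-valued) spectral measure with density $f$ if $f$ is a $T\times T$ matrix function with integrable entries on $(-\pi,\pi]$ and $$\big[a^\top(\vec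 Z(t)-\vec Z(s)),\,b^\top(\vec Z(t)-\vec Z(s))\big]_\alpha=\int_s^t a^\top f(\theta)\,b^{<\alpha-1>}\,d\theta\qquad(a,b\in\mathbb C^T,\ -\pi\le s\le t\le\pi).$$ $L^\alpha(f)$ is the space of measurable $u:(-\pi,\pi]\to\mathbb C^T$ with $\int u^\top f\,u^{<\alpha-1>}d\theta<\infty$, and $\int u^\top d\vec Z$ is the limit in $\|\cdot\|_\alpha$ of the integrals of step functions converging to $u$ in $L^\alpha(f)$. A sequence $\xi(n)$, $n\in\mathbb Z$, is periodically harmonizable S$\alpha$S with period $T$, spectral process $\vec Z^\xi$ and spectral density $f$, if $\vec Z^\xi$ is such a process and the blocked sequence $\vec\xi(n)=\{\xi(nT+k)\}_{k=0}^{T-1}$ satisfies $\vec\xi(n)=\int_{-\pi}^{\pi}e^{in\theta}d\vec Z^\xi(\theta)$ for all $n\in\mathbb Z$. **Theorem.** Let $\xi$ and $\eta$ be mutually independent periodically harmonizable S$\alpha$S sequences with period $T$, spectral processes $\vec Z^\xi,\vec Z^\eta$ and spectral densities $f,g$ satisfying the minimality condition $$\int_{-\pi}^{\pi}\mathrm{Tr}\big[(f(\theta)+g(\theta))^{-1/(\alpha-1)}\big]\,d\theta<\infty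 .$$ Let $\vec a(j)=\{a_k(j)\}_{k=0}^{T-1}\in\mathbb C^T$, $j=0,\dots,N$, and $$A_N\vec\xi=\sum_{j=0}^N\sum_{k=0}^{T-1}a_k(j)\,\xi(jT+k),\qquad A_N(e^{i\theta})=\sum_{j=0}^N\vec a(j)e^{ij\theta}.$$ Let $H^N(\xi+\eta)$ be the $\|\cdot\|_\alpha$-closed complex linear manifold generated by $\xi(j)+\eta(j)$, $j\in\mathbb Z\setminus\{0,1,\dots,T(N+1)-1\}$. Then: 1. There is an almost surely unique element $\hat A_N\vec\xi$ of $H^N(\xi+\eta)$ that minimizes $\|A_N\vec\xi-Y\|_\alpha$ over $Y\in H^N(\xi+\eta)$ (the optimal linear estimate). 2. There are $h\in L^\alpha(f+g)$ and $\vec c(0),\dots,\vec c(N)\in\mathbb C^T$ such that, for almost all $\theta\in(-\pi,\pi]$, $$f(\theta)\big(A_N(e^{i\theta})-h(\theta)\big)^{<\alpha-1>}-g(\theta)\,h(\theta)^{<\alpha-1>}=C_N(e^{i\theta}),\qquad C_N(e^{i\theta})=\sum_{j=0}^N\vec c(j)e^{-ij\theta},$$ and $h$ is integrable with $$\int_{-\pi}^{\pi}e^{-ik\theta}h(\theta)\,d\theta=0,\qquad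 k=0,1,\dots,N.$$ These relations determine $h\in L^\alpha(f+g)$ up to almost everywhere equality, and $\vec c(0),\dots,\vec c(N)$, uniquely. Moreover $h$ lies in the closed subspace of $L^\alpha(f+g)$ generated by the functions $e^{ij\theta}\delta_k$, $k=0,\dots,T-1$, $j\in\mathbb Z\setminus\{0,\dots,N\}$, where $\delta_k$ are the standard basis vectors. 3. With this $h$ (the spectral characteristic of the estimate), $$\hat A_N\vec\xi=\int_{-\pi}^{\pi}h(\theta)^\top\big(d\vec Z^\xi(\theta)+d\vec Z^\eta(\theta)\big).$$ 4. The error is finite and equals $$\|A_N\vec\xi-\hat A_N\vec\xi\|_\alpha^\alpha=\int_{-\pi}^{\pi}\big(A_N(e^{i\theta})-h(\theta)\big)^\top f(\theta)\big(A_N(e^{i\theta})-h(\theta)\big)^{<\alpha-1>}d\theta+\int_{-\pi}^{\pi}h(\theta)^\top g(\theta)\,h(\theta)^{<\alpha-1>}d\theta,$$ with integrable integrands; for $T=1$ this reads $\int_{-\pi}^{\pi}|A_N(e^{i\theta})-h(\theta)|^\alpha f(\theta)\,d\theta+\int_{-\pi}^{\pi}|h(\theta)|^\alpha g(\theta)\,d\theta$.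 -/

import Mathlib

open MeasureTheory ProbabilityTheory Filter Topology Set
open scoped ENNReal Matrix ComplexConjugate

noncomputable section

namespace StableInterp

variable {Ω : Type*} [MeasurableSpace Ω]

/-- The signed power `z^{<β>} = |z|^{β-1} z̄` of a complex number (equal to `0` at `z = 0`). -/
def signedPow (β : ℝ) (z : ℂ) : ℂ := ((‖z‖ ^ (β - 1) : ℝ) : ℂ) * conj z

/-- The signed power of a vector, taken coordinate by coordinate. -/
def vecSignedPow {T : ℕ} (β : ℝ) (v : Fin T → ℂ) : Fin T → ℂ := fun k => signedPow β (v k)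

/-- `Γ` is a spectral measure of the family `X` of complex random variables, i.e. of the real
random vector of all real and imaginary parts: a finite symmetric measure on the unit sphere of
`ℂ^ι = ℝ^{2|ι|}` with
`E exp (i ⟨t, X⟩) = exp (- ∫ |⟨t, x⟩|^α dΓ(x))`, where `⟨t, x⟩ = Re ∑ conj (t k) * x k` is the
real scalar product of `ℝ^{2|ι|}`. -/
structure IsSpectralMeasure {ι : Type} [Fintype ι] (α : ℝ) (P : Measure Ω)
    (X : ι → Ω → ℂ) (Γ : Measure (EuclideanSpace ℂ ι)) : Prop where
  finite : IsFiniteMeasure Γ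
  sphere : Γ (Metric.sphere (0 : EuclideanSpace ℂ ι) 1)ᶜ = 0
  symmetric : Γ.map (fun x => -x) = Γ
  charFun : ∀ t : ι → ℂ,
    ∫ ω, Complex.exp (Complex.I * (((∑ k, conj (t k) * X k ω).re : ℝ) : ℂ)) ∂P =
      ((Real.exp (-∫ x, |(∑ k, conj (t k) * x k).re| ^ α ∂Γ) : ℝ) : ℂ)

/-- The complex random variables `X k` are jointly symmetric `α`-stable. -/
def IsJointlySaS {ι : Type} [Fintype ι] (α : ℝ) (P : Measure Ω) (X : ι → Ω → ℂ) : Prop :=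
  (∀ k, AEMeasurable (X k) P) ∧ ∃ Γ, IsSpectralMeasure α P X Γ

open Classical in
/-- The covariation `[X, Y]_α = ∫ x (y)^{<α-1>} dΓ_{X,Y}(x, y)` of jointly symmetric `α`-stable
complex random variables (`0` if they are not jointly symmetric `α`-stable). The value does not
depend on the chosen spectral measure. -/
def covariation (α : ℝ) (P : Measure Ω) (X Y : Ω → ℂ) : ℂ :=
  if h : ∃ Γ, IsSpectralMeasure α P ![X, Y] Γ then
    ∫ x, x 0 * signedPow (α - 1) (x 1) ∂h.choose
  else 0

open Classical in
/-- The norm `‖X‖_α = [X, X]_α ^ (1/α)` of a symmetric `α`-stable complex random variable;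
it is `∞` if `X` is not symmetric `α`-stable. -/
def stableNorm (α : ℝ) (P : Measure Ω) (X : Ω → ℂ) : ℝ≥0∞ :=
  if IsJointlySaS α P (fun _ : Fin 1 => X) then
    ENNReal.ofReal ((covariation α P X X).re ^ (1 / α))
  else ⊤

/-- The closed (in the norm `‖·‖_α`) linear manifold generated by a set of random variables. -/
def closedManifold (α : ℝ) (P : Measure Ω) (S : Set (Ω → ℂ)) : Set (Ω → ℂ) :=
  {Y | ∀ ε : ℝ≥0∞, 0 < ε → ∃ X ∈ Submodule.span ℂ S, stableNorm α P (Y - X) < ε}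

/-- `Y` is an optimal estimate of `X` in `H`: an element of `H` with the least distance to `X`. -/
def IsOptimalEstimate (α : ℝ) (P : Measure Ω) (X : Ω → ℂ) (H : Set (Ω → ℂ)) (Y : Ω → ℂ) : Prop :=
  Y ∈ H ∧ ∀ Y' ∈ H, stableNorm α P (X - Y) ≤ stableNorm α P (X - Y')

/-- The vector-valued process `Z(θ)`, `-π ≤ θ ≤ π`, is symmetric `α`-stable. -/
def IsSaSProcess {T : ℕ} (α : ℝ) (P : Measure Ω) (Z : ℝ → Ω → Fin T → ℂ) : Prop :=
  ∀ (n : ℕ) (t : Fin n → ℝ), (∀ i, t i ∈ Icc (-Real.pi) Real.pi) →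
    IsJointlySaS α P (fun (p : Fin n × Fin T) ω => Z (t p.1) ω p.2)

/-- The process `Z(θ)`, `-π ≤ θ ≤ π`, has independent increments. -/
def IndepIncrements {T : ℕ} (P : Measure Ω) (Z : ℝ → Ω → Fin T → ℂ) : Prop :=
  ∀ (n : ℕ) (t : Fin (n + 1) → ℝ), Monotone t → (∀ i, t i ∈ Icc (-Real.pi) Real.pi) →
    iIndepFun (fun (i : Fin n) ω => Z (t i.succ) ω - Z (t i.castSucc) ω) P

/-- The matrix-valued spectral measure of the process `Z` is finite and absolutely continuous with
density `f`: the increments satisfy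
`[aᵀ (Z(t) - Z(s)), bᵀ (Z(t) - Z(s))]_α = ∫_s^t aᵀ f(θ) b^{<α-1>} dθ` for all vectors `a`, `b`.
For `T = 1` this says that `‖Z(t) - Z(s)‖_α^α = ∫_s^t f(θ) dθ`. -/
def HasSpectralDensity {T : ℕ} (α : ℝ) (P : Measure Ω) (Z : ℝ → Ω → Fin T → ℂ)
    (f : ℝ → Matrix (Fin T) (Fin T) ℂ) : Prop :=
  (∀ k l, IntegrableOn (fun θ => f θ k l) (Ioc (-Real.pi) Real.pi)) ∧
  ∀ s t : ℝ, -Real.pi ≤ s → s ≤ t → t ≤ Real.pi → ∀ a b : Fin T → ℂ,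
    covariation α P (fun ω => a ⬝ᵥ (Z t ω - Z s ω)) (fun ω => b ⬝ᵥ (Z t ω - Z s ω)) =
      ∫ θ in Ioc s t, a ⬝ᵥ (f θ *ᵥ vecSignedPow (α - 1) b)

/-- `uᵀ w u^{<α-1>}` at the point `θ`. -/
def alphaForm {T : ℕ} (α : ℝ) (w : ℝ → Matrix (Fin T) (Fin T) ℂ) (u : ℝ → Fin T → ℂ) (θ : ℝ) : ℂ :=
  u θ ⬝ᵥ (w θ *ᵥ vecSignedPow (α - 1) (u θ))

/-- The `α`-th power `∫ uᵀ w u^{<α-1>} dθ` of the norm of `u` in `L^α(w)`. (The integrand is a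
nonnegative real number for almost all `θ` when `w` is a spectral density.) -/
def lalphaPow {T : ℕ} (α : ℝ) (w : ℝ → Matrix (Fin T) (Fin T) ℂ) (u : ℝ → Fin T → ℂ) : ℝ≥0∞ :=
  ∫⁻ θ in Ioc (-Real.pi) Real.pi, ‖alphaForm α w u θ‖ₑ

/-- Membership in `L^α(w)`. -/
def MemLalpha {T : ℕ} (α : ℝ) (w : ℝ → Matrix (Fin T) (Fin T) ℂ) (u : ℝ → Fin T → ℂ) : Prop :=
  AEStronglyMeasurable u (volume.restrict (Ioc (-Real.pi) Real.pi)) ∧ lalphaPow α w u < ⊤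

/-- The function `θ ↦ e^{inθ} δ_k`. -/
def harmonic {T : ℕ} (n : ℤ) (k : Fin T) : ℝ → Fin T → ℂ :=
  fun θ => Complex.exp (Complex.I * n * θ) • Pi.single k 1

/-- Membership in the closed subspace `L_N^α(w)` of `L^α(w)` generated by the functions
`e^{ijθ} δ_k` with `j ∈ ℤ ∖ {0, …, N}`. -/
def MemLalphaN {T : ℕ} (α : ℝ) (N : ℕ) (w : ℝ → Matrix (Fin T) (Fin T) ℂ)
    (u : ℝ → Fin T → ℂ) : Prop :=
  MemLalpha α w u ∧ ∀ ε : ℝ≥0∞, 0 < ε →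
    ∃ p ∈ Submodule.span ℂ
        {v : ℝ → Fin T → ℂ | ∃ (j : ℤ) (k : Fin T), j ∉ Icc (0 : ℤ) N ∧ v = harmonic j k},
      lalphaPow α w (u - p) < ε

/-- The step function `∑ i, c i * 1_{(s i, t i]}`. -/
def stepFun {T n : ℕ} (s t : Fin n → ℝ) (c : Fin n → Fin T → ℂ) : ℝ → Fin T → ℂ :=
  fun θ => ∑ i, (Ioc (s i) (t i)).indicator (fun _ => c i) θ

/-- The integral `∑ i, (c i)ᵀ (Z(t i) - Z(s i))` of a step function. -/
def stepIntegral {T n : ℕ} (Z : ℝ → Ω → Fin T → ℂ) (s t : Fin n → ℝ) (c : Fin n → Fin T → ℂ) :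
    Ω → ℂ :=
  fun ω => ∑ i, c i ⬝ᵥ (Z (t i) ω - Z (s i) ω)

/-- `Y = ∫ uᵀ dZ`, where `Z` has spectral density `w`: `Y` is the limit in `‖·‖_α` of integrals of
step functions that converge to `u` in `L^α(w)`. -/
def IsStochIntegral {T : ℕ} (α : ℝ) (P : Measure Ω) (Z : ℝ → Ω → Fin T → ℂ)
    (w : ℝ → Matrix (Fin T) (Fin T) ℂ) (u : ℝ → Fin T → ℂ) (Y : Ω → ℂ) : Prop :=
  MemLalpha α w u ∧ ∀ ε : ℝ≥0∞, 0 < ε →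
    ∃ (n : ℕ) (s t : Fin n → ℝ) (c : Fin n → Fin T → ℂ),
      (∀ i, -Real.pi ≤ s i ∧ s i ≤ t i ∧ t i ≤ Real.pi) ∧
      lalphaPow α w (u - stepFun s t c) < ε ∧
      stableNorm α P (Y - stepIntegral Z s t c) < ε

/-- The vector-valued sequence `X` is harmonizable symmetric `α`-stable with spectral process `Z`
and spectral density `f`: `X(n) = ∫ e^{inθ} dZ(θ)`. -/
structure IsHarmonizableWith {T : ℕ} (α : ℝ) (P : Measure Ω) (X : ℤ → Ω → Fin T → ℂ)
    (Z : ℝ → Ω → Fin T → ℂ) (f : ℝ → Matrix (Fin T) (Fin T) ℂ) : Prop where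
  stable : IsSaSProcess α P Z
  indep : IndepIncrements P Z
  density : HasSpectralDensity α P Z f
  repr : ∀ (n : ℤ) (k : Fin T), IsStochIntegral α P Z f (harmonic n k) (fun ω => X n ω k)

/-- The blocked sequence `n ↦ (ξ(nT), ξ(nT+1), …, ξ(nT+T-1))`. -/
def block (T : ℕ) (ξ : ℤ → Ω → ℂ) : ℤ → Ω → Fin T → ℂ :=
  fun n ω k => ξ (n * (T : ℤ) + ((k : ℕ) : ℤ)) ω

/-- The sequence `ξ` is periodically harmonizable symmetric `α`-stable with period `T`; its blocked
sequence has spectral process `Z` and spectral density `f`. -/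
def IsPeriodicallyHarmonizableWith (α : ℝ) (P : Measure Ω) (T : ℕ) (ξ : ℤ → Ω → ℂ)
    (Z : ℝ → Ω → Fin T → ℂ) (f : ℝ → Matrix (Fin T) (Fin T) ℂ) : Prop :=
  IsHarmonizableWith α P (block T ξ) Z f

open Classical in
/-- The trace of the power `M^p` of a Hermitian matrix: the sum of `λ^p` over the eigenvalues.
For `p < 0` it is `∞` unless `M` is positive definite. -/
def tracePow {T : ℕ} (p : ℝ) (M : Matrix (Fin T) (Fin T) ℂ) : ℝ≥0∞ :=
  if h : M.IsHermitian then ∑ i, (ENNReal.ofReal (h.eigenvalues i)) ^ p else ⊤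

/-- The minimality condition `∫ Tr [w(θ)^{-1/(α-1)}] dθ < ∞`. -/
def Minimality {T : ℕ} (α : ℝ) (w : ℝ → Matrix (Fin T) (Fin T) ℂ) : Prop :=
  ∫⁻ θ in Ioc (-Real.pi) Real.pi, tracePow (-1 / (α - 1)) (w θ) < ⊤

/-- The functional `A_N ξ = ∑_{j=0}^N ∑_{k=0}^{T-1} a_k(j) ξ(jT+k)`. -/
def functional {T N : ℕ} (a : Fin (N + 1) → Fin T → ℂ) (ξ : ℤ → Ω → ℂ) : Ω → ℂ :=
  fun ω => ∑ j : Fin (N + 1), ∑ k : Fin T, a j k * ξ (((j : ℕ) : ℤ) * (T : ℤ) + ((k : ℕ) : ℤ)) ω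

/-- `A_N(e^{iθ}) = ∑_{j=0}^N a(j) e^{ijθ}`. -/
def polyA {T N : ℕ} (a : Fin (N + 1) → Fin T → ℂ) (θ : ℝ) : Fin T → ℂ :=
  ∑ j : Fin (N + 1), Complex.exp (Complex.I * ((j : ℕ) : ℂ) * θ) • a j

/-- `C_N(e^{iθ}) = ∑_{j=0}^N c(j) e^{-ijθ}`. -/
def polyC {T N : ℕ} (c : Fin (N + 1) → Fin T → ℂ) (θ : ℝ) : Fin T → ℂ :=
  ∑ j : Fin (N + 1), Complex.exp (-(Complex.I * ((j : ℕ) : ℂ) * θ)) • c j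

/-- The closed linear manifold generated by the observations `ξ(j) + η(j)`,
`j ∈ ℤ ∖ {0, …, T(N+1)-1}`. -/
def observed (α : ℝ) (P : Measure Ω) (T N : ℕ) (ξ η : ℤ → Ω → ℂ) : Set (Ω → ℂ) :=
  closedManifold α P
    {X | ∃ j : ℤ, j ∉ Ico (0 : ℤ) ((T : ℤ) * ((N : ℤ) + 1)) ∧ X = ξ j + η j}

/-- The function `h ∈ L^α(f+g)` and the coefficients `c(0), …, c(N)` solve the equation
`f (A_N - h)^{<α-1>} - g h^{<α-1>} = C_N` almost everywhere, together with the system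
`∫ e^{-ikθ} h(θ) dθ = 0`, `k = 0, …, N`. -/
structure IsSolution {T N : ℕ} (α : ℝ) (f g : ℝ → Matrix (Fin T) (Fin T) ℂ)
    (a : Fin (N + 1) → Fin T → ℂ) (h : ℝ → Fin T → ℂ) (c : Fin (N + 1) → Fin T → ℂ) : Prop where
  memL : MemLalpha α (f + g) h
  equation : ∀ᵐ θ ∂(volume.restrict (Ioc (-Real.pi) Real.pi)),
    f θ *ᵥ vecSignedPow (α - 1) (polyA a θ - h θ) - g θ *ᵥ vecSignedPow (α - 1) (h θ) = polyC c θ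
  integrable : IntegrableOn h (Ioc (-Real.pi) Real.pi)
  system : ∀ k : Fin (N + 1),
    ∫ θ in Ioc (-Real.pi) Real.pi, Complex.exp (-(Complex.I * ((k : ℕ) : ℂ) * θ)) • h θ = 0

end StableInterp

end

noncomputable section

namespace StableInterp

variable {Ω : Type*} [MeasurableSpace Ω]

/-! ### Scalar inequalities for signed powers -/

/-! A symmetric stable vector behaves like a family of functions in an $L^\alpha$ space. If $X$ has
spectral measure $\Gamma$, then averaging $-\log|E\exp(i\,\mathrm{Re}(zX))|$ over the circle $|z|=1$
gives $\int|x|^\alpha d\Gamma$ up to the $\alpha$-th absolute moment of the cosine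
(`StableRep.stablePow_eq`). So $\|X\|_\alpha$ depends on the distribution only, and inequalities
between complex numbers integrate to inequalities between stable norms, notably Minkowski's
inequality and uniform convexity (`exists_uniform_convexity_stablePow`). Limits of jointly stable
vectors are jointly stable, because spectral measures of bounded mass on a compact sphere have weak
limit points (`isJointlySaS_of_tendsto`). Tail bounds and Borel-Cantelli give completeness
(`SaSSpace.exists_limit`). Hence best approximations in closed manifolds exist and are almost surely
unique (`SaSSpace.exists_projection`).

The problem is then moved to functions on $(-\pi,\pi]$. For $\alpha<2$ the spectral density must be
diagonal almost everywhere, since $b^\top f b^{<\alpha-1>}$ has to come from a norm and norms are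
convex; for $\alpha=2$ it is positive semidefinite (`HasSpectralDensity.isDensity`). In both cases
$a^\top f b^{<\alpha-1>}$ is a finite sum of terms $(v\cdot a)(v\cdot b)^{<\alpha-1>}$, so scalar
inequalities apply pointwise. Independence of increments makes integration of step functions an
isometry, which extends to limits. Trigonometric polynomials are dense, so integrals against $Z^\xi$
belong to the closed span of $\xi$; this carries the independence of $\xi$ and $\eta$ over to the
integrals, and the error of $\int u^\top(dZ^\xi+dZ^\eta)$ becomes
$\|A_N-u\|^\alpha_{L^\alpha(f)}+\|u\|^\alpha_{L^\alpha(g)}$ (`IndepProcesses.stablePow_sub`).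

Minimality and Hölder's inequality embed $L^\alpha(f+g)$ in $L^1$
(`Minimality.exists_lintegral_le`). This makes $L^\alpha(f+g)$ complete, so that the projection is
itself an integral of some $h$, and it makes Fourier coefficients continuous, so that those of $h$
vanish on $\{0,\dots,N\}$. Varying $h$ along $e^{in\theta}\delta_k$ with $n\notin\{0,\dots,N\}$
kills the corresponding Fourier coefficients of $f(A_N-h)^{<\alpha-1>}-g\,h^{<\alpha-1>}$, which is
therefore a polynomial $C_N$ (`exists_polyC_of_minimal`); the first variation rests on the
smoothness estimate `norm_add_rpow_le`.

Uniqueness is a monotone operator argument (`IsSolution.unique`). For two solutions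
$\int(h'-h)^\top(C_N-C_N')\,d\theta=0$ by the system, while the equations write the integrand as a
sum of terms with nonnegative real part. These real parts vanish, hence so does the form of $f+g$ at
$h'-h$, and minimality gives $h'=h$. -/

theorem mul_signedPow_self {α : ℝ} (hα : 0 < α) (z : ℂ) :
    z * signedPow (α - 1) z = ((‖z‖ ^ α : ℝ) : ℂ) := by
  rcases eq_or_ne z 0 with rfl | hz
  · simp [signedPow, Real.zero_rpow hα.ne']
  · have h0 : 0 < ‖z‖ := norm_pos_iff.2 hz
    have : z * conj z = ((‖z‖ ^ 2 : ℝ) : ℂ) := by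
      rw [Complex.mul_conj, Complex.normSq_eq_norm_sq]
    unfold signedPow
    rw [mul_left_comm, this, ← Complex.ofReal_mul, ← Real.rpow_natCast, ← Real.rpow_add h0]
    congr 2
    push_cast; ring

theorem norm_signedPow {α : ℝ} (hα : 1 < α) (z : ℂ) :
    ‖signedPow (α - 1) z‖ = ‖z‖ ^ (α - 1) := by
  rcases eq_or_ne z 0 with rfl | hz
  · simp [signedPow, Real.zero_rpow (sub_pos.2 hα).ne']
  · have h0 : 0 < ‖z‖ := norm_pos_iff.2 hz
    unfold signedPow
    rw [norm_mul, RCLike.norm_conj, Complex.norm_real, Real.norm_of_nonneg (by positivity)]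
    nth_rewrite 2 [← Real.rpow_one ‖z‖]
    rw [← Real.rpow_add h0]
    congr 1; ring

theorem signedPow_zero (β : ℝ) : signedPow β 0 = 0 := by simp [signedPow]

theorem signedPow_mul (β : ℝ) (z w : ℂ) :
    signedPow β (z * w) = signedPow β z * signedPow β w := by
  unfold signedPow
  rw [norm_mul, Real.mul_rpow (norm_nonneg _) (norm_nonneg _), map_mul]
  push_cast; ring

theorem signedPow_one (β : ℝ) : signedPow β 1 = 1 := by simp [signedPow]

theorem signedPow_one_left (z : ℂ) : signedPow 1 z = conj z := by simp [signedPow]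

@[fun_prop]
theorem measurable_signedPow (β : ℝ) : Measurable (signedPow β) := by
  unfold signedPow
  fun_prop

theorem mul_rpow_sub_one_le {α : ℝ} (hα : 1 < α) {a b : ℝ} (ha : 0 ≤ a) (hb : 0 ≤ b) :
    a * b ^ (α - 1) ≤ a ^ α + b ^ α := by
  have hpow : ∀ c : ℝ, 0 ≤ c → c * c ^ (α - 1) = c ^ α := fun c hc => by
    rcases hc.eq_or_lt with rfl | hc
    · simp [Real.zero_rpow (by linarith : α ≠ 0)]
    · nth_rewrite 1 [← Real.rpow_one c]
      rw [← Real.rpow_add hc]; congr 1; ring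
  rcases le_total a b with h | h
  · calc a * b ^ (α - 1) ≤ b * b ^ (α - 1) := by gcongr
      _ = b ^ α := hpow b hb
      _ ≤ _ := by have := Real.rpow_nonneg ha α; linarith
  · calc a * b ^ (α - 1) ≤ a * a ^ (α - 1) := by
          gcongr
      _ = a ^ α := hpow a ha
      _ ≤ _ := by have := Real.rpow_nonneg hb α; linarith

theorem norm_mul_signedPow_le {α : ℝ} (hα : 1 < α) (y x : ℂ) :
    ‖y * signedPow (α - 1) x‖ ≤ ‖y‖ ^ α + ‖x‖ ^ α := by
  rw [norm_mul, norm_signedPow hα]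
  exact mul_rpow_sub_one_le hα (norm_nonneg _) (norm_nonneg _)

/-- Strict monotonicity of the signed power map. -/
theorem re_sub_mul_signedPow_sub {α : ℝ} (hα : 1 < α) (x y : ℂ) :
    0 ≤ ((x - y) * (signedPow (α - 1) x - signedPow (α - 1) y)).re ∧
    (((x - y) * (signedPow (α - 1) x - signedPow (α - 1) y)).re = 0 → x = y) := by
  have hα0 : 0 < α := by linarith
  have hα1 : 0 < α - 1 := by linarith
  set a := ‖x‖
  set b := ‖y‖
  have ha : 0 ≤ a := norm_nonneg _
  have hb : 0 ≤ b := norm_nonneg _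
  have e : ((x - y) * (signedPow (α - 1) x - signedPow (α - 1) y)).re
      = a ^ α + b ^ α - (x * signedPow (α - 1) y).re - (y * signedPow (α - 1) x).re := by
    have h1 := congrArg Complex.re (mul_signedPow_self hα0 x)
    have h2 := congrArg Complex.re (mul_signedPow_self hα0 y)
    rw [Complex.ofReal_re] at h1 h2
    rw [sub_mul, mul_sub, mul_sub]
    simp only [Complex.sub_re]
    rw [h1, h2]; ring
  have l1 : (x * signedPow (α - 1) y).re ≤ a * b ^ (α - 1) := by
    refine (Complex.re_le_norm _).trans ?_
    rw [norm_mul, norm_signedPow hα]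
  have l2 : (y * signedPow (α - 1) x).re ≤ b * a ^ (α - 1) := by
    refine (Complex.re_le_norm _).trans ?_
    rw [norm_mul, norm_signedPow hα]
  have hpow : ∀ c : ℝ, 0 ≤ c → c ^ α = c * c ^ (α - 1) := fun c hc => by
    rcases hc.eq_or_lt with rfl | hc
    · simp [Real.zero_rpow (by linarith : α ≠ 0)]
    · nth_rewrite 2 [← Real.rpow_one c]
      rw [← Real.rpow_add hc]; congr 1; ring
  have key : a ^ α + b ^ α - a * b ^ (α - 1) - b * a ^ (α - 1)
      = (a - b) * (a ^ (α - 1) - b ^ (α - 1)) := by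
    rw [hpow a ha, hpow b hb]; ring
  have kpos : 0 ≤ (a - b) * (a ^ (α - 1) - b ^ (α - 1)) := by
    rcases le_total a b with h | h
    · exact mul_nonneg_of_nonpos_of_nonpos (by linarith)
        (by have := Real.rpow_le_rpow ha h hα1.le; linarith)
    · exact mul_nonneg (by linarith) (by have := Real.rpow_le_rpow hb h hα1.le; linarith)
  refine ⟨by rw [e]; linarith, fun h0 => ?_⟩
  rw [e] at h0
  -- Equality leaves no slack in `l1` and `l2`. The product in `key` is then zero, so the moduli
  -- agree; afterwards `l2` becomes the equality case of Cauchy-Schwarz, $\mathrm{Re}(y\bar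
  -- x)=|y|^2$, and $|x-y|^2=0$.
  have hab : a = b := by
    have h1 : (a - b) * (a ^ (α - 1) - b ^ (α - 1)) = 0 := by linarith
    rcases mul_eq_zero.1 h1 with h | h
    · linarith
    · exact (Real.rpow_left_inj ha hb hα1.ne').1 (by linarith)
  rcases hb.eq_or_lt with hb0 | hb0
  · have h1 : x = 0 := norm_eq_zero.1 (show a = 0 by linarith)
    have h2 : y = 0 := norm_eq_zero.1 hb0.symm
    rw [h1, h2]
  have h3 : (y * signedPow (α - 1) x).re = b * a ^ (α - 1) := by linarith
  unfold signedPow at h3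
  have h4 : (y * (((‖x‖ ^ (α - 1 - 1) : ℝ) : ℂ) * conj x)).re
      = b ^ (α - 1 - 1) * (y * conj x).re := by
    rw [mul_left_comm, Complex.re_ofReal_mul]
    change a ^ _ * _ = _
    rw [hab]
  have h5 : b * a ^ (α - 1) = b ^ (α - 1 - 1) * b ^ 2 := by
    rw [hab, ← Real.rpow_natCast, ← Real.rpow_add hb0]
    nth_rewrite 1 [← Real.rpow_one b]
    rw [← Real.rpow_add hb0]; congr 1; push_cast; ring
  rw [h4, h5] at h3
  have h6 : (y * conj x).re = b ^ 2 := mul_left_cancel₀ (by positivity) h3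
  have h7 : ‖x - y‖ ^ 2 = 0 := by
    rw [← Complex.normSq_eq_norm_sq, Complex.normSq_sub, Complex.normSq_eq_norm_sq,
      Complex.normSq_eq_norm_sq]
    have : (x * conj y).re = (y * conj x).re := by
      simp only [Complex.mul_re, Complex.conj_re, Complex.conj_im]; ring
    rw [this, h6]
    change a ^ 2 + b ^ 2 - 2 * b ^ 2 = 0
    rw [hab]; ring
  exact sub_eq_zero.1 (norm_eq_zero.1 (by simpa using h7))

/-- The function `‖·‖ ^ α` is `α`-smooth for `1 < α ≤ 2`. -/
theorem norm_add_rpow_le {α : ℝ} (hα₁ : 1 < α) (hα₂ : α ≤ 2) (x y : ℂ) :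
    ‖x + y‖ ^ α ≤ ‖x‖ ^ α + α * (y * signedPow (α - 1) x).re + 6 * ‖y‖ ^ α := by
  have hα0 : 0 < α := by linarith
  have hy0 := Real.rpow_nonneg (norm_nonneg y) α
  -- If $|x|\le|y|$, the constant is $6=4+2$: $2^\alpha\le4$ bounds the left side and $\alpha\le2$
  -- bounds the linear term. Otherwise $|x+y|^2=|x|^2(1+s)$ and Bernoulli's inequality with exponent
  -- $\alpha/2\le1$ applies.
  rcases le_or_gt ‖x‖ ‖y‖ with h | h
  · have h1 : ‖x + y‖ ^ α ≤ 4 * ‖y‖ ^ α := by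
      calc ‖x + y‖ ^ α ≤ (2 * ‖y‖) ^ α := by
            gcongr; exact (norm_add_le _ _).trans (by linarith)
        _ = 2 ^ α * ‖y‖ ^ α := Real.mul_rpow (by norm_num) (norm_nonneg _)
        _ ≤ 4 * ‖y‖ ^ α := by
            gcongr
            calc (2 : ℝ) ^ α ≤ 2 ^ (2 : ℝ) := by gcongr; norm_num
              _ = 4 := by norm_num
    have h2 : -(‖y‖ ^ α) ≤ (y * signedPow (α - 1) x).re := by
      have h3 : |(y * signedPow (α - 1) x).re| ≤ ‖y‖ ^ α := by
        refine (Complex.abs_re_le_norm _).trans ?_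
        rw [norm_mul, norm_signedPow hα₁]
        calc ‖y‖ * ‖x‖ ^ (α - 1) ≤ ‖y‖ * ‖y‖ ^ (α - 1) := by
              gcongr
          _ = ‖y‖ ^ α := by
              rcases (norm_nonneg y).eq_or_lt with h | h
              · rw [← h]; simp [Real.zero_rpow (by linarith : α ≠ 0)]
              · nth_rewrite 1 [← Real.rpow_one ‖y‖]
                rw [← Real.rpow_add h]; congr 1; ring
      exact (abs_le.1 h3).1
    have h4 := Real.rpow_nonneg (norm_nonneg x) α
    nlinarith
  · have hx : 0 < ‖x‖ := (norm_nonneg y).trans_lt h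
    have hx2 : 0 < ‖x‖ ^ 2 := by positivity
    have hp : ∀ z : ℂ, ‖z‖ ^ α = (‖z‖ ^ 2) ^ (α / 2) := fun z => by
      rw [← Real.rpow_natCast, ← Real.rpow_mul (norm_nonneg _)]; congr 1; push_cast; ring
    set s : ℝ := (2 * (y * conj x).re + ‖y‖ ^ 2) / ‖x‖ ^ 2 with hs
    have hxy : ‖x + y‖ ^ 2 = ‖x‖ ^ 2 * (1 + s) := by
      rw [hs, mul_add, mul_div_cancel₀ _ hx2.ne', ← Complex.normSq_eq_norm_sq, Complex.normSq_add,
        Complex.normSq_eq_norm_sq, Complex.normSq_eq_norm_sq]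
      have : (x * conj y).re = (y * conj x).re := by
        simp only [Complex.mul_re, Complex.conj_re, Complex.conj_im]; ring
      rw [this]; ring
    have hs1 : 0 ≤ 1 + s := by
      have : 0 ≤ ‖x‖ ^ 2 * (1 + s) := by rw [← hxy]; positivity
      exact nonneg_of_mul_nonneg_right this hx2
    have hb : (1 + s) ^ (α / 2) ≤ 1 + α / 2 * s :=
      rpow_one_add_le_one_add_mul_self (by linarith) (by linarith) (by linarith)
    have h1 : ‖x + y‖ ^ α ≤ ‖x‖ ^ α * (1 + α / 2 * s) := by
      rw [hp, hxy, Real.mul_rpow hx2.le hs1, ← hp]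
      gcongr
    have h2 : (y * signedPow (α - 1) x).re = ‖x‖ ^ α / ‖x‖ ^ 2 * (y * conj x).re := by
      unfold signedPow
      rw [mul_left_comm, Complex.re_ofReal_mul]
      congr 1
      rw [← Real.rpow_natCast, ← Real.rpow_sub hx]; congr 1; push_cast; ring
    have h3 : ‖x‖ ^ α / ‖x‖ ^ 2 * ‖y‖ ^ 2 ≤ ‖y‖ ^ α := by
      rcases (norm_nonneg y).eq_or_lt with h0 | h0
      · rw [← h0]; simp [Real.zero_rpow hα0.ne']
      · rw [div_mul_eq_mul_div, div_le_iff₀ hx2]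
        have e1 : ‖x‖ ^ 2 = ‖x‖ ^ α * ‖x‖ ^ (2 - α) := by
          rw [← Real.rpow_add hx, ← Real.rpow_natCast]; congr 1; push_cast; ring
        have e2 : ‖y‖ ^ 2 = ‖y‖ ^ α * ‖y‖ ^ (2 - α) := by
          rw [← Real.rpow_add h0, ← Real.rpow_natCast]; congr 1; push_cast; ring
        rw [e1, e2]
        have : ‖y‖ ^ (2 - α) ≤ ‖x‖ ^ (2 - α) := by gcongr
        have h7 : 0 ≤ ‖x‖ ^ α * ‖y‖ ^ α := by positivity
        nlinarith
    calc ‖x + y‖ ^ α ≤ ‖x‖ ^ α * (1 + α / 2 * s) := h1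
      _ = ‖x‖ ^ α + α * (y * signedPow (α - 1) x).re
          + α / 2 * (‖x‖ ^ α / ‖x‖ ^ 2 * ‖y‖ ^ 2) := by
          rw [h2, hs]; field_simp; ring
      _ ≤ _ := by nlinarith

/-- Two sources of strictness: strict convexity of $t^\alpha$ when the moduli differ, the strict
triangle inequality when they agree. -/
theorem norm_midpoint_rpow_lt {α : ℝ} (hα : 1 < α) {x y : ℂ} (h : x ≠ y) :
    ‖(x + y) / 2‖ ^ α < (‖x‖ ^ α + ‖y‖ ^ α) / 2 := by
  have hα0 : 0 < α := by linarith
  have e : ‖(x + y) / 2‖ = ‖x + y‖ / 2 := by rw [norm_div]; simp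
  by_cases hn : ‖x‖ = ‖y‖
  · have h1 : ‖x + y‖ < ‖x‖ + ‖y‖ := by
      refine lt_of_le_of_ne (norm_add_le _ _) fun h2 => h ?_
      exact (sameRay_iff_norm_add.2 h2).eq_of_norm_eq hn
    calc ‖(x + y) / 2‖ ^ α < ‖x‖ ^ α := by
          apply Real.rpow_lt_rpow (norm_nonneg _) _ hα0
          rw [e]; linarith
      _ = _ := by rw [← hn]; ring
  · have h1 := (strictConvexOn_rpow hα).2 (mem_Ici.2 (norm_nonneg x)) (mem_Ici.2 (norm_nonneg y))
      hn (by norm_num : (0 : ℝ) < 1 / 2) (by norm_num : (0 : ℝ) < 1 / 2) (by norm_num)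
    simp only [smul_eq_mul] at h1
    calc ‖(x + y) / 2‖ ^ α ≤ (1 / 2 * ‖x‖ + 1 / 2 * ‖y‖) ^ α := by
          gcongr
          rw [e]; have := norm_add_le x y; linarith
      _ < _ := h1
      _ = _ := by ring

theorem norm_midpoint_rpow_le {α : ℝ} (hα : 1 < α) (x y : ℂ) :
    ‖(x + y) / 2‖ ^ α ≤ (‖x‖ ^ α + ‖y‖ ^ α) / 2 := by
  rcases eq_or_ne x y with rfl | h
  · simp
  · exact (norm_midpoint_rpow_lt hα h).le

/-- A form of uniform convexity of `‖·‖ ^ α`, `1 < α`, on the complex plane. -/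
theorem exists_uniform_convexity {α : ℝ} (hα : 1 < α) {ε : ℝ} (hε : 0 < ε) :
    ∃ C : ℝ, 0 ≤ C ∧ ∀ x y : ℂ, ‖x - y‖ ^ α ≤ ε * (‖x‖ ^ α + ‖y‖ ^ α)
      + C * ((‖x‖ ^ α + ‖y‖ ^ α) / 2 - ‖(x + y) / 2‖ ^ α) := by
  have hα0 : 0 < α := by linarith
  have hα0' : 0 ≤ α := hα0.le
  let G : ℂ × ℂ → ℝ := fun p => (‖p.1‖ ^ α + ‖p.2‖ ^ α) / 2 - ‖(p.1 + p.2) / 2‖ ^ α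
  let D : ℂ × ℂ → ℝ := fun p => ‖p.1 - p.2‖ ^ α
  have hG : Continuous G := by
    refine Continuous.sub (Continuous.div_const (Continuous.add ?_ ?_) _) ?_ <;>
      exact Continuous.rpow_const (by fun_prop) fun _ => Or.inr hα0'
  have hD : Continuous D := Continuous.rpow_const (by fun_prop) fun _ => Or.inr hα0'
  -- On this compact set the convexity gap `G` has a positive minimum $\delta$, and `D` is at most
  -- $2^\alpha$ on the unit sphere; hence $C=2^\alpha/\delta$. The general case follows because both
  -- sides are homogeneous of degree $\alpha$.
  let K : Set (ℂ × ℂ) := Metric.sphere 0 1 ∩ {p | ε ≤ D p}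
  have hK : IsCompact K := (isCompact_sphere _ _).inter_right (isClosed_le continuous_const hD)
  obtain ⟨δ, hδ, hδK⟩ : ∃ δ > 0, ∀ p ∈ K, δ ≤ G p := by
    rcases K.eq_empty_or_nonempty with h | h
    · exact ⟨1, one_pos, by simp [h]⟩
    · obtain ⟨p, hp, hmin⟩ := hK.exists_isMinOn h hG.continuousOn
      refine ⟨G p, sub_pos.2 (norm_midpoint_rpow_lt hα fun h => ?_), fun q hq => hmin hq⟩
      have := hp.2
      simp [D, h, Real.zero_rpow hα0.ne'] at this
      linarith
  have hunit : ∀ p ∈ Metric.sphere (0 : ℂ × ℂ) 1, D p ≤ ε + 2 ^ α / δ * G p := by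
    intro p hp
    have hG0 : 0 ≤ G p := sub_nonneg.2 (norm_midpoint_rpow_le hα _ _)
    by_cases h : ε ≤ D p
    · have h1 := hδK p ⟨hp, h⟩
      have hp1 : ‖p‖ = 1 := by simpa using hp
      have h3 : D p ≤ 2 ^ α := by
        refine Real.rpow_le_rpow (norm_nonneg _) ?_ hα0'
        have := norm_sub_le p.1 p.2
        have := norm_fst_le p
        have := norm_snd_le p
        linarith
      have h4 : 2 ^ α ≤ 2 ^ α / δ * G p := by
        rw [div_mul_eq_mul_div, le_div_iff₀ hδ]; gcongr
      linarith
    · have : 0 ≤ 2 ^ α / δ * G p := by positivity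
      linarith [not_le.1 h]
  refine ⟨2 ^ α / δ, by positivity, fun x y => ?_⟩
  by_cases h0 : (x, y) = (0 : ℂ × ℂ)
  · obtain ⟨rfl, rfl⟩ := Prod.mk.inj h0
    simp [Real.zero_rpow hα0.ne']
  set r : ℝ := ‖(x, y)‖ with hr_def
  have hr : 0 < r := norm_pos_iff.2 h0
  have hrα : 0 < r ^ α := by positivity
  have hpr : ((r⁻¹ : ℝ) : ℂ) • (x, y) ∈ Metric.sphere (0 : ℂ × ℂ) 1 := by
    rw [mem_sphere_zero_iff_norm, norm_smul, Complex.norm_real, Real.norm_of_nonneg (by positivity),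
      ← hr_def, inv_mul_cancel₀ hr.ne']
  have hscale : ∀ z : ℂ, ‖((r⁻¹ : ℝ) : ℂ) * z‖ ^ α = ‖z‖ ^ α / r ^ α := fun z => by
    rw [norm_mul, Complex.norm_real, Real.norm_of_nonneg (by positivity),
      Real.mul_rpow (by positivity) (norm_nonneg _), Real.inv_rpow hr.le]
    field_simp
  have h1 := hunit _ hpr
  simp only [D, G, Prod.smul_mk, smul_eq_mul, ← mul_sub, ← mul_add, mul_div_assoc, hscale] at h1
  have h2 : r ^ α ≤ ‖x‖ ^ α + ‖y‖ ^ α := by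
    have hx := Real.rpow_nonneg (norm_nonneg x) α
    have hy := Real.rpow_nonneg (norm_nonneg y) α
    rcases max_cases ‖x‖ ‖y‖ with h | h <;> rw [hr_def, Prod.norm_def, h.1] <;> linarith
  rw [div_le_iff₀ hrα] at h1
  calc ‖x - y‖ ^ α ≤ _ := h1
    _ = ε * r ^ α + 2 ^ α / δ * ((‖x‖ ^ α + ‖y‖ ^ α) / 2 - ‖(x + y) / 2‖ ^ α) := by
        field_simp
    _ ≤ _ := by gcongr

/-! ### Representations of symmetric stable vectors -/

/-- The value `E exp (i Re Y)` of the characteristic function of `Y`. -/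
def cf (P : Measure Ω) (Y : Ω → ℂ) : ℂ :=
  ∫ ω, Complex.exp (Complex.I * (((Y ω).re : ℝ) : ℂ)) ∂P

/-- The random variables `X k` have the joint characteristic function of the stable integrals of
the functions `φ k ∈ L^α(m)`. -/
structure StableRep {ι E : Type*} [Fintype ι] [MeasurableSpace E] (α : ℝ) (P : Measure Ω)
    (X : ι → Ω → ℂ) (m : Measure E) (φ : ι → E → ℂ) : Prop where
  aemeasurable : ∀ k, AEMeasurable (X k) P
  sfinite : SFinite m
  measurable : ∀ k, Measurable (φ k)
  lt_top : ∀ k, ∫⁻ x, ‖φ k x‖ₑ ^ α ∂m < ⊤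
  cf_eq : ∀ t : ι → ℂ, cf P (fun ω => ∑ k, t k * X k ω) =
    ((Real.exp (-(∫⁻ x, ‖(∑ k, t k * φ k x).re‖ₑ ^ α ∂m).toReal) : ℝ) : ℂ)

theorem enorm_re_le (z : ℂ) : ‖z.re‖ₑ ≤ ‖z‖ₑ := by
  rw [← ofReal_norm, ← ofReal_norm]
  exact ENNReal.ofReal_le_ofReal (Complex.abs_re_le_norm z)

theorem ofReal_norm_rpow {E : Type*} [SeminormedAddCommGroup E] {α : ℝ} (hα : 0 ≤ α) (z : E) :
    ENNReal.ofReal (‖z‖ ^ α) = ‖z‖ₑ ^ α := by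
  rw [← ofReal_norm, ENNReal.ofReal_rpow_of_nonneg (norm_nonneg _) hα]

theorem memLp_iff_lintegral_lt_top {E : Type*} [MeasurableSpace E] {m : Measure E} {α : ℝ}
    (hα : 0 < α) {φ : E → ℂ} (hφ : AEStronglyMeasurable φ m) :
    MemLp φ (ENNReal.ofReal α) m ↔ ∫⁻ x, ‖φ x‖ₑ ^ α ∂m < ⊤ := by
  rw [MemLp, eLpNorm_lt_top_iff_lintegral_rpow_enorm_lt_top (by simpa using hα) (by simp),
    ENNReal.toReal_ofReal hα.le]
  exact and_iff_right hφ

section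

variable {ι E : Type*} [Fintype ι] [MeasurableSpace E] {α : ℝ} {P : Measure Ω}
  {X : ι → Ω → ℂ} {m : Measure E} {φ : ι → E → ℂ}

theorem StableRep.sum_lt_top (hα : 0 < α) (h : StableRep α P X m φ) (t : ι → ℂ) :
    ∫⁻ x, ‖∑ k, t k * φ k x‖ₑ ^ α ∂m < ⊤ := by
  have hm := h.measurable
  rw [← memLp_iff_lintegral_lt_top hα (by fun_prop)]
  refine memLp_finsetSum _ fun k _ => MemLp.const_mul ?_ _
  exact (memLp_iff_lintegral_lt_top hα (hm k).aestronglyMeasurable).2 (h.lt_top k)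

theorem StableRep.sum_re_lt_top (hα : 0 < α) (h : StableRep α P X m φ) (t : ι → ℂ) :
    ∫⁻ x, ‖(∑ k, t k * φ k x).re‖ₑ ^ α ∂m < ⊤ :=
  (lintegral_mono fun _ => ENNReal.rpow_le_rpow (enorm_re_le _) hα.le).trans_lt
    (h.sum_lt_top hα t)

theorem sum_mul_sum_mul {ι κ : Type*} [Fintype ι] [Fintype κ] (t : κ → ℂ) (A : κ → ι → ℂ)
    (y : ι → ℂ) : ∑ j, t j * ∑ k, A j k * y k = ∑ k, (∑ j, t j * A j k) * y k := by
  simp only [Finset.mul_sum, Finset.sum_mul]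
  rw [Finset.sum_comm]
  simp only [mul_assoc]

/-- Linear images of a stable vector. -/
theorem StableRep.linear {κ : Type*} [Fintype κ] (hα : 0 < α) (h : StableRep α P X m φ)
    (A : κ → ι → ℂ) :
    StableRep α P (fun j ω => ∑ k, A j k * X k ω) m (fun j x => ∑ k, A j k * φ k x) where
  aemeasurable j := by
    have := h.aemeasurable
    fun_prop
  sfinite := h.sfinite
  measurable j := by
    have := h.measurable
    fun_prop
  lt_top j := h.sum_lt_top hα _
  cf_eq t := by
    simp only [sum_mul_sum_mul]
    exact h.cf_eq _

end

section

variable {ι : Type} {E : Type*} [Fintype ι] [MeasurableSpace E] {α : ℝ} {P : Measure Ω}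
  {X : ι → Ω → ℂ}

/-- A vector that has a representation is jointly symmetric stable: the representing measure is
moved to the unit sphere and symmetrized. -/
theorem StableRep.isJointlySaS (hα : 0 < α) {m : Measure E} {φ : ι → E → ℂ}
    (h : StableRep α P X m φ) : IsJointlySaS α P X := by
  classical
  refine ⟨h.aemeasurable, ?_⟩
  have hmeas := h.measurable
  let u : E → EuclideanSpace ℂ ι := fun x => WithLp.toLp 2 fun k => φ k x
  have hu : Measurable u := by
    refine (PiLp.continuous_toLp 2 _).measurable.comp ?_
    fun_prop
  let v : E → EuclideanSpace ℂ ι := fun x => ((‖u x‖⁻¹ : ℝ) : ℂ) • u x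
  have hv : Measurable v := by
    have hc : Measurable fun x => ((‖u x‖⁻¹ : ℝ) : ℂ) := by fun_prop
    exact Measurable.smul (M := ℂ) (X := EuclideanSpace ℂ ι) hc hu
  -- The density compensates, by homogeneity, for normalizing `u`. It also removes the points where
  -- `u` vanishes, the only ones that `v` does not send to the sphere.
  let m' : Measure E := m.withDensity fun x => ‖u x‖ₑ ^ α
  let Γ₁ : Measure (EuclideanSpace ℂ ι) := m'.map v
  have hfin : IsFiniteMeasure Γ₁ := by
    refine ⟨?_⟩
    rw [Measure.map_apply hv MeasurableSet.univ, preimage_univ,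
      withDensity_apply _ MeasurableSet.univ, Measure.restrict_univ]
    have : MemLp u (ENNReal.ofReal α) m := by
      have : ∀ x, u x = ∑ k, φ k x • EuclideanSpace.single k (1 : ℂ) := fun x => by
        ext j
        simp [u, Finset.sum_apply, Pi.single_apply]
      rw [funext this]
      refine memLp_finsetSum _ fun k _ => ?_
      exact (ContinuousLinearMap.toSpanSingleton ℂ
        (EuclideanSpace.single k (1 : ℂ))).comp_memLp' ((memLp_iff_lintegral_lt_top hα (hmeas k).aestronglyMeasurable).2 (h.lt_top k))
    have h2 := this.2
    rwa [eLpNorm_lt_top_iff_lintegral_rpow_enorm_lt_top (by simpa using hα) (by simp),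
      ENNReal.toReal_ofReal hα.le] at h2
  have hneg : Measurable fun x : EuclideanSpace ℂ ι => -x := measurable_neg
  have hsph : Γ₁ (Metric.sphere (0 : EuclideanSpace ℂ ι) 1)ᶜ = 0 := by
    have hS : MeasurableSet (Metric.sphere (0 : EuclideanSpace ℂ ι) 1)ᶜ :=
      Metric.isClosed_sphere.measurableSet.compl
    rw [Measure.map_apply hv hS, withDensity_apply _ (hv hS),
      setLIntegral_eq_zero_iff (hv hS) (by fun_prop)]
    filter_upwards with x hx
    by_contra h0
    apply hx
    have h1 : u x ≠ 0 := fun h1 => h0 (by simp [h1, hα])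
    have h2 : ‖u x‖ ≠ 0 := norm_ne_zero_iff.2 h1
    simp only [v, mem_sphere_zero_iff_norm, norm_smul, Complex.norm_real, norm_inv, norm_norm]
    exact inv_mul_cancel₀ h2
  let Γ : Measure (EuclideanSpace ℂ ι) :=
    (2⁻¹ : ℝ≥0∞) • Γ₁ + (2⁻¹ : ℝ≥0∞) • Γ₁.map fun x => -x
  have h2top : (2⁻¹ : ℝ≥0∞) ≠ ⊤ := by simp
  refine ⟨Γ, ?_, ?_, ?_, ?_⟩
  · have : IsFiniteMeasure (Γ₁.map fun x => -x) := Measure.isFiniteMeasure_map _ _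
    have := Γ₁.smul_finite h2top
    have := (Γ₁.map fun x => -x).smul_finite h2top
    infer_instance
  · have : (Γ₁.map fun x => -x) (Metric.sphere (0 : EuclideanSpace ℂ ι) 1)ᶜ = 0 := by
      rw [Measure.map_apply hneg Metric.isClosed_sphere.measurableSet.compl]
      convert! hsph using 2
      ext x
      simp
    simp [Γ, this, hsph]
  · simp only [Γ]
    rw [Measure.map_add _ _ hneg, Measure.map_smul, Measure.map_smul,
      Measure.map_map hneg hneg, add_comm]
    congr
    convert Measure.map_id
    ext x
    simp
  · intro t
    have hg : Measurable fun x : EuclideanSpace ℂ ι => ‖(∑ k, conj (t k) * x k).re‖ₑ ^ α := by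
      have : ∀ k : ι, Measurable fun x : EuclideanSpace ℂ ι => x k := fun k =>
        (EuclideanSpace.proj (𝕜 := ℂ) k).continuous.measurable
      fun_prop
    have e1 : ∫ x, |(∑ k, conj (t k) * x k).re| ^ α ∂Γ
        = (∫⁻ x, ‖(∑ k, conj (t k) * x k).re‖ₑ ^ α ∂Γ).toReal := by
      rw [integral_eq_lintegral_of_nonneg_ae]
      · congr 1
        refine lintegral_congr fun x => ?_
        rw [← Real.norm_eq_abs, ofReal_norm_rpow hα.le]
      · filter_upwards with x using by positivity
      · have : ∀ k : ι, Measurable fun x : EuclideanSpace ℂ ι => x k := fun k =>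
          (EuclideanSpace.proj (𝕜 := ℂ) k).continuous.measurable
        exact Measurable.aestronglyMeasurable (by fun_prop)
    have e2 : ∫⁻ x, ‖(∑ k, conj (t k) * x k).re‖ₑ ^ α ∂(Γ₁.map fun x => -x)
        = ∫⁻ x, ‖(∑ k, conj (t k) * x k).re‖ₑ ^ α ∂Γ₁ := by
      rw [lintegral_map hg hneg]
      refine lintegral_congr fun x => ?_
      have : ∑ k, conj (t k) * (-x) k = -∑ k, conj (t k) * x k := by simp
      rw [this, Complex.neg_re, enorm_neg]
    have e3 : ∫⁻ x, ‖(∑ k, conj (t k) * x k).re‖ₑ ^ α ∂Γ₁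
        = ∫⁻ x, ‖(∑ k, conj (t k) * φ k x).re‖ₑ ^ α ∂m := by
      rw [lintegral_map hg hv, lintegral_withDensity_eq_lintegral_mul m
        (f := fun x => ‖u x‖ₑ ^ α) (by fun_prop)
        (g := fun x => ‖(∑ k, conj (t k) * v x k).re‖ₑ ^ α) (hg.comp hv)]
      refine lintegral_congr fun x => ?_
      simp only [Pi.mul_apply]
      have e4 : ∑ k, conj (t k) * v x k = ((‖u x‖⁻¹ : ℝ) : ℂ) * ∑ k, conj (t k) * φ k x := by
        rw [Finset.mul_sum]
        refine Finset.sum_congr rfl fun k _ => ?_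
        simp only [v, u, PiLp.smul_apply, smul_eq_mul]
        ring
      rw [e4, Complex.re_ofReal_mul, enorm_mul, ENNReal.mul_rpow_of_nonneg _ _ hα.le, ← mul_assoc]
      rcases eq_or_ne (u x) 0 with h0 | h0
      · have : ∀ k, φ k x = 0 := fun k => by
          have := congrArg (fun y : EuclideanSpace ℂ ι => y k) h0
          simpa [u] using this
        simp [this, hα]
      · rw [← ENNReal.mul_rpow_of_nonneg _ _ hα.le, ← enorm_norm (u x), ← enorm_mul,
          mul_inv_cancel₀ (norm_ne_zero_iff.2 h0)]
        simp
    have e5 : ∫⁻ x, ‖(∑ k, conj (t k) * x k).re‖ₑ ^ α ∂Γ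
        = ∫⁻ x, ‖(∑ k, conj (t k) * φ k x).re‖ₑ ^ α ∂m := by
      simp only [Γ]
      rw [lintegral_add_measure, lintegral_smul_measure, lintegral_smul_measure, e2, e3,
        smul_eq_mul, ← add_mul, ENNReal.inv_two_add_inv_two, one_mul]
    rw [e1, e5]
    exact h.cf_eq fun k => conj (t k)

theorem _root_.EuclideanSpace.measurable_coord (k : ι) :
    Measurable fun x : EuclideanSpace ℂ ι => x k :=
  (EuclideanSpace.proj (𝕜 := ℂ) k).continuous.measurable

theorem IsSpectralMeasure.stableRep (hα : 0 < α) {Γ : Measure (EuclideanSpace ℂ ι)}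
    (hX : ∀ k, AEMeasurable (X k) P) (h : IsSpectralMeasure α P X Γ) :
    StableRep α P X Γ (fun k x => x k) where
  aemeasurable := hX
  sfinite := by
    have := h.finite
    infer_instance
  measurable := EuclideanSpace.measurable_coord
  lt_top k := by
    have := h.finite
    have hs : ∀ᵐ x ∂Γ, x ∈ Metric.sphere (0 : EuclideanSpace ℂ ι) 1 := h.sphere
    refine (lintegral_mono_ae (g := fun _ => 1) ?_).trans_lt (by simp)
    filter_upwards [hs] with x hx
    refine ENNReal.rpow_le_one ?_ hα.le
    rw [← ofReal_norm, ← ENNReal.ofReal_one]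
    refine ENNReal.ofReal_le_ofReal ((PiLp.norm_apply_le x k).trans ?_)
    rw [mem_sphere_zero_iff_norm.1 hx]
  cf_eq t := by
    have h1 := h.charFun fun k => conj (t k)
    simp only [RingHomCompTriple.comp_apply, RingHom.id_apply] at h1
    refine h1.trans ?_
    have e : ∫ x, |(∑ k, t k * x k).re| ^ α ∂Γ
        = (∫⁻ x, ‖(∑ k, t k * x k).re‖ₑ ^ α ∂Γ).toReal := by
      rw [integral_eq_lintegral_of_nonneg_ae]
      · congr 1
        refine lintegral_congr fun x => ?_
        rw [← Real.norm_eq_abs, ofReal_norm_rpow hα.le]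
      · filter_upwards with x using by positivity
      · have := EuclideanSpace.measurable_coord (ι := ι)
        exact Measurable.aestronglyMeasurable (by fun_prop)
    rw [e]

theorem IsJointlySaS.exists_stableRep (hα : 0 < α) (h : IsJointlySaS α P X) :
    ∃ Γ : Measure (EuclideanSpace ℂ ι), IsSpectralMeasure α P X Γ ∧
      StableRep α P X Γ (fun k x => x k) := by
  obtain ⟨hX, Γ, hΓ⟩ := h
  exact ⟨Γ, hΓ, hΓ.stableRep hα hX⟩

theorem IsJointlySaS.linear {κ : Type} [Fintype κ] (hα : 0 < α) (h : IsJointlySaS α P X)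
    (A : κ → ι → ℂ) : IsJointlySaS α P (fun j ω => ∑ k, A j k * X k ω) := by
  obtain ⟨Γ, -, hΓ⟩ := h.exists_stableRep hα
  exact (hΓ.linear hα A).isJointlySaS hα

end

/-! ### The `α`-th power of the norm as a functional of the distribution -/

/-- The point of the unit circle with a given angle. -/
def circ (x : UnitAddCircle) : ℂ := AddCircle.toCircle x

@[fun_prop]
theorem continuous_circ : Continuous circ :=
  continuous_subtype_val.comp AddCircle.continuous_toCircle

@[fun_prop]
theorem measurable_circ : Measurable circ := continuous_circ.measurable

theorem norm_circ (x : UnitAddCircle) : ‖circ x‖ = 1 := Circle.norm_coe _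

theorem circ_add (x y : UnitAddCircle) : circ (x + y) = circ x * circ y := by
  simp [circ, AddCircle.toCircle_add]

theorem circ_zero : circ 0 = 1 := by simp [circ]

/-- The `α`-th absolute moment of `cos` over a period. -/
def cosMoment (α : ℝ) : ℝ≥0∞ :=
  ∫⁻ x : UnitAddCircle, ‖(circ x).re‖ₑ ^ α

theorem cosMoment_ne_top {α : ℝ} (hα : 0 < α) : cosMoment α ≠ ⊤ := by
  refine ((lintegral_mono (g := fun _ => 1) fun x => ?_).trans_lt (by simp)).ne
  refine ENNReal.rpow_le_one ((enorm_re_le _).trans ?_) hα.le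
  rw [← ofReal_norm, norm_circ]
  simp

theorem cosMoment_ne_zero (α : ℝ) : cosMoment α ≠ 0 := by
  have hc' : Continuous fun x : UnitAddCircle => ‖(circ x).re‖ₑ ^ α := by
    fun_prop
  intro h
  rw [cosMoment, lintegral_eq_zero_iff hc'.measurable] at h
  have := congrFun ((hc'.ae_eq_iff_eq _ continuous_const).1 h) 0
  simp [circ_zero] at this

/-- The phase of $z$ is absorbed by the rotation invariance of the measure on the circle, so only
$|z|$ survives. -/
theorem lintegral_toCircle_mul_re {α : ℝ} (hα : 0 < α) (z : ℂ) :
    ∫⁻ x : UnitAddCircle, ‖(circ x * z).re‖ₑ ^ α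
      = cosMoment α * ‖z‖ₑ ^ α := by
  rcases eq_or_ne z 0 with rfl | hz
  · simp [hα]
  have hn : ‖z‖ ≠ 0 := norm_ne_zero_iff.2 hz
  obtain ⟨y, hy⟩ : ∃ y : UnitAddCircle, circ y = z / ‖z‖ := by
    let w : Circle := ⟨z / ‖z‖, by
      simp [Submonoid.unitSphere, hn]⟩
    obtain ⟨y, hy⟩ := (AddCircle.homeomorphCircle (T := 1) one_ne_zero).surjective w
    refine ⟨y, ?_⟩
    rw [AddCircle.homeomorphCircle_apply] at hy
    rw [circ, hy]
  have hz' : z = (‖z‖ : ℂ) * circ y := by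
    rw [hy, mul_div_cancel₀]
    exact_mod_cast hn
  calc ∫⁻ x : UnitAddCircle, ‖(circ x * z).re‖ₑ ^ α
      = ∫⁻ x : UnitAddCircle, ‖(circ (x + y)).re‖ₑ ^ α * ‖z‖ₑ ^ α := by
        refine lintegral_congr fun x => ?_
        nth_rewrite 1 [hz']
        rw [mul_left_comm, Complex.re_ofReal_mul, enorm_mul, enorm_norm,
          ENNReal.mul_rpow_of_nonneg _ _ hα.le, mul_comm, circ_add]
    _ = _ := by
        rw [lintegral_mul_const _ (by fun_prop),
          lintegral_add_right_eq_self
            (fun x : UnitAddCircle => ‖(circ x).re‖ₑ ^ α) y, cosMoment]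

/-- The `α`-th power of the norm `‖X‖_α`, computed from the distribution of `X`. -/
def stablePow (α : ℝ) (P : Measure Ω) (X : Ω → ℂ) : ℝ≥0∞ :=
  (cosMoment α)⁻¹ * ∫⁻ x : UnitAddCircle,
    ENNReal.ofReal (-Real.log ‖cf P fun ω => circ x * X ω‖)

theorem StableRep.neg_log_norm_cf {ι E : Type*} [Fintype ι] [MeasurableSpace E] {α : ℝ}
    {P : Measure Ω} {X : ι → Ω → ℂ} {m : Measure E} {φ : ι → E → ℂ} (hα : 0 < α)
    (h : StableRep α P X m φ) (t : ι → ℂ) :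
    ENNReal.ofReal (-Real.log ‖cf P fun ω => ∑ k, t k * X k ω‖)
      = ∫⁻ x, ‖(∑ k, t k * φ k x).re‖ₑ ^ α ∂m := by
  rw [h.cf_eq, Complex.norm_real, Real.norm_of_nonneg (Real.exp_nonneg _), Real.log_exp, neg_neg,
    ENNReal.ofReal_toReal (h.sum_re_lt_top hα t).ne]

/-- By Tonelli, averaging over rotations turns $|\mathrm{Re}\,\cdot|^\alpha$ into $|\cdot|^\alpha$.
The left side is determined by the law of the combination, hence the right side is the same for all
representations, whichever spectral measure is chosen. -/
theorem StableRep.stablePow_eq {ι E : Type*} [Fintype ι] [MeasurableSpace E] {α : ℝ}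
    {P : Measure Ω} {X : ι → Ω → ℂ} {m : Measure E} {φ : ι → E → ℂ} (hα : 0 < α)
    (h : StableRep α P X m φ) (t : ι → ℂ) :
    stablePow α P (fun ω => ∑ k, t k * X k ω) = ∫⁻ x, ‖∑ k, t k * φ k x‖ₑ ^ α ∂m := by
  have hm := h.measurable
  have := h.sfinite
  have h1 : ∀ x : UnitAddCircle,
      ENNReal.ofReal (-Real.log ‖cf P fun ω => circ x * ∑ k, t k * X k ω‖)
        = ∫⁻ y, ‖(circ x * ∑ k, t k * φ k y).re‖ₑ ^ α ∂m := fun x => by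
    simp only [Finset.mul_sum, ← mul_assoc]
    exact h.neg_log_norm_cf hα fun k => circ x * t k
  rw [stablePow]
  simp only [h1]
  rw [lintegral_lintegral_swap (Measurable.aemeasurable (by fun_prop))]
  simp only [lintegral_toCircle_mul_re hα]
  rw [lintegral_const_mul _ (by fun_prop), ← mul_assoc,
    ENNReal.inv_mul_cancel (cosMoment_ne_zero α) (cosMoment_ne_top hα), one_mul]

/-! ### The stable norm -/

theorem cf_zero (P : Measure Ω) [IsProbabilityMeasure P] : cf P (fun _ => 0) = 1 := by
  simp [cf]

theorem stablePow_zero (α : ℝ) (P : Measure Ω) [IsProbabilityMeasure P] :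
    stablePow α P 0 = 0 := by
  simp [stablePow, cf_zero]

theorem IsJointlySaS.comp_linear {ι κ : Type} [Fintype ι] [Fintype κ] {α : ℝ} {P : Measure Ω}
    {X : ι → Ω → ℂ} {Y : κ → Ω → ℂ} (hα : 0 < α) (h : IsJointlySaS α P X) (A : κ → ι → ℂ)
    (hY : ∀ j, Y j = ∑ k, A j k • X k) : IsJointlySaS α P Y := by
  have : Y = fun j ω => ∑ k, A j k * X k ω := by
    funext j ω
    simp [hY]
  rw [this]
  exact h.linear hα A

section

variable {α : ℝ} {P : Measure Ω} {X Y : Ω → ℂ}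

/-- A symmetric stable complex random variable. -/
abbrev IsSaS (α : ℝ) (P : Measure Ω) (X : Ω → ℂ) : Prop := IsJointlySaS α P fun _ : Fin 1 => X

/-- The device for transferring inequalities: an inequality between $|ax_0+bx_1|^\alpha$ for several
$(a,b)$, integrated against `Γ`, becomes one between powers of stable norms. -/
theorem IsJointlySaS.exists_pair (hα : 0 < α) (h : IsJointlySaS α P ![X, Y]) :
    ∃ Γ : Measure (EuclideanSpace ℂ (Fin 2)),
      (∀ k, ∫⁻ x, ‖x k‖ₑ ^ α ∂Γ < ⊤) ∧
      ∀ a b : ℂ, stablePow α P (a • X + b • Y) = ∫⁻ x, ‖a * x 0 + b * x 1‖ₑ ^ α ∂Γ := by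
  obtain ⟨Γ, -, hΓ⟩ := h.exists_stableRep hα
  refine ⟨Γ, hΓ.lt_top, fun a b => ?_⟩
  have := hΓ.stablePow_eq hα ![a, b]
  simp only [Fin.sum_univ_two, Matrix.cons_val_zero, Matrix.cons_val_one] at this
  exact this

theorem IsSaS.exists_rep (hα : 0 < α) (h : IsSaS α P X) :
    ∃ Γ : Measure (EuclideanSpace ℂ (Fin 1)), (∫⁻ x, ‖x 0‖ₑ ^ α ∂Γ < ⊤) ∧
      (∀ a : ℂ, cf P (a • X) = ((Real.exp (-(∫⁻ x, ‖(a * x 0).re‖ₑ ^ α ∂Γ).toReal) : ℝ) : ℂ)) ∧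
      ∀ a : ℂ, stablePow α P (a • X) = ∫⁻ x, ‖a * x 0‖ₑ ^ α ∂Γ := by
  obtain ⟨Γ, -, hΓ⟩ := h.exists_stableRep hα
  refine ⟨Γ, hΓ.lt_top 0, fun a => ?_, fun a => ?_⟩
  · have := hΓ.cf_eq ![a]
    simp only [Fin.sum_univ_one, Matrix.cons_val_fin_one] at this
    exact this
  · have := hΓ.stablePow_eq hα ![a]
    simp only [Fin.sum_univ_one, Matrix.cons_val_fin_one] at this
    exact this

theorem IsSaS.stablePow_smul (hα : 0 < α) (h : IsSaS α P X) (a : ℂ) :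
    stablePow α P (a • X) = ‖a‖ₑ ^ α * stablePow α P X := by
  obtain ⟨Γ, -, -, h2⟩ := h.exists_rep hα
  have h1 := h2 1
  rw [one_smul] at h1
  have := EuclideanSpace.measurable_coord (ι := Fin 1)
  rw [h2, h1, ← lintegral_const_mul _ (by fun_prop)]
  refine lintegral_congr fun x => ?_
  rw [one_mul, enorm_mul, ENNReal.mul_rpow_of_nonneg _ _ hα.le]

theorem IsSaS.stablePow_lt_top (hα : 0 < α) (h : IsSaS α P X) : stablePow α P X < ⊤ := by
  obtain ⟨Γ, h1, -, h2⟩ := h.exists_rep hα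
  have := h2 1
  rw [one_smul] at this
  simpa [this] using h1

theorem IsSaS.smul (hα : 0 < α) (h : IsSaS α P X) (a : ℂ) : IsSaS α P (a • X) :=
  h.comp_linear hα (fun _ _ => a) fun _ => by simp

theorem IsSaS.aemeasurable (h : IsSaS α P X) : AEMeasurable X P := h.1 0

theorem IsSaS.cf_eq (hα : 0 < α) (h : IsSaS α P X) :
    ∃ r : ℝ, 0 ≤ r ∧ r ≤ (stablePow α P X).toReal ∧ cf P X = ((Real.exp (-r) : ℝ) : ℂ) := by
  obtain ⟨Γ, h1, h2, h3⟩ := h.exists_rep hα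
  have h3 := h3 1
  have h2 := h2 1
  simp only [one_smul, one_mul] at h2 h3
  refine ⟨_, ENNReal.toReal_nonneg, ?_, h2⟩
  rw [h3]
  refine ENNReal.toReal_mono h1.ne (lintegral_mono fun x => ?_)
  exact ENNReal.rpow_le_rpow (enorm_re_le _) hα.le

/-- The norm of $X-X$ is zero, so every spectral measure of the pair $(X,X)$ lives on the diagonal
$x_0=x_1$. There the integrand of the covariation is $|x_0|^\alpha$. -/
theorem IsSaS.covariation_self [IsProbabilityMeasure P] (hα : 0 < α) (h : IsSaS α P X) :
    covariation α P X X = ((stablePow α P X).toReal : ℂ) := by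
  have hp : IsJointlySaS α P ![X, X] :=
    h.comp_linear hα (fun _ _ => 1) fun j => by fin_cases j <;> simp
  have hex := hp.2
  rw [covariation, dif_pos hex]
  have hspec := hex.choose_spec
  generalize hex.choose = Γ at hspec
  have hΓ := hspec.stableRep hα hp.1
  have hm := EuclideanSpace.measurable_coord (ι := Fin 2)
  have h0 : ∫⁻ x : EuclideanSpace ℂ (Fin 2), ‖x 0 - x 1‖ₑ ^ α ∂Γ = 0 := by
    have := hΓ.stablePow_eq hα ![1, -1]
    simp only [Fin.sum_univ_two, Matrix.cons_val_zero, Matrix.cons_val_one, one_mul, neg_mul,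
      ← sub_eq_add_neg, sub_self] at this
    rw [← this]
    exact stablePow_zero α P
  have h1 : ∫⁻ x : EuclideanSpace ℂ (Fin 2), ‖x 0‖ₑ ^ α ∂Γ = stablePow α P X := by
    have := hΓ.stablePow_eq hα ![1, 0]
    simp only [Fin.sum_univ_two, Matrix.cons_val_zero, Matrix.cons_val_one, one_mul, zero_mul,
      add_zero] at this
    rw [← this]
  rw [lintegral_eq_zero_iff (by fun_prop)] at h0
  have h2 : ∫ x : EuclideanSpace ℂ (Fin 2), x 0 * signedPow (α - 1) (x 1) ∂Γ
      = ∫ x : EuclideanSpace ℂ (Fin 2), ((‖x 0‖ ^ α : ℝ) : ℂ) ∂Γ := by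
    refine integral_congr_ae ?_
    filter_upwards [h0] with x hx
    have : x 0 = x 1 := by simpa [hα, hα.not_gt, sub_eq_zero] using hx
    rw [← this, mul_signedPow_self hα]
  rw [h2, integral_complex_ofReal, ← h1, integral_eq_lintegral_of_nonneg_ae]
  · simp only [ofReal_norm_rpow hα.le]
  · filter_upwards with x using by positivity
  · exact Measurable.aestronglyMeasurable (by fun_prop)

theorem IsSaS.stableNorm_eq [IsProbabilityMeasure P] (hα : 0 < α) (h : IsSaS α P X) :
    stableNorm α P X = stablePow α P X ^ (1 / α) := by
  rw [stableNorm, if_pos h, h.covariation_self hα, Complex.ofReal_re,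
    ← ENNReal.ofReal_rpow_of_nonneg ENNReal.toReal_nonneg (by positivity),
    ENNReal.ofReal_toReal (h.stablePow_lt_top hα).ne]

theorem IsSaS.stablePow_eq_rpow [IsProbabilityMeasure P] (hα : 0 < α) (h : IsSaS α P X) :
    stablePow α P X = stableNorm α P X ^ α := by
  rw [h.stableNorm_eq hα, ← ENNReal.rpow_mul, one_div_mul_cancel hα.ne', ENNReal.rpow_one]

theorem isSaS_of_stableNorm_lt_top (h : stableNorm α P X < ⊤) : IsSaS α P X := by
  by_contra h0
  rw [stableNorm, if_neg h0] at h
  exact lt_irrefl _ h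

theorem IsSaS.stableNorm_smul [IsProbabilityMeasure P] (hα : 0 < α) (h : IsSaS α P X) (a : ℂ) :
    stableNorm α P (a • X) = ‖a‖ₑ * stableNorm α P X := by
  rw [h.stableNorm_eq hα, (h.smul hα a).stableNorm_eq hα, h.stablePow_smul hα,
    ENNReal.mul_rpow_of_nonneg _ _ (by positivity), ← ENNReal.rpow_mul, mul_one_div_cancel hα.ne',
    ENNReal.rpow_one]

theorem IsJointlySaS.stableNorm_add_le [IsProbabilityMeasure P] (hα : 1 ≤ α) (h : IsJointlySaS α P ![X, Y]) :
    stableNorm α P (X + Y) ≤ stableNorm α P X + stableNorm α P Y := by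
  have hα0 : 0 < α := by linarith
  have hX : IsSaS α P X := h.comp_linear hα0 (fun _ => ![1, 0]) fun _ => by simp
  have hY : IsSaS α P Y := h.comp_linear hα0 (fun _ => ![0, 1]) fun _ => by simp
  have hXY : IsSaS α P (X + Y) := h.comp_linear hα0 (fun _ => ![1, 1]) fun _ => by simp
  obtain ⟨Γ, -, h2⟩ := h.exists_pair hα0
  have e1 := h2 1 0
  have e2 := h2 0 1
  have e3 := h2 1 1
  simp only [one_smul, zero_smul, add_zero, zero_add, one_mul, zero_mul] at e1 e2 e3
  rw [hX.stableNorm_eq hα0, hY.stableNorm_eq hα0, hXY.stableNorm_eq hα0, e1, e2, e3]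
  have hm := EuclideanSpace.measurable_coord (ι := Fin 2)
  refine le_trans ?_ (ENNReal.lintegral_Lp_add_le (by fun_prop) (by fun_prop) hα)
  gcongr with x
  exact enorm_add_le _ _

/-- Uniform convexity of the stable norm. -/
theorem exists_uniform_convexity_stablePow (hα : 1 < α) {ε : ℝ} (hε : 0 < ε) :
    ∃ C : ℝ, 0 ≤ C ∧ ∀ {X Y : Ω → ℂ}, IsJointlySaS α P ![X, Y] →
      stablePow α P (X - Y) + ENNReal.ofReal C * stablePow α P ((1 / 2 : ℂ) • (X + Y)) ≤
        ENNReal.ofReal (ε + C / 2) * (stablePow α P X + stablePow α P Y) := by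
  have hα0 : 0 < α := by linarith
  obtain ⟨C, hC, hineq⟩ := exists_uniform_convexity hα hε
  refine ⟨C, hC, fun {X Y} h => ?_⟩
  obtain ⟨Γ, -, h2⟩ := h.exists_pair hα0
  have e1 := h2 1 0
  have e2 := h2 0 1
  have e3 := h2 1 (-1)
  have e4 := h2 (1 / 2) (1 / 2)
  simp only [one_smul, zero_smul, add_zero, zero_add, one_mul, zero_mul, neg_smul, neg_mul,
    ← sub_eq_add_neg, ← smul_add] at e1 e2 e3 e4
  have hm := EuclideanSpace.measurable_coord (ι := Fin 2)
  rw [e1, e2, e3, e4, ← lintegral_const_mul _ (by fun_prop), ← lintegral_add_left (by fun_prop),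
    ← lintegral_add_left (by fun_prop), ← lintegral_const_mul _ (by fun_prop)]
  refine lintegral_mono fun x => ?_
  have h3 := hineq (x 0) (x 1)
  simp only [← ofReal_norm_rpow hα0.le]
  rw [← ENNReal.ofReal_mul hC, ← ENNReal.ofReal_add (by positivity) (by positivity),
    ← ENNReal.ofReal_add (by positivity) (by positivity), ← ENNReal.ofReal_mul (by positivity)]
  refine ENNReal.ofReal_le_ofReal ?_
  have e5 : (1 / 2 : ℂ) * x 0 + 1 / 2 * x 1 = (x 0 + x 1) / 2 := by ring
  rw [e5]
  nlinarith

/-! ### Continuity of the characteristic function in the stable norm -/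

theorem norm_cexp_I_mul_re (z : ℂ) : ‖Complex.exp (Complex.I * ((z.re : ℝ) : ℂ))‖ = 1 := by
  rw [mul_comm]
  exact Complex.norm_exp_ofReal_mul_I _

theorem norm_cexp_I_mul_re_sub_one_sq (z : ℂ) :
    ‖Complex.exp (Complex.I * ((z.re : ℝ) : ℂ)) - 1‖ ^ 2
      = 2 - 2 * (Complex.exp (Complex.I * ((z.re : ℝ) : ℂ))).re := by
  rw [← Complex.normSq_eq_norm_sq, Complex.normSq_sub, Complex.normSq_eq_norm_sq,
    norm_cexp_I_mul_re]
  simp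
  ring

/-- The difference is at most $E|e^{i\,\mathrm{Re}X}-1|$, whose square is at most
$E|e^{i\,\mathrm{Re}X}-1|^2=2-2e^{-r}\le2r$. No joint stability of $X$ and $Y$ is needed. -/
theorem IsSaS.norm_cf_add_sub_le [IsProbabilityMeasure P] (hα : 0 < α) (h : IsSaS α P X) (hY : AEMeasurable Y P) :
    ‖cf P (Y + X) - cf P Y‖ ≤ √(2 * (stablePow α P X).toReal) := by
  have hX := h.aemeasurable
  obtain ⟨r, hr0, hr, hcf⟩ := h.cf_eq hα
  have hb : ∀ {Z : Ω → ℂ}, AEMeasurable Z P →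
      Integrable (fun ω => Complex.exp (Complex.I * (((Z ω).re : ℝ) : ℂ))) P := fun {Z} hZ => by
    refine Integrable.of_bound (C := 1) (AEMeasurable.aestronglyMeasurable (by fun_prop)) ?_
    filter_upwards with ω
    rw [norm_cexp_I_mul_re]
  set D : Ω → ℂ := fun ω => Complex.exp (Complex.I * (((X ω).re : ℝ) : ℂ)) - 1 with hD
  have hDm : AEMeasurable D P := by fun_prop
  have hDi : Integrable D P := (hb hX).sub (integrable_const _)
  have h1 : cf P (Y + X) - cf P Y
      = ∫ ω, Complex.exp (Complex.I * (((Y ω).re : ℝ) : ℂ)) * D ω ∂P := by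
    rw [cf, cf, ← integral_sub (hb (hY.add hX)) (hb hY)]
    congr with ω
    simp only [hD, Pi.add_apply, Complex.add_re, Complex.ofReal_add, mul_add, Complex.exp_add]
    ring
  have h2 : ‖cf P (Y + X) - cf P Y‖ ≤ ∫ ω, ‖D ω‖ ∂P := by
    rw [h1]
    refine (norm_integral_le_integral_norm _).trans (le_of_eq ?_)
    congr with ω
    rw [norm_mul, norm_cexp_I_mul_re, one_mul]
  have hsq : (fun ω => ‖D ω‖ ^ 2)
      = fun ω => 2 - 2 * (Complex.exp (Complex.I * (((X ω).re : ℝ) : ℂ))).re := by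
    funext ω
    exact norm_cexp_I_mul_re_sub_one_sq _
  have hi2 : Integrable (fun ω => ‖D ω‖ ^ 2) P := by
    rw [hsq]
    exact (integrable_const _).sub ((hb hX).re.const_mul 2)
  have h3 : ∫ ω, ‖D ω‖ ^ 2 ∂P = 2 - 2 * Real.exp (-r) := by
    have hi : Integrable (fun ω => (Complex.exp (Complex.I * (((X ω).re : ℝ) : ℂ))).re) P :=
      (hb hX).re
    have : ∫ ω, (Complex.exp (Complex.I * (((X ω).re : ℝ) : ℂ))).re ∂P = (cf P X).re :=
      integral_re (hb hX)
    rw [hsq, integral_sub (integrable_const _) (hi.const_mul 2), integral_const_mul]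
    rw [this, hcf, Complex.ofReal_re]
    simp
  -- Nonnegativity of the variance of $|D|$.
  have h4 : (∫ ω, ‖D ω‖ ∂P) ^ 2 ≤ ∫ ω, ‖D ω‖ ^ 2 ∂P := by
    set c := ∫ ω, ‖D ω‖ ∂P
    have h5 : 0 ≤ ∫ ω, (‖D ω‖ - c) ^ 2 ∂P := integral_nonneg fun ω => sq_nonneg _
    have h6 : ∫ ω, (‖D ω‖ - c) ^ 2 ∂P = ∫ ω, ‖D ω‖ ^ 2 ∂P - c ^ 2 := by
      have : (fun ω => (‖D ω‖ - c) ^ 2) = fun ω => ‖D ω‖ ^ 2 - (2 * c * ‖D ω‖ - c ^ 2) := by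
        funext ω; ring
      have hi3 : Integrable (fun ω => 2 * c * ‖D ω‖) P := hDi.norm.const_mul _
      have hi4 : Integrable (fun ω => 2 * c * ‖D ω‖ - c ^ 2) P := hi3.sub (integrable_const _)
      rw [this, integral_sub hi2 hi4, integral_sub hi3 (integrable_const _), integral_const_mul]
      simp
      ring
    linarith
  refine h2.trans (Real.le_sqrt_of_sq_le ?_)
  have := Real.add_one_le_exp (-r)
  linarith

theorem norm_cf_add_sum_sub_le [IsProbabilityMeasure P] (hα : 0 < α) {κ : Type*} (s : Finset κ) {D : κ → Ω → ℂ}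
    (hD : ∀ k ∈ s, IsSaS α P (D k)) (hY : AEMeasurable Y P) :
    ‖cf P (Y + ∑ k ∈ s, D k) - cf P Y‖ ≤ ∑ k ∈ s, √(2 * (stablePow α P (D k)).toReal) := by
  classical
  induction s using Finset.induction_on with
  | empty => simp
  | insert k s hk ih =>
    rw [Finset.sum_insert hk, Finset.sum_insert hk]
    have ih := ih fun j hj => hD j (Finset.mem_insert_of_mem hj)
    have h1 := (hD k (Finset.mem_insert_self _ _)).norm_cf_add_sub_le hα
      (Y := Y + ∑ k ∈ s, D k) (hY.add (Finset.aemeasurable_sum _ fun j hj =>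
        (hD j (Finset.mem_insert_of_mem hj)).aemeasurable))
    have e : Y + (D k + ∑ j ∈ s, D j) = Y + ∑ j ∈ s, D j + D k := by abel
    rw [e]
    calc _ = ‖(cf P (Y + ∑ j ∈ s, D j + D k) - cf P (Y + ∑ j ∈ s, D j))
          + (cf P (Y + ∑ j ∈ s, D j) - cf P Y)‖ := by congr 1; ring
      _ ≤ _ := (norm_add_le _ _).trans (add_le_add h1 ih)

end

/-! ### Limits of stable vectors -/

theorem tendsto_cf_of_tendsto_ae {κ : Type*} {l : Filter κ} [l.IsCountablyGenerated]
    {P : Measure Ω} [IsProbabilityMeasure P] {X : κ → Ω → ℂ} {Y : Ω → ℂ}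
    (hX : ∀ k, AEMeasurable (X k) P) (h : ∀ᵐ ω ∂P, Tendsto (fun k => X k ω) l (𝓝 (Y ω))) :
    Tendsto (fun k => cf P (X k)) l (𝓝 (cf P Y)) := by
  refine tendsto_integral_filter_of_dominated_convergence (fun _ => 1) ?_ ?_
    (integrable_const _) ?_
  · exact Eventually.of_forall fun k =>
      AEMeasurable.aestronglyMeasurable (by have := hX k; fun_prop)
  · exact Eventually.of_forall fun k => Eventually.of_forall fun ω => (norm_cexp_I_mul_re _).le
  · filter_upwards [h] with ω hω
    have hc : Continuous fun z : ℂ => Complex.exp (Complex.I * ((z.re : ℝ) : ℂ)) := by fun_prop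
    exact (hc.tendsto _).comp hω

/-- If the joint characteristic functions of symmetric stable vectors converge to the joint
characteristic function of a vector, then this vector is symmetric stable. -/
theorem isJointlySaS_of_tendsto {ι : Type} [Fintype ι] {α : ℝ} (hα : 0 < α) (hα₂ : α ≤ 2)
    {P : Measure Ω} [IsProbabilityMeasure P] {X : ℕ → ι → Ω → ℂ} {Y : ι → Ω → ℂ}
    (hX : ∀ n, IsJointlySaS α P (X n)) (hY : ∀ k, AEMeasurable (Y k) P)
    (h : ∀ t : ι → ℂ, Tendsto (fun n => cf P fun ω => ∑ k, t k * X n k ω) atTop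
      (𝓝 (cf P fun ω => ∑ k, t k * Y k ω))) :
    IsJointlySaS α P Y := by
  classical
  choose Γ hΓ hrep using fun n => (hX n).exists_stableRep hα
  let S := Metric.sphere (0 : EuclideanSpace ℂ ι) 1
  have hSm : MeasurableSet S := Metric.isClosed_sphere.measurableSet
  have : CompactSpace S := isCompact_iff_compactSpace.1 (isCompact_sphere _ _)
  have hfin : ∀ n, IsFiniteMeasure ((Γ n).comap (Subtype.val : S → EuclideanSpace ℂ ι)) :=
    fun n => by
      have := (hΓ n).finite
      exact ⟨(Measure.comap_apply_le _ _ nullMeasurableSet_univ).trans_lt (measure_lt_top _ _)⟩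
  let μ : ℕ → FiniteMeasure S := fun n => ⟨(Γ n).comap Subtype.val, hfin n⟩
  have hcoord : ∀ k, Continuous fun x : S => (x : EuclideanSpace ℂ ι) k := fun k =>
    (EuclideanSpace.proj (𝕜 := ℂ) k).continuous.comp continuous_subtype_val
  let F : (ι → ℂ) → S → ℝ := fun t x => |(∑ k, t k * (x : EuclideanSpace ℂ ι) k).re| ^ α
  have hF : ∀ t, Continuous (F t) := fun t =>
    Continuous.rpow_const (by fun_prop) fun _ => Or.inr hα.le
  have hFi : ∀ (ν : FiniteMeasure S) t, Integrable (F t) (ν : Measure S) := fun ν t =>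
    (BoundedContinuousFunction.mkOfCompact ⟨F t, hF t⟩).integrable _
  let I : ℕ → (ι → ℂ) → ℝ := fun n t => ∫ x, F t x ∂(μ n : Measure S)
  have hcf : ∀ n t, cf P (fun ω => ∑ k, t k * X n k ω) = ((Real.exp (-I n t) : ℝ) : ℂ) := by
    intro n t
    have e1 : I n t = (∫⁻ x, ‖(∑ k, t k * x k).re‖ₑ ^ α ∂(Γ n)).toReal := by
      simp only [I]
      rw [integral_eq_lintegral_of_nonneg_ae
        (Eventually.of_forall fun x => by simp only [F]; positivity)
        (hF t).measurable.aestronglyMeasurable]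
      congr 1
      have e2 : (Γ n).restrict S = Γ n := Measure.restrict_eq_self_of_ae_mem (hΓ n).sphere
      rw [← e2, ← lintegral_subtype_comap hSm]
      refine lintegral_congr fun x => ?_
      simp only [F]
      rw [← Real.norm_eq_abs, ofReal_norm_rpow hα.le]
    rw [(hrep n).cf_eq, e1]
  have hscale : ∀ n (δ : ℝ) (t : ι → ℂ), 0 < δ → I n (fun k => (δ : ℂ) * t k) = δ ^ α * I n t := by
    intro n δ t hδ
    simp only [I]
    rw [← integral_const_mul]
    congr with x
    simp only [F, mul_assoc, ← Finset.mul_sum]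
    rw [Complex.re_ofReal_mul, abs_mul, abs_of_pos hδ, Real.mul_rpow hδ.le (abs_nonneg _)]
  -- The coefficients $1$ and $-i$ extract the real and the imaginary part of each coordinate.
  let T : Finset (ι → ℂ) := Finset.univ.image (fun k : ι => Pi.single k (1 : ℂ)) ∪
    Finset.univ.image (fun k : ι => Pi.single k (-Complex.I : ℂ))
  -- On the unit sphere the squares of the real coordinates add up to $1$, and $r^2\le|r|^\alpha$
  -- for $|r|\le1$ because $\alpha\le2$. Finitely many values of the exponent therefore control the
  -- total mass.
  have hmass : ∀ n, ((μ n).mass : ℝ) ≤ ∑ k, (I n (Pi.single k 1) + I n (Pi.single k (-Complex.I))) := by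
    intro n
    have e1 : ((μ n).mass : ℝ) = ∫ x : S, (1 : ℝ) ∂(μ n : Measure S) := by
      simp [FiniteMeasure.mass, measureReal_def]
      rfl
    simp only [I]
    rw [e1]
    simp only [← integral_add (hFi (μ n) _) (hFi (μ n) _)]
    have hint : ∀ k, Integrable (fun x => F (Pi.single k 1) x + F (Pi.single k (-Complex.I)) x)
        (μ n : Measure S) := fun k => (hFi (μ n) _).add (hFi (μ n) _)
    rw [← integral_finsetSum _ fun k _ => hint k]
    refine integral_mono (integrable_const _) (integrable_finsetSum _ fun k _ => hint k)
      fun x => ?_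
    have hx : ‖(x : EuclideanSpace ℂ ι)‖ = 1 := mem_sphere_zero_iff_norm.1 x.2
    have hx2 : ∑ k, ‖(x : EuclideanSpace ℂ ι) k‖ ^ 2 = 1 := by
      rw [← EuclideanSpace.norm_sq_eq, hx, one_pow]
    have hle : ∀ r : ℝ, |r| ≤ 1 → r ^ 2 ≤ |r| ^ α := fun r hr => by
      rw [← sq_abs, ← Real.rpow_natCast]
      rcases (abs_nonneg r).eq_or_lt with h0 | h0
      · simp [← h0, hα.ne']
      · exact Real.rpow_le_rpow_of_exponent_ge h0 hr (by simpa using hα₂)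
    change (1 : ℝ) ≤ ∑ k, (F (Pi.single k 1) x + F (Pi.single k (-Complex.I)) x)
    rw [← hx2]
    refine Finset.sum_le_sum fun k _ => ?_
    have e2 : F (Pi.single k 1) x = |((x : EuclideanSpace ℂ ι) k).re| ^ α := by
      have : ∑ j, (Pi.single k 1 : ι → ℂ) j * (x : EuclideanSpace ℂ ι) j
          = (x : EuclideanSpace ℂ ι) k := by simp [Pi.single_apply]
      simp only [F, this]
    have e3 : F (Pi.single k (-Complex.I)) x = |((x : EuclideanSpace ℂ ι) k).im| ^ α := by
      have : ∑ j, (Pi.single k (-Complex.I) : ι → ℂ) j * (x : EuclideanSpace ℂ ι) j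
          = -Complex.I * (x : EuclideanSpace ℂ ι) k := by simp [Pi.single_apply]
      simp only [F, this]
      simp
    have hk : ‖(x : EuclideanSpace ℂ ι) k‖ ≤ 1 := hx ▸ PiLp.norm_apply_le _ k
    rw [e2, e3, ← Complex.normSq_eq_norm_sq, Complex.normSq_apply, ← sq, ← sq]
    exact add_le_add (hle _ ((Complex.abs_re_le_norm _).trans hk))
      (hle _ ((Complex.abs_im_le_norm _).trans hk))
  -- The limit characteristic function is near $1$ at small arguments. Once $e^{-\delta^\alpha
  -- I_n(t)}>1/2>e^{-1}$, the exponent obeys $\delta^\alpha I_n(t)<1$; so the masses are eventually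
  -- bounded.
  obtain ⟨δ, hδ0, hδ⟩ : ∃ δ : ℝ, 0 < δ ∧ ∀ t ∈ T,
      1 / 2 < (cf P fun ω => ∑ k, (δ : ℂ) * t k * Y k ω).re := by
    have h1 : ∀ t ∈ T, ∀ᶠ δ : ℝ in 𝓝[>] 0,
        1 / 2 < (cf P fun ω => ∑ k, (δ : ℂ) * t k * Y k ω).re := fun t _ => by
      have h2 : Tendsto (fun δ : ℝ => cf P fun ω => ∑ k, (δ : ℂ) * t k * Y k ω) (𝓝[>] 0)
          (𝓝 (cf P fun ω => 0)) := by
        refine tendsto_cf_of_tendsto_ae (fun δ => by fun_prop) (Eventually.of_forall fun ω => ?_)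
        have hc : Continuous fun δ : ℝ => ∑ k, (δ : ℂ) * t k * Y k ω := by fun_prop
        have := hc.tendsto 0
        simp only [Complex.ofReal_zero, zero_mul, Finset.sum_const_zero] at this
        exact this.mono_left nhdsWithin_le_nhds
      rw [cf_zero] at h2
      have h3 := (Complex.continuous_re.tendsto _).comp h2
      exact h3.eventually (lt_mem_nhds (by norm_num))
    have h2 := (Finset.eventually_all T).2 h1
    obtain ⟨δ, hδ, hδ'⟩ := (h2.and self_mem_nhdsWithin).exists
    exact ⟨δ, hδ', hδ⟩
  have hev : ∀ᶠ n in atTop, ∀ t ∈ T, I n t ≤ (δ ^ α)⁻¹ := by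
    refine (Finset.eventually_all T).2 fun t ht => ?_
    have h1 := (Complex.continuous_re.tendsto _).comp (h fun k => (δ : ℂ) * t k)
    filter_upwards [h1.eventually (lt_mem_nhds (hδ t ht))] with n hn
    simp only [Function.comp, hcf, Complex.ofReal_re] at hn
    rw [hscale n δ t hδ0] at hn
    have h2 : δ ^ α * I n t < 1 := by
      by_contra h3
      have := Real.exp_le_exp.2 (neg_le_neg (not_lt.1 h3))
      have h4 := Real.exp_neg_one_lt_half
      linarith
    rw [← one_div, le_div_iff₀ (by positivity)]
    linarith
  let C : NNReal := Real.toNNReal (∑ _k : ι, ((δ ^ α)⁻¹ + (δ ^ α)⁻¹))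
  have hmem : ∀ᶠ n in atTop, μ n ∈ {ν : FiniteMeasure S | ν.mass ≤ C} := by
    filter_upwards [hev] with n hn
    have h1 := hmass n
    have h2 : ∑ k, (I n (Pi.single k 1) + I n (Pi.single k (-Complex.I)))
        ≤ ∑ _k : ι, ((δ ^ α)⁻¹ + (δ ^ α)⁻¹) :=
      Finset.sum_le_sum fun k _ => add_le_add
        (hn _ (Finset.mem_union_left _ (Finset.mem_image_of_mem _ (Finset.mem_univ k))))
        (hn _ (Finset.mem_union_right _ (Finset.mem_image_of_mem _ (Finset.mem_univ k))))
    exact NNReal.le_toNNReal_of_coe_le (h1.trans h2)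
  -- Measures of bounded mass on a compact space form a compact set, so along an ultrafilter the
  -- spectral measures converge. The limit `ν` represents `Y`, since the exponents are integrals of
  -- continuous functions.
  let U : Ultrafilter ℕ := hyperfilter ℕ
  have hU : (U : Filter ℕ) ≤ atTop := Nat.hyperfilter_le_atTop
  obtain ⟨ν, -, hν⟩ := (isCompact_setOfPred_finiteMeasure_le_of_compactSpace S C).ultrafilter_le_nhds
    (U.map μ) (by
      rw [le_principal_iff]
      exact hU hmem)
  have hν' : Tendsto μ U (𝓝 ν) := hν
  have hrepY : StableRep α P Y (ν : Measure S) fun k x => (x : EuclideanSpace ℂ ι) k := by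
    refine ⟨hY, inferInstance, fun k => (hcoord k).measurable, fun k => ?_, fun t => ?_⟩
    · refine (lintegral_mono (g := fun _ => 1) fun x => ?_).trans_lt (by simp)
      refine ENNReal.rpow_le_one ?_ hα.le
      rw [← ofReal_norm, ← ENNReal.ofReal_one]
      refine ENNReal.ofReal_le_ofReal ((PiLp.norm_apply_le _ k).trans ?_)
      rw [mem_sphere_zero_iff_norm.1 x.2]
    · have h1 : Tendsto (fun n => I n t) U (𝓝 (∫ x, F t x ∂(ν : Measure S))) :=
        (FiniteMeasure.tendsto_iff_forall_integral_tendsto.1 hν')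
          (BoundedContinuousFunction.mkOfCompact ⟨F t, hF t⟩)
      have hc : Continuous fun r : ℝ => ((Real.exp (-r) : ℝ) : ℂ) := by fun_prop
      have h2 := (hc.tendsto _).comp h1
      have h3 := (h t).mono_left hU
      simp only [hcf] at h3
      rw [tendsto_nhds_unique h3 h2]
      congr 3
      rw [integral_eq_lintegral_of_nonneg_ae
        (Eventually.of_forall fun x => by simp only [F]; positivity)
        (hF t).measurable.aestronglyMeasurable]
      simp only [F, ← Real.norm_eq_abs, ofReal_norm_rpow hα.le]
  exact hrepY.isJointlySaS hα

/-! ### Spaces of jointly stable random variables -/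

/-- All finite families of elements of `V` are jointly symmetric stable. -/
def SaSSpace (α : ℝ) (P : Measure Ω) (V : Submodule ℂ (Ω → ℂ)) : Prop :=
  ∀ (n : ℕ) (X : Fin n → Ω → ℂ), (∀ k, X k ∈ V) → IsJointlySaS α P X

section

variable {α : ℝ} {P : Measure Ω} {V : Submodule ℂ (Ω → ℂ)}

theorem SaSSpace.pair (hV : SaSSpace α P V) {X Y : Ω → ℂ} (hX : X ∈ V) (hY : Y ∈ V) :
    IsJointlySaS α P ![X, Y] :=
  hV 2 _ fun k => by fin_cases k <;> assumption

theorem SaSSpace.isSaS (hV : SaSSpace α P V) {X : Ω → ℂ} (hX : X ∈ V) : IsSaS α P X :=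
  hV 1 _ fun _ => hX

theorem mem_closedManifold_iff {Y : Ω → ℂ} : Y ∈ closedManifold α P (V : Set (Ω → ℂ)) ↔
    ∀ ε : ℝ≥0∞, 0 < ε → ∃ X ∈ V, stableNorm α P (Y - X) < ε := by
  simp [closedManifold]

/-- Membership in the closed manifold only says that each single difference $Y_k-X$ is stable and
small. Joint stability of the $Y_k$ comes from convergence of the joint characteristic functions,
which are continuous in the stable norm. -/
theorem SaSSpace.isJointlySaS_of_mem_closedManifold [IsProbabilityMeasure P] (hα : 0 < α)
    (hα₂ : α ≤ 2) (hV : SaSSpace α P V) {n : ℕ} {Y : Fin n → Ω → ℂ}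
    (hY : ∀ k, Y k ∈ closedManifold α P (V : Set (Ω → ℂ))) : IsJointlySaS α P Y := by
  have hex : ∀ (m : ℕ) k, ∃ X ∈ V, stableNorm α P (Y k - X) < ((m : ℝ≥0∞) + 1)⁻¹ := fun m k =>
    mem_closedManifold_iff.1 (hY k) _ (by simp)
  choose X hXV hX using hex
  have hD : ∀ m k, IsSaS α P (Y k - X m k) := fun m k =>
    isSaS_of_stableNorm_lt_top ((hX m k).trans_le le_top)
  have hXm : ∀ m k, AEMeasurable (X m k) P := fun m k => (hV.isSaS (hXV m k)).aemeasurable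
  have hYm : ∀ k, AEMeasurable (Y k) P := fun k => by
    have : Y k = (Y k - X 0 k) + X 0 k := by abel
    rw [this]
    exact (hD 0 k).aemeasurable.add (hXm 0 k)
  refine isJointlySaS_of_tendsto hα hα₂ (fun m => hV n (X m) (hXV m)) hYm fun t => ?_
  rw [tendsto_iff_norm_sub_tendsto_zero]
  have hb : ∀ m, ‖(cf P fun ω => ∑ k, t k * X m k ω) - cf P fun ω => ∑ k, t k * Y k ω‖
      ≤ ∑ k, √(2 * (stablePow α P (t k • (Y k - X m k))).toReal) := fun m => by
    rw [norm_sub_rev]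
    have h1 := norm_cf_add_sum_sub_le hα Finset.univ (D := fun k => t k • (Y k - X m k))
      (fun k _ => (hD m k).smul hα _) (Y := fun ω => ∑ k, t k * X m k ω)
      (by have := hXm m; fun_prop)
    have e : (fun ω => ∑ k, t k * Y k ω)
        = (fun ω => ∑ k, t k * X m k ω) + ∑ k, t k • (Y k - X m k) := ?_
    · rw [e]
      exact h1
    funext ω
    simp only [Pi.add_apply, Finset.sum_apply, Pi.smul_apply, Pi.sub_apply, smul_eq_mul]
    rw [← Finset.sum_add_distrib]
    exact Finset.sum_congr rfl fun k _ => by ring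
  refine squeeze_zero (fun _ => norm_nonneg _) hb ?_
  have h0 : (0 : ℝ) = ∑ k : Fin n, √(2 * 0) := by simp
  rw [h0]
  refine tendsto_finsetSum _ fun k _ => ?_
  refine (Real.continuous_sqrt.tendsto _).comp (Tendsto.const_mul 2 ?_)
  have h1 : Tendsto (fun m : ℕ => ‖t k‖ₑ ^ α * (((m : ℝ≥0∞) + 1)⁻¹) ^ α) atTop (𝓝 0) := by
    have h2 : Tendsto (fun m : ℕ => ((m : ℝ≥0∞) + 1)⁻¹) atTop (𝓝 0) := by
      have := (tendsto_add_atTop_iff_nat 1).2 ENNReal.tendsto_inv_nat_nhds_zero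
      simpa using this
    have h3 := (ENNReal.continuous_rpow_const (y := α)).tendsto 0 |>.comp h2
    rw [ENNReal.zero_rpow_of_pos hα] at h3
    have h4 := ENNReal.Tendsto.const_mul (a := ‖t k‖ₑ ^ α) h3
      (Or.inr (ENNReal.rpow_ne_top_of_nonneg hα.le enorm_ne_top))
    simpa using h4
  have h2 : Tendsto (fun m => stablePow α P (t k • (Y k - X m k))) atTop (𝓝 0) := by
    refine tendsto_of_tendsto_of_tendsto_of_le_of_le tendsto_const_nhds h1 (fun _ => zero_le)
      fun m => ?_
    rw [(hD m k).stablePow_smul hα, (hD m k).stablePow_eq_rpow hα]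
    gcongr
    exact (hX m k).le
  exact (ENNReal.tendsto_toReal ENNReal.zero_ne_top).comp h2

/-- The closure of a space of jointly stable random variables in the stable norm. -/
def SaSSpace.closure [IsProbabilityMeasure P] (hα : 1 ≤ α) (hα₂ : α ≤ 2) (hV : SaSSpace α P V) :
    Submodule ℂ (Ω → ℂ) where
  carrier := closedManifold α P (V : Set (Ω → ℂ))
  zero_mem' := mem_closedManifold_iff.2 fun ε hε => ⟨0, V.zero_mem, by
    have hα0 : 0 < α := by linarith
    have h0 := hV.isSaS V.zero_mem
    rw [sub_zero, h0.stableNorm_eq hα0, stablePow_zero, ENNReal.zero_rpow_of_pos (by positivity)]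
    exact hε⟩
  add_mem' := by
    intro Y Y' hY hY'
    have hα0 : 0 < α := by linarith
    refine mem_closedManifold_iff.2 fun ε hε => ?_
    have hε2 : 0 < ε / 2 := ENNReal.half_pos hε.ne'
    obtain ⟨X, hX, h1⟩ := mem_closedManifold_iff.1 hY _ hε2
    obtain ⟨X', hX', h2⟩ := mem_closedManifold_iff.1 hY' _ hε2
    refine ⟨X + X', V.add_mem hX hX', ?_⟩
    have hsub : ∀ Z ∈ V, Z ∈ closedManifold α P (V : Set (Ω → ℂ)) := fun Z hZ =>
      mem_closedManifold_iff.2 fun ε hε => ⟨Z, hZ, by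
        have h0 := hV.isSaS V.zero_mem
        rw [sub_self, h0.stableNorm_eq hα0, stablePow_zero,
          ENNReal.zero_rpow_of_pos (by positivity)]
        exact hε⟩
    -- Minkowski's inequality requires $Y-X$ and $Y'-X'$ to be jointly stable, so the four variables
    -- are treated together.
    have hJ := hV.isJointlySaS_of_mem_closedManifold hα0 hα₂ (Y := ![Y, Y', X, X']) fun k => by
      fin_cases k
      exacts [hY, hY', hsub _ hX, hsub _ hX']
    have hJ2 : IsJointlySaS α P ![Y - X, Y' - X'] :=
      hJ.comp_linear hα0 ![![1, 0, -1, 0], ![0, 1, 0, -1]] fun j => by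
        fin_cases j <;> simp [Fin.sum_univ_four, sub_eq_add_neg]
    have e : Y + Y' - (X + X') = (Y - X) + (Y' - X') := by abel
    rw [e]
    calc _ ≤ _ := hJ2.stableNorm_add_le hα
      _ < ε / 2 + ε / 2 := ENNReal.add_lt_add h1 h2
      _ = ε := ENNReal.add_halves ε
  smul_mem' := by
    intro a Y hY
    have hα0 : 0 < α := by linarith
    refine mem_closedManifold_iff.2 fun ε hε => ?_
    obtain ⟨X, hX, h1⟩ := mem_closedManifold_iff.1 hY (ε / (‖a‖ₑ + 1))
      (ENNReal.div_pos hε.ne' (by simp))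
    refine ⟨a • X, V.smul_mem _ hX, ?_⟩
    rw [← smul_sub, (isSaS_of_stableNorm_lt_top (h1.trans_le le_top)).stableNorm_smul hα0]
    have h2 : (‖a‖ₑ + 1) * stableNorm α P (Y - X) < ε := by
      rw [mul_comm]
      exact (ENNReal.lt_div_iff_mul_lt (by simp) (by simp)).1 h1
    refine lt_of_le_of_lt ?_ h2
    gcongr
    exact le_self_add

variable [IsProbabilityMeasure P]

theorem SaSSpace.closure_saSSpace (hα : 1 ≤ α) (hα₂ : α ≤ 2) (hV : SaSSpace α P V) :
    SaSSpace α P (hV.closure hα hα₂) := fun _ _ hX =>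
  hV.isJointlySaS_of_mem_closedManifold (by linarith) hα₂ hX

theorem SaSSpace.mem_closure_iff (hα : 1 ≤ α) (hα₂ : α ≤ 2) (hV : SaSSpace α P V) {Y : Ω → ℂ} : Y ∈ hV.closure hα hα₂ ↔
    ∀ ε : ℝ≥0∞, 0 < ε → ∃ X ∈ V, stableNorm α P (Y - X) < ε :=
  mem_closedManifold_iff

end

/-! ### Sums of independent stable vectors. -/

section

variable {α : ℝ} {P : Measure Ω} {V : Submodule ℂ (Ω → ℂ)}

theorem IsSaS.neg_log_norm_cf_le {X : Ω → ℂ} (hα : 0 < α) (h : IsSaS α P X) :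
    -Real.log ‖cf P X‖ ≤ (stablePow α P X).toReal := by
  obtain ⟨r, -, hr, he⟩ := h.cf_eq hα
  rwa [he, Complex.norm_real, Real.norm_of_nonneg (Real.exp_nonneg _), Real.log_exp, neg_neg]

theorem IsSaS.cf_ne_zero {X : Ω → ℂ} (hα : 0 < α) (h : IsSaS α P X) : cf P X ≠ 0 := by
  obtain ⟨r, -, -, he⟩ := h.cf_eq hα
  rw [he]
  exact_mod_cast (Real.exp_pos _).ne'

/-- Sums of independent stable vectors. -/
theorem StableRep.add {ι : Type*} {E : Type*} [Fintype ι] [MeasurableSpace E] (hα : 0 < α)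
    {X Y : ι → Ω → ℂ} {m m' : Measure E} {φ : ι → E → ℂ} (hX : StableRep α P X m φ)
    (hY : StableRep α P Y m' φ)
    (h : ∀ t : ι → ℂ, cf P ((fun ω => ∑ k, t k * X k ω) + fun ω => ∑ k, t k * Y k ω)
      = cf P (fun ω => ∑ k, t k * X k ω) * cf P fun ω => ∑ k, t k * Y k ω) :
    StableRep α P (fun k => X k + Y k) (m + m') φ where
  aemeasurable k := (hX.aemeasurable k).add (hY.aemeasurable k)
  sfinite := by
    have := hX.sfinite
    have := hY.sfinite
    infer_instance
  measurable := hX.measurable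
  lt_top k := by
    rw [lintegral_add_measure]
    exact ENNReal.add_lt_top.2 ⟨hX.lt_top k, hY.lt_top k⟩
  cf_eq t := by
    have e : (fun ω => ∑ k, t k * (X k + Y k) ω)
        = (fun ω => ∑ k, t k * X k ω) + fun ω => ∑ k, t k * Y k ω := by
      funext ω
      simp [mul_add, Finset.sum_add_distrib]
    rw [e, h, hX.cf_eq, hY.cf_eq, lintegral_add_measure,
      ENNReal.toReal_add (hX.sum_re_lt_top hα t).ne (hY.sum_re_lt_top hα t).ne, neg_add,
      Real.exp_add, Complex.ofReal_mul]

section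

variable {V₁ V₂ : Submodule ℂ (Ω → ℂ)}

/-- A family in the sum splits into two families whose spectral measures live on the same space with
the same coordinate functions. Factorization of the characteristic functions means that these
measures are added. -/
theorem SaSSpace.sup (hα : 0 < α) (h₁ : SaSSpace α P V₁) (h₂ : SaSSpace α P V₂)
    (h : ∀ X ∈ V₁, ∀ Y ∈ V₂, cf P (X + Y) = cf P X * cf P Y) : SaSSpace α P (V₁ ⊔ V₂) := by
  intro n Z hZ
  choose X hX Y hY hXY using fun k => Submodule.mem_sup.1 (hZ k)
  obtain ⟨Γ₁, -, hΓ₁⟩ := (h₁ n X hX).exists_stableRep hα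
  obtain ⟨Γ₂, -, hΓ₂⟩ := (h₂ n Y hY).exists_stableRep hα
  have hs : ∀ (W : Submodule ℂ (Ω → ℂ)) (X : Fin n → Ω → ℂ), (∀ k, X k ∈ W) → ∀ t : Fin n → ℂ,
      (fun ω => ∑ k, t k * X k ω) ∈ W := fun W X hX t => by
    have : (fun ω => ∑ k, t k * X k ω) = ∑ k, t k • X k := by
      funext ω
      simp
    rw [this]
    exact W.sum_mem fun k _ => W.smul_mem _ (hX k)
  have := (hΓ₁.add hα hΓ₂ fun t => h _ (hs _ _ hX t) _ (hs _ _ hY t)).isJointlySaS hα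
  convert this using 1
  funext k
  exact (hXY k).symm

theorem IsSaS.stablePow_add (hα : 0 < α) {X Y : Ω → ℂ} (h₁ : IsSaS α P X) (h₂ : IsSaS α P Y)
    (h : ∀ a : ℂ, cf P (a • X + a • Y) = cf P (a • X) * cf P (a • Y)) :
    stablePow α P (X + Y) = stablePow α P X + stablePow α P Y := by
  obtain ⟨Γ₁, -, hΓ₁⟩ := h₁.exists_stableRep hα
  obtain ⟨Γ₂, -, hΓ₂⟩ := h₂.exists_stableRep hα
  have h3 := hΓ₁.add hα hΓ₂ fun t => by
    have e : ∀ X : Ω → ℂ, (fun ω => ∑ k : Fin 1, t k * X ω) = t 0 • X := fun X => by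
      funext ω
      simp
    rw [e, e]
    exact h _
  have e1 := hΓ₁.stablePow_eq hα fun _ => 1
  have e2 := hΓ₂.stablePow_eq hα fun _ => 1
  have e3 := h3.stablePow_eq hα fun _ => 1
  simp only [Fin.sum_univ_one, one_mul] at e1 e2 e3
  rw [lintegral_add_measure, ← e1, ← e2] at e3
  exact e3

theorem stablePow_add_of_cf_add (hα : 0 < α) (h₁ : SaSSpace α P V₁) (h₂ : SaSSpace α P V₂)
    (h : ∀ X ∈ V₁, ∀ Y ∈ V₂, cf P (X + Y) = cf P X * cf P Y) {X Y : Ω → ℂ} (hX : X ∈ V₁)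
    (hY : Y ∈ V₂) : stablePow α P (X + Y) = stablePow α P X + stablePow α P Y :=
  (h₁.isSaS hX).stablePow_add hα (h₂.isSaS hY) fun a =>
    h _ (V₁.smul_mem a hX) _ (V₂.smul_mem a hY)

end

variable [IsProbabilityMeasure P]

theorem SaSSpace.le_closure (hα : 1 ≤ α) (hα₂ : α ≤ 2) (hV : SaSSpace α P V) :
    V ≤ hV.closure hα hα₂ := fun X hX =>
  (hV.mem_closure_iff hα hα₂).2 fun ε hε => ⟨X, hX, by
    have hα0 : 0 < α := by linarith
    rw [sub_self, (hV.isSaS V.zero_mem).stableNorm_eq hα0, stablePow_zero,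
      ENNReal.zero_rpow_of_pos (by positivity)]
    exact hε⟩

/-! ### Tails of stable random variables -/

/-- The tail is bounded by $\frac r2\left|\int_{-2/r}^{2/r}(1-\varphi(t))\,dt\right|$, and
$1-e^{-q}\le q\le|t|^\alpha\|X\|_\alpha^\alpha$. The interval has length $4/r$, whence the factor
$2$. -/
theorem IsSaS.measureReal_lt_abs_re_le {X : Ω → ℂ} (hα : 0 < α) (h : IsSaS α P X) {r : ℝ}
    (hr : 0 < r) :
    P.real {ω | r < |(X ω).re|} ≤ 2 * (2 / r) ^ α * (stablePow α P X).toReal := by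
  have hX := h.aemeasurable
  have hm : AEMeasurable (fun ω => (X ω).re) P := by fun_prop
  have : IsProbabilityMeasure (P.map fun ω => (X ω).re) := Measure.isProbabilityMeasure_map hm
  have h1 := measureReal_abs_gt_le_integral_charFun (μ := P.map fun ω => (X ω).re) hr
  have hcf : ∀ t : ℝ, charFun (P.map fun ω => (X ω).re) t = cf P ((t : ℂ) • X) := fun t => by
    rw [charFun_apply_real, integral_map hm (by fun_prop), cf]
    congr with ω
    congr 1
    simp
    ring
  have h2 : ∀ t ∈ uIoc (-2 * r⁻¹) (2 * r⁻¹), ‖1 - charFun (P.map fun ω => (X ω).re) t‖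
      ≤ (2 / r) ^ α * (stablePow α P X).toReal := fun t ht => by
    have hr' : 0 < r⁻¹ := inv_pos.2 hr
    rw [uIoc_of_le (by linarith)] at ht
    have ht' : |t| ≤ 2 / r := by
      rw [div_eq_mul_inv, abs_le]
      exact ⟨by linarith [ht.1], ht.2⟩
    obtain ⟨q, hq0, hq, he⟩ := (h.smul hα (t : ℂ)).cf_eq hα
    rw [hcf, he, ← Complex.ofReal_one, ← Complex.ofReal_sub, Complex.norm_real, Real.norm_eq_abs,
      abs_of_nonneg (by
        have := Real.exp_le_one_iff.2 (neg_nonpos.2 hq0)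
        linarith)]
    have h3 := Real.add_one_le_exp (-q)
    rw [h.stablePow_smul hα, ENNReal.toReal_mul, ← ofReal_norm_rpow hα.le,
      ENNReal.toReal_ofReal (by positivity), Complex.norm_real, Real.norm_eq_abs] at hq
    have h4 : |t| ^ α ≤ (2 / r) ^ α := by gcongr
    have h5 := mul_le_mul_of_nonneg_right h4 (ENNReal.toReal_nonneg (a := stablePow α P X))
    linarith
  have h3 := intervalIntegral.norm_integral_le_of_norm_le_const h2
  have e : P.real {ω | r < |(X ω).re|} = (P.map fun ω => (X ω).re).real {x | r < |x|} := by
    rw [measureReal_def, measureReal_def, Measure.map_apply_of_aemeasurable hm]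
    · rfl
    · exact measurableSet_lt measurable_const measurable_id.abs
  rw [e]
  refine h1.trans ((mul_le_mul_of_nonneg_left h3 (by positivity)).trans (le_of_eq ?_))
  rw [abs_of_nonneg (by have := inv_pos.2 hr; linarith)]
  field_simp
  ring

theorem IsSaS.measureReal_lt_abs_im_le {X : Ω → ℂ} (hα : 0 < α) (h : IsSaS α P X) {r : ℝ}
    (hr : 0 < r) :
    P.real {ω | r < |(X ω).im|} ≤ 2 * (2 / r) ^ α * (stablePow α P X).toReal := by
  have h1 := (h.smul hα (-Complex.I)).measureReal_lt_abs_re_le hα hr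
  rw [h.stablePow_smul hα] at h1
  rw [← ofReal_norm_rpow hα.le] at h1
  simpa using h1

theorem IsSaS.ae_eq_zero {X : Ω → ℂ} (hα : 0 < α) (h : IsSaS α P X)
    (h0 : stablePow α P X = 0) : X =ᵐ[P] 0 := by
  have h1 : ∀ n : ℕ, ∀ᵐ ω ∂P, |(X ω).re| ≤ 1 / ((n : ℝ) + 1) ∧ |(X ω).im| ≤ 1 / ((n : ℝ) + 1) := by
    intro n
    have hr : 0 < 1 / ((n : ℝ) + 1) := by positivity
    have h2 := h.measureReal_lt_abs_re_le hα hr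
    have h3 := h.measureReal_lt_abs_im_le hα hr
    rw [h0, ENNReal.toReal_zero, mul_zero] at h2 h3
    have h4 := (measureReal_eq_zero_iff).1 (le_antisymm h2 measureReal_nonneg)
    have h5 := (measureReal_eq_zero_iff).1 (le_antisymm h3 measureReal_nonneg)
    have h6 : ∀ᵐ ω ∂P, ¬ (1 / ((n : ℝ) + 1) < |(X ω).re|) := by
      rw [ae_iff]; simpa using h4
    have h7 : ∀ᵐ ω ∂P, ¬ (1 / ((n : ℝ) + 1) < |(X ω).im|) := by
      rw [ae_iff]; simpa using h5
    filter_upwards [h6, h7] with ω a b using ⟨not_lt.1 a, not_lt.1 b⟩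
  filter_upwards [ae_all_iff.2 h1] with ω hω
  have ht := tendsto_one_div_add_atTop_nhds_zero_nat (𝕜 := ℝ)
  have h2 : |(X ω).re| ≤ 0 := ge_of_tendsto' ht fun n => (hω n).1
  have h3 : |(X ω).im| ≤ 0 := ge_of_tendsto' ht fun n => (hω n).2
  exact Complex.ext (abs_nonpos_iff.1 h2) (abs_nonpos_iff.1 h3)

/-! ### Independent spaces -/

/-- Factorization survives limits because both sides are continuous in the stable norm. It will be
used once for each of the two factors. -/
theorem cf_add_of_mem_closedManifold (hα : 0 < α) {Z : Ω → ℂ} (hZ : AEMeasurable Z P)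
    (hVm : ∀ X ∈ V, AEMeasurable X P) (h : ∀ X ∈ V, cf P (X + Z) = cf P X * cf P Z) {Y : Ω → ℂ}
    (hY : Y ∈ closedManifold α P (V : Set (Ω → ℂ))) : cf P (Y + Z) = cf P Y * cf P Z := by
  have hb : ∀ ε : ℝ, 0 < ε → ∃ X ∈ V, IsSaS α P (Y - X) ∧
      √(2 * (stablePow α P (Y - X)).toReal) ≤ ε := fun ε hε => by
    obtain ⟨X, hX, h1⟩ := mem_closedManifold_iff.1 hY (ENNReal.ofReal ((ε ^ 2 / 2) ^ (1 / α)))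
      (by rw [ENNReal.ofReal_pos]; positivity)
    have hs := isSaS_of_stableNorm_lt_top (h1.trans_le le_top)
    refine ⟨X, hX, hs, ?_⟩
    rw [Real.sqrt_le_left hε.le, hs.stablePow_eq_rpow hα]
    have h2 : stableNorm α P (Y - X) ^ α ≤ ENNReal.ofReal (ε ^ 2 / 2) := by
      calc _ ≤ ENNReal.ofReal ((ε ^ 2 / 2) ^ (1 / α)) ^ α := by gcongr
        _ = _ := by
          rw [ENNReal.ofReal_rpow_of_nonneg (by positivity) hα.le, ← Real.rpow_mul (by positivity),
            one_div_mul_cancel hα.ne', Real.rpow_one]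
    have h3 := ENNReal.toReal_mono ENNReal.ofReal_ne_top h2
    rw [ENNReal.toReal_ofReal (by positivity)] at h3
    linarith
  refine eq_of_forall_dist_le fun ε hε => ?_
  obtain ⟨X, hX, hs, hle⟩ := hb (ε / 2) (by positivity)
  have hXm := hVm X hX
  have h1 := hs.norm_cf_add_sub_le hα (Y := X + Z) (hXm.add hZ)
  have h2 := hs.norm_cf_add_sub_le hα (Y := X) hXm
  have e1 : X + Z + (Y - X) = Y + Z := by abel
  have e2 : X + (Y - X) = Y := by abel
  rw [e1, h X hX] at h1
  rw [e2] at h2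
  have hc : ‖cf P Z‖ ≤ 1 := by
    refine (norm_integral_le_of_norm_le_const (C := 1) (Eventually.of_forall fun ω =>
      (norm_cexp_I_mul_re _).le)).trans ?_
    simp
  rw [dist_eq_norm]
  calc ‖cf P (Y + Z) - cf P Y * cf P Z‖
      = ‖(cf P (Y + Z) - cf P X * cf P Z) - (cf P Y - cf P X) * cf P Z‖ := by congr 1; ring
    _ ≤ ‖cf P (Y + Z) - cf P X * cf P Z‖ + ‖cf P Y - cf P X‖ * ‖cf P Z‖ := by
        rw [← norm_mul]; exact norm_sub_le _ _
    _ ≤ ε / 2 + ε / 2 * 1 := by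
        gcongr
        · exact h1.trans hle
        · exact h2.trans hle
    _ = ε := by ring

/-! ### Completeness -/

/-- Lower semicontinuity of the norm up to a constant. For each rotation $-\log|\varphi|\le c$
passes to the limit; averaging over the circle, of total mass $1$, costs only the factor
$1/$`cosMoment`, which is harmless for completeness. -/
theorem isSaS_and_stablePow_le_of_tendsto_ae (hα : 0 < α) (hα₂ : α ≤ 2) {D : ℕ → Ω → ℂ}
    {Y : Ω → ℂ} (hD : ∀ n, IsSaS α P (D n)) (hlim : ∀ᵐ ω ∂P, Tendsto (fun n => D n ω) atTop (𝓝 (Y ω)))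
    {c : ℝ≥0∞} (hc : c ≠ ⊤) (hle : ∀ n, stablePow α P (D n) ≤ c) :
    IsSaS α P Y ∧ stablePow α P Y ≤ (cosMoment α)⁻¹ * c := by
  have hDm : ∀ n, AEMeasurable (D n) P := fun n => (hD n).aemeasurable
  have hYm : AEMeasurable Y P := aemeasurable_of_tendsto_metrizable_ae _ hDm hlim
  have htend : ∀ a : ℂ, Tendsto (fun n => cf P (a • D n)) atTop (𝓝 (cf P (a • Y))) := fun a => by
    refine tendsto_cf_of_tendsto_ae (fun n => (hDm n).const_smul a) ?_
    filter_upwards [hlim] with ω hω using hω.const_smul a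
  have hY : IsSaS α P Y := by
    refine isJointlySaS_of_tendsto hα hα₂ hD (fun _ => hYm) fun t => ?_
    simp only [Fin.sum_univ_one]
    exact htend (t 0)
  refine ⟨hY, ?_⟩
  have hbound : ∀ x : UnitAddCircle,
      ENNReal.ofReal (-Real.log ‖cf P fun ω => circ x * Y ω‖) ≤ c := fun x => by
    refine ENNReal.ofReal_le_of_le_toReal ?_
    have h1 := ((htend (circ x)).norm.log (norm_ne_zero_iff.2 ((hY.smul hα _).cf_ne_zero hα))).neg
    refine le_of_tendsto' h1 fun n => ?_
    refine (((hD n).smul hα _).neg_log_norm_cf_le hα).trans (ENNReal.toReal_mono hc ?_)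
    rw [(hD n).stablePow_smul hα, ← ofReal_norm_rpow hα.le, norm_circ]
    simpa using hle n
  rw [stablePow]
  gcongr
  refine (lintegral_mono hbound).trans ?_
  simp

/-- A sequence of jointly stable random variables that is a Cauchy sequence in the stable norm
converges. -/
theorem SaSSpace.exists_limit (hα : 0 < α) (hα₂ : α ≤ 2) (hV : SaSSpace α P V) {X : ℕ → Ω → ℂ}
    (hX : ∀ n, X n ∈ V)
    (hc : ∀ ε : ℝ≥0∞, 0 < ε → ∃ N, ∀ m ≥ N, ∀ n ≥ N, stablePow α P (X m - X n) ≤ ε) :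
    ∃ Y : Ω → ℂ, ∀ ε : ℝ≥0∞, 0 < ε → ∃ N, ∀ n ≥ N, IsSaS α P (Y - X n) ∧
      stablePow α P (Y - X n) ≤ ε := by
  have hXm : ∀ n, AEMeasurable (X n) P := fun n => (hV.isSaS (hX n)).aemeasurable
  have hXX : ∀ m n, IsSaS α P (X m - X n) := fun m n => hV.isSaS (V.sub_mem (hX m) (hX n))
  -- Chosen so that the tail bound at level $2^{-k}$ equals $2^{-k}$. Borel-Cantelli then makes a
  -- subsequence almost surely Cauchy.
  let δ : ℕ → ℝ := fun k => (1 / 2) ^ k / (2 * (2 / (1 / 2) ^ k) ^ α)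
  have hδ : ∀ k, 0 < δ k := fun k => by positivity
  choose N hN using fun k => hc (ENNReal.ofReal (δ k)) (by simpa using hδ k)
  let M : ℕ → ℕ := fun k => ∑ j ∈ Finset.range (k + 1), N j + k
  have hMmono : StrictMono M := strictMono_nat_of_lt_succ fun k => by
    simp only [M]
    rw [Finset.sum_range_succ _ (k + 1)]
    omega
  have hMN : ∀ k, N k ≤ M k := fun k => by
    have := Finset.single_le_sum (f := N) (fun j _ => Nat.zero_le _) (Finset.self_mem_range_succ k)
    simp only [M]; omega
  have hsmall : ∀ k, (stablePow α P (X (M (k + 1)) - X (M k))).toReal ≤ δ k := fun k => by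
    have h1 := hN k (M (k + 1)) ((hMN k).trans (hMmono.monotone (Nat.le_succ k))) (M k) (hMN k)
    have := ENNReal.toReal_mono ENNReal.ofReal_ne_top h1
    rwa [ENNReal.toReal_ofReal (hδ k).le] at this
  have hδe : ∀ k, 2 * (2 / (1 / 2) ^ k) ^ α * δ k = (1 / 2) ^ k := fun k => by
    simp only [δ]
    rw [mul_div_cancel₀]
    positivity
  have hpr : ∀ k : ℕ, 0 < ((1 : ℝ) / 2) ^ k := fun k => by positivity
  have hsum : ∑' k : ℕ, ENNReal.ofReal ((1 / 2 : ℝ) ^ k) ≠ ⊤ := by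
    rw [← ENNReal.ofReal_tsum_of_nonneg (fun k => (hpr k).le) summable_geometric_two]
    exact ENNReal.ofReal_ne_top
  have hBC : ∀ A : ℕ → Set Ω, (∀ k, P.real (A k) ≤ (1 / 2 : ℝ) ^ k) →
      ∀ᵐ ω ∂P, ∀ᶠ k in atTop, ω ∉ A k := fun A hA => by
    refine ae_eventually_notMem (ne_top_of_le_ne_top hsum (ENNReal.tsum_le_tsum fun k => ?_))
    rw [← ENNReal.ofReal_toReal (measure_ne_top P (A k))]
    exact ENNReal.ofReal_le_ofReal (hA k)
  have h1 := hBC (fun k => {ω | (1 / 2 : ℝ) ^ k < |((X (M (k + 1)) - X (M k)) ω).re|}) fun k =>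
    ((hXX _ _).measureReal_lt_abs_re_le hα (hpr k)).trans ((mul_le_mul_of_nonneg_left (hsmall k) (by positivity)).trans
      (hδe k).le)
  have h2 := hBC (fun k => {ω | (1 / 2 : ℝ) ^ k < |((X (M (k + 1)) - X (M k)) ω).im|}) fun k =>
    ((hXX _ _).measureReal_lt_abs_im_le hα (hpr k)).trans ((mul_le_mul_of_nonneg_left (hsmall k) (by positivity)).trans
      (hδe k).le)
  have hex : ∀ᵐ ω ∂P, ∃ l, Tendsto (fun k => X (M k) ω) atTop (𝓝 l) := by
    filter_upwards [h1, h2] with ω ha hb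
    obtain ⟨K, hK⟩ := eventually_atTop.1 (ha.and hb)
    have hcau : CauchySeq fun k => X (M (k + K)) ω := by
      refine cauchySeq_of_le_geometric (1 / 2) (2 * (1 / 2) ^ K) (by norm_num) fun k => ?_
      have h3 := hK (k + K) (Nat.le_add_left _ _)
      simp only [not_lt, Pi.sub_apply] at h3
      rw [dist_eq_norm, norm_sub_rev, show k + 1 + K = k + K + 1 by ring]
      refine (Complex.norm_le_abs_re_add_abs_im _).trans ?_
      have e : 2 * (1 / 2 : ℝ) ^ K * (1 / 2) ^ k = (1 / 2) ^ (k + K) + (1 / 2) ^ (k + K) := by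
        rw [pow_add]; ring
      rw [e]
      exact add_le_add h3.1 h3.2
    obtain ⟨l, hl⟩ := cauchySeq_tendsto_of_complete hcau
    exact ⟨l, (tendsto_add_atTop_iff_nat K).1 hl⟩
  classical
  let Y : Ω → ℂ := fun ω => if h : ∃ l, Tendsto (fun k => X (M k) ω) atTop (𝓝 l) then h.choose else 0
  have hY : ∀ᵐ ω ∂P, Tendsto (fun k => X (M k) ω) atTop (𝓝 (Y ω)) := by
    filter_upwards [hex] with ω hω
    simp only [Y, dif_pos hω]
    exact hω.choose_spec
  refine ⟨Y, fun ε hε => ?_⟩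
  have hcos := cosMoment_ne_zero α
  have hcos' := cosMoment_ne_top hα
  -- The factor `cosMoment α` cancels the constant lost in the limit; the minimum with $1$ keeps `c`
  -- finite when $\varepsilon=\infty$.
  obtain ⟨c, hc0, hctop, hcε⟩ : ∃ c : ℝ≥0∞, 0 < c ∧ c ≠ ⊤ ∧ (cosMoment α)⁻¹ * c ≤ ε := by
    refine ⟨cosMoment α * min ε 1, ?_, ?_, ?_⟩
    · exact ENNReal.mul_pos hcos (by simp [hε.ne'])
    · exact ENNReal.mul_ne_top hcos' (by simp)
    · rw [← mul_assoc, ENNReal.inv_mul_cancel hcos hcos', one_mul]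
      exact min_le_left _ _
  obtain ⟨K, hK⟩ := hc c hc0
  refine ⟨K, fun n hn => ?_⟩
  have h3 := isSaS_and_stablePow_le_of_tendsto_ae hα hα₂ (D := fun k => X (M (k + K)) - X n)
    (Y := Y - X n) (fun k => hXX _ _) (by
      filter_upwards [hY] with ω hω
      exact ((tendsto_add_atTop_iff_nat K).2 hω).sub_const _) hctop
    (fun k => hK _ ((Nat.le_add_left _ _).trans (hMmono.le_apply)) n hn)
  exact ⟨h3.1, h3.2.trans hcε⟩

end

/-! ### Matrices of stable forms -/

/-- The form `aᵀ W b^{<α-1>}`. -/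
def pform {T : ℕ} (α : ℝ) (W : Matrix (Fin T) (Fin T) ℂ) (a b : Fin T → ℂ) : ℂ :=
  a ⬝ᵥ (W *ᵥ vecSignedPow (α - 1) b)

/-- The form `aᵀ W b^{<α-1>}` is a sum of forms `(v · a) (v · b)^{<α-1>}` of rank one. -/
def IsStableMatrix {T : ℕ} (α : ℝ) (W : Matrix (Fin T) (Fin T) ℂ) : Prop :=
  ∃ (m : ℕ) (v : Fin m → Fin T → ℂ), ∀ a b : Fin T → ℂ,
    pform α W a b = ∑ i, (v i ⬝ᵥ a) * signedPow (α - 1) (v i ⬝ᵥ b)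

section

variable {T : ℕ} {α : ℝ} {W W' : Matrix (Fin T) (Fin T) ℂ}

theorem pform_add_left (a a' b : Fin T → ℂ) :
    pform α W (a + a') b = pform α W a b + pform α W a' b := add_dotProduct _ _ _

theorem pform_smul_left (z : ℂ) (a b : Fin T → ℂ) :
    pform α W (z • a) b = z * pform α W a b := smul_dotProduct _ _ _

theorem pform_add_matrix (a b : Fin T → ℂ) :
    pform α (W + W') a b = pform α W a b + pform α W' a b := by
  simp [pform, Matrix.add_mulVec]

theorem pform_eq_sum (a b : Fin T → ℂ) :
    pform α W a b = ∑ k, ∑ l, a k * W k l * signedPow (α - 1) (b l) := by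
  simp [pform, dotProduct, Matrix.mulVec, vecSignedPow, Finset.mul_sum, mul_assoc]

theorem alphaForm_eq_pform (w : ℝ → Matrix (Fin T) (Fin T) ℂ) (u : ℝ → Fin T → ℂ) (θ : ℝ) :
    alphaForm α w u θ = pform α (w θ) (u θ) (u θ) := rfl

theorem alphaForm_add_matrix (f g : ℝ → Matrix (Fin T) (Fin T) ℂ) (u : ℝ → Fin T → ℂ) (θ : ℝ) :
    alphaForm α (f + g) u θ = alphaForm α f u θ + alphaForm α g u θ :=
  pform_add_matrix _ _

theorem pform_smul_smul (hα : 0 < α) (z : ℂ) (a : Fin T → ℂ) :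
    pform α W (z • a) (z • a) = ((‖z‖ ^ α : ℝ) : ℂ) * pform α W a a := by
  rw [← mul_signedPow_self hα]
  simp only [pform_eq_sum, Pi.smul_apply, smul_eq_mul, signedPow_mul, Finset.mul_sum]
  refine Finset.sum_congr rfl fun k _ => Finset.sum_congr rfl fun l _ => by ring

theorem norm_pform_self_le (hα : 1 < α) (a : Fin T → ℂ) :
    ‖pform α W a a‖ ≤ (∑ k, ∑ l, ‖W k l‖) * ‖a‖ ^ α := by
  rw [pform_eq_sum, Finset.sum_mul]
  refine (norm_sum_le _ _).trans (Finset.sum_le_sum fun k _ => ?_)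
  rw [Finset.sum_mul]
  refine (norm_sum_le _ _).trans (Finset.sum_le_sum fun l _ => ?_)
  rw [norm_mul, norm_mul, norm_signedPow hα]
  have h1 : ‖a k‖ ≤ ‖a‖ := norm_le_pi_norm a k
  have h2 : ‖a l‖ ^ (α - 1) ≤ ‖a‖ ^ (α - 1) :=
    Real.rpow_le_rpow (norm_nonneg _) (norm_le_pi_norm a l) (by linarith)
  have h3 : ‖a‖ * ‖a‖ ^ (α - 1) = ‖a‖ ^ α := by
    rcases (norm_nonneg a).eq_or_lt with h | h
    · rw [← h]; simp [Real.zero_rpow (by linarith : α ≠ 0)]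
    · nth_rewrite 1 [← Real.rpow_one ‖a‖]
      rw [← Real.rpow_add h]; congr 1; ring
  calc ‖a k‖ * ‖W k l‖ * ‖a l‖ ^ (α - 1) ≤ ‖a‖ * ‖W k l‖ * ‖a‖ ^ (α - 1) := by gcongr
    _ = ‖W k l‖ * (‖a‖ * ‖a‖ ^ (α - 1)) := by ring
    _ = _ := by rw [h3]

/-- The diagonal values of the form of a stable matrix are nonnegative. -/
theorem IsStableMatrix.pform_self (hα : 0 < α) (h : IsStableMatrix α W) (a : Fin T → ℂ) :
    pform α W a a = (‖pform α W a a‖ : ℂ) ∧ (pform α W a a).re = ‖pform α W a a‖ := by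
  obtain ⟨m, v, hv⟩ := h
  have e : pform α W a a = ((∑ i, ‖v i ⬝ᵥ a‖ ^ α : ℝ) : ℂ) := by
    rw [hv]
    simp only [mul_signedPow_self hα]
    push_cast; rfl
  have h0 : 0 ≤ ∑ i, ‖v i ⬝ᵥ a‖ ^ α := Finset.sum_nonneg fun i _ => by positivity
  rw [e, Complex.norm_real, Real.norm_of_nonneg h0]
  exact ⟨rfl, rfl⟩

theorem IsStableMatrix.norm_pform_self (hα : 0 < α) {m : ℕ} {v : Fin m → Fin T → ℂ}
    (hv : ∀ a b : Fin T → ℂ, pform α W a b = ∑ i, (v i ⬝ᵥ a) * signedPow (α - 1) (v i ⬝ᵥ b))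
    (a : Fin T → ℂ) : ‖pform α W a a‖ = ∑ i, ‖v i ⬝ᵥ a‖ ^ α := by
  have e : pform α W a a = ((∑ i, ‖v i ⬝ᵥ a‖ ^ α : ℝ) : ℂ) := by
    rw [hv]
    simp only [mul_signedPow_self hα]
    push_cast; rfl
  have h0 : 0 ≤ ∑ i, ‖v i ⬝ᵥ a‖ ^ α := Finset.sum_nonneg fun i _ => by positivity
  rw [e, Complex.norm_real, Real.norm_of_nonneg h0]

theorem IsStableMatrix.enorm_add (hα : 0 < α) (h : IsStableMatrix α W) (h' : IsStableMatrix α W')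
    (a : Fin T → ℂ) : ‖pform α (W + W') a a‖ₑ = ‖pform α W a a‖ₑ + ‖pform α W' a a‖ₑ := by
  rw [pform_add_matrix, (h.pform_self hα a).1, (h'.pform_self hα a).1, ← Complex.ofReal_add]
  simp only [← ofReal_norm, Complex.norm_real, norm_norm]
  rw [Real.norm_of_nonneg (by positivity), ENNReal.ofReal_add (norm_nonneg _) (norm_nonneg _)]

theorem IsStableMatrix.add (h : IsStableMatrix α W) (h' : IsStableMatrix α W') :
    IsStableMatrix α (W + W') := by
  obtain ⟨m, v, hv⟩ := h
  obtain ⟨m', v', hv'⟩ := h'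
  refine ⟨m + m', Fin.append v v', fun a b => ?_⟩
  rw [pform_add_matrix, hv, hv', Fin.sum_univ_add]
  simp

/-- Minkowski's inequality. -/
theorem IsStableMatrix.rpow_add_le (hα : 1 ≤ α) (h : IsStableMatrix α W) (a b : Fin T → ℂ) :
    ‖pform α W (a + b) (a + b)‖ₑ ^ (1 / α)
      ≤ ‖pform α W a a‖ₑ ^ (1 / α) + ‖pform α W b b‖ₑ ^ (1 / α) := by
  have hα0 : 0 < α := by linarith
  obtain ⟨m, v, hv⟩ := h
  have e : ∀ c, ‖pform α W c c‖ₑ = ∑ i, ‖v i ⬝ᵥ c‖ₑ ^ α := fun c => by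
    rw [← ofReal_norm, IsStableMatrix.norm_pform_self hα0 hv,
      ENNReal.ofReal_sum_of_nonneg fun i _ => by positivity]
    simp only [ofReal_norm_rpow hα0.le]
  rw [e, e, e]
  refine le_trans ?_ (ENNReal.Lp_add_le _ _ _ hα)
  gcongr with i
  rw [dotProduct_add]
  exact enorm_add_le _ _

/-- A crude substitute for Hölder's inequality, sufficient for integrability of the mixed forms. -/
theorem IsStableMatrix.norm_pform_le (hα : 1 < α) (h : IsStableMatrix α W) (a b : Fin T → ℂ) :
    ‖pform α W a b‖ ≤ ‖pform α W a a‖ + ‖pform α W b b‖ := by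
  obtain ⟨m, v, hv⟩ := h
  rw [IsStableMatrix.norm_pform_self (by linarith) hv,
    IsStableMatrix.norm_pform_self (by linarith) hv, hv, ← Finset.sum_add_distrib]
  exact (norm_sum_le _ _).trans (Finset.sum_le_sum fun i _ => norm_mul_signedPow_le hα _ _)

theorem IsStableMatrix.norm_pform_add_le (hα₁ : 1 < α) (hα₂ : α ≤ 2) (h : IsStableMatrix α W)
    (a b : Fin T → ℂ) : ‖pform α W (a + b) (a + b)‖
      ≤ ‖pform α W a a‖ + α * (pform α W b a).re + 6 * ‖pform α W b b‖ := by
  obtain ⟨m, v, hv⟩ := h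
  rw [IsStableMatrix.norm_pform_self (by linarith) hv,
    IsStableMatrix.norm_pform_self (by linarith) hv,
    IsStableMatrix.norm_pform_self (by linarith) hv, hv, Complex.re_sum, Finset.mul_sum,
    Finset.mul_sum, ← Finset.sum_add_distrib, ← Finset.sum_add_distrib]
  refine Finset.sum_le_sum fun i _ => ?_
  rw [dotProduct_add]
  exact norm_add_rpow_le hα₁ hα₂ _ _

/-- Scalar strict monotonicity, applied to each rank one term: a zero sum of nonnegative terms
forces $v_i\cdot(a-b)=0$ for every $i$. This is the core of uniqueness. -/
theorem IsStableMatrix.re_pform_sub (hα : 1 < α) (h : IsStableMatrix α W) (a b : Fin T → ℂ) :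
    0 ≤ (pform α W (a - b) a - pform α W (a - b) b).re ∧
    ((pform α W (a - b) a - pform α W (a - b) b).re = 0 → pform α W (a - b) (a - b) = 0) := by
  obtain ⟨m, v, hv⟩ := h
  have e : (pform α W (a - b) a - pform α W (a - b) b).re
      = ∑ i, ((v i ⬝ᵥ a - v i ⬝ᵥ b) *
        (signedPow (α - 1) (v i ⬝ᵥ a) - signedPow (α - 1) (v i ⬝ᵥ b))).re := by
    rw [hv, hv, ← Finset.sum_sub_distrib, Complex.re_sum]
    simp only [dotProduct_sub, mul_sub]
  have h0 := fun i => re_sub_mul_signedPow_sub hα (v i ⬝ᵥ a) (v i ⬝ᵥ b)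
  rw [e]
  refine ⟨Finset.sum_nonneg fun i _ => (h0 i).1, fun hz => ?_⟩
  rw [Finset.sum_eq_zero_iff_of_nonneg fun i _ => (h0 i).1] at hz
  rw [hv]
  refine Finset.sum_eq_zero fun i hi => ?_
  rw [dotProduct_sub, (h0 i).2 (hz i hi), sub_self, zero_mul]

/-- The vectors $d_i^{1/\alpha}e_i$ work because $zz^{<\alpha-1>}=|z|^\alpha$ returns $d_i$. -/
theorem isStableMatrix_diagonal (hα : 0 < α) {d : Fin T → ℝ} (hd : ∀ k, 0 ≤ d k) :
    IsStableMatrix α (Matrix.diagonal fun k => ((d k : ℝ) : ℂ)) := by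
  refine ⟨T, fun i => Pi.single i ((d i ^ (1 / α) : ℝ) : ℂ), fun a b => ?_⟩
  rw [pform_eq_sum]
  refine Finset.sum_congr rfl fun k _ => ?_
  have e := mul_signedPow_self hα ((d k ^ (1 / α) : ℝ) : ℂ)
  rw [Complex.norm_real, Real.norm_of_nonneg (Real.rpow_nonneg (hd k) _), ← Real.rpow_mul (hd k),
    one_div_mul_cancel hα.ne', Real.rpow_one] at e
  rw [Finset.sum_eq_single k, Matrix.diagonal_apply_eq, single_dotProduct, single_dotProduct,
    signedPow_mul, ← e]
  · ring
  · intro l _ hl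
    rw [Matrix.diagonal_apply_ne _ hl.symm]
    simp
  · simp

-- For $\alpha=2$ the signed power is conjugation, the form is sesquilinear, and a positive
-- semidefinite matrix is a sum of matrices $vv^*$.
open scoped ComplexOrder in
theorem isStableMatrix_of_posSemidef (h : W.PosSemidef) : IsStableMatrix 2 W := by
  obtain ⟨m, v, hv⟩ := Matrix.posSemidef_iff_eq_sum_vecMulVec.1 h
  refine ⟨m, v, fun a b => ?_⟩
  have e1 : (2 - 1 : ℝ) = 1 := by norm_num
  have e2 : vecSignedPow (2 - 1) b = star b := by
    funext k
    simp [vecSignedPow, e1, signedPow_one_left]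
  rw [pform, e2, hv, Matrix.sum_mulVec, dotProduct_sum]
  refine Finset.sum_congr rfl fun i _ => ?_
  rw [Matrix.vecMulVec_mulVec, e1, signedPow_one_left, dotProduct_comm a, dotProduct_comm (v i) b]
  have e3 : star (v i) ⬝ᵥ star b = conj (b ⬝ᵥ v i) := by
    rw [Matrix.star_dotProduct_star]
    rfl
  simp [e3, mul_comm]

open scoped ComplexOrder in
theorem posSemidef_of_pform_nonneg
    (h : ∀ b : Fin T → ℂ, 0 ≤ (pform 2 W b b).re ∧ (pform 2 W b b).im = 0) : W.PosSemidef := by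
  have e1 : (2 - 1 : ℝ) = 1 := by norm_num
  have e2 : ∀ x : Fin T → ℂ, vecSignedPow (2 - 1) (star x) = x := fun x => by
    funext k
    simp [vecSignedPow, e1, signedPow_one_left]
  have h1 : ∀ x : Fin T → ℂ, 0 ≤ (star x ⬝ᵥ (W *ᵥ x)).re ∧ (star x ⬝ᵥ (W *ᵥ x)).im = 0 := fun x => by
    have := h (star x)
    rwa [pform, e2] at this
  rw [← Matrix.isPositive_toEuclideanLin_iff, LinearMap.isPositive_iff_complex]
  intro x
  have h2 : inner ℂ (W.toEuclideanLin x) x = conj (star x.ofLp ⬝ᵥ (W *ᵥ x.ofLp)) := by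
    rw [← inner_conj_symm, EuclideanSpace.inner_eq_star_dotProduct]
    simp [Matrix.toLpLin_apply, dotProduct_comm]
  have h3 := h1 x.ofLp
  rw [h2]
  refine ⟨?_, ?_⟩
  · apply Complex.ext
    · simp
    · simpa using h3.2
  · simpa using h3.1

end

/-! ### The spectral density consists of stable matrices -/

/-- Lebesgue measure on `(-π, π]`. -/
abbrev muC : Measure ℝ := volume.restrict (Ioc (-Real.pi) Real.pi)

/-- Lebesgue differentiation from the right: the averages of $\varphi$ over $(x,x+t]$ stay in the
closed cone `K`, hence so does their limit. The point $\pi$ has no room to its right and is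
discarded. -/
theorem ae_mem_of_forall_integral_mem {φ : ℝ → ℂ}
    (hφ : IntegrableOn φ (Ioc (-Real.pi) Real.pi)) {K : Set ℂ} (hK : IsClosed K)
    (hsc : ∀ r : ℝ, 0 < r → ∀ z ∈ K, (r : ℂ) * z ∈ K)
    (h : ∀ s t : ℝ, -Real.pi ≤ s → s ≤ t → t ≤ Real.pi → ∫ θ in Ioc s t, φ θ ∈ K) :
    ∀ᵐ θ ∂muC, φ θ ∈ K := by
  have hpi := Real.pi_pos
  have hle : -Real.pi ≤ Real.pi := by linarith
  have hi : IntervalIntegrable φ volume (-Real.pi) Real.pi :=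
    (intervalIntegrable_iff_integrableOn_Ioc_of_le hle).2 hφ
  have hne : ∀ᵐ x : ℝ, x ≠ Real.pi := by simp [ae_iff, measure_singleton]
  rw [ae_restrict_iff' measurableSet_Ioc]
  filter_upwards [hi.ae_hasDerivAt_integral, hne] with x hx hxne hxD
  have hd := hx (by rw [uIcc_of_le hle]; exact Ioc_subset_Icc_self hxD) (-Real.pi) left_mem_uIcc
  refine hK.mem_of_tendsto hd.tendsto_slope_zero_right ?_
  have hlt : 0 < Real.pi - x := sub_pos.2 (lt_of_le_of_ne hxD.2 hxne)
  filter_upwards [Ioo_mem_nhdsGT hlt] with t ht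
  have h1 : IntervalIntegrable φ volume (-Real.pi) (x + t) :=
    hi.mono_set (by
      rw [uIcc_of_le hle, uIcc_of_le (by linarith [hxD.1, ht.1])]
      exact Icc_subset_Icc_right (by linarith [ht.2]))
  have h2 : IntervalIntegrable φ volume (-Real.pi) x :=
    hi.mono_set (by
      rw [uIcc_of_le hle, uIcc_of_le (by linarith [hxD.1])]
      exact Icc_subset_Icc_right hxD.2)
  rw [intervalIntegral.integral_interval_sub_left h1 h2,
    intervalIntegral.integral_of_le (by linarith [ht.1])]
  have h3 := hsc t⁻¹ (inv_pos.2 ht.1) _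
    (h x (x + t) hxD.1.le (by linarith [ht.1]) (by linarith [ht.2]))
  rw [← Complex.real_smul] at h3
  exact h3

section

variable {α : ℝ} {P : Measure Ω} {T : ℕ} {Z : ℝ → Ω → Fin T → ℂ}
  {f : ℝ → Matrix (Fin T) (Fin T) ℂ}

theorem IsSaSProcess.increments (hα : 0 < α) (hZ : IsSaSProcess α P Z) {s t : ℝ}
    (hs : s ∈ Icc (-Real.pi) Real.pi) (ht : t ∈ Icc (-Real.pi) Real.pi) :
    IsJointlySaS α P fun (k : Fin T) ω => Z t ω k - Z s ω k := by
  have h := hZ 2 ![s, t] fun i => by fin_cases i <;> assumption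
  refine h.comp_linear hα
    (fun k p => if p.2 = k then (if p.1 = 1 then 1 else -1) else 0) fun k => ?_
  funext ω
  rw [Fintype.sum_prod_type, Fin.sum_univ_two]
  simp only [Pi.add_apply, Finset.sum_apply, Pi.smul_apply, smul_eq_mul, ite_mul, zero_mul,
    Finset.sum_ite_eq', Finset.mem_univ, if_true]
  simp
  ring

theorem IsSaSProcess.isSaS_dotProduct (hα : 0 < α) (hZ : IsSaSProcess α P Z) {s t : ℝ}
    (hs : s ∈ Icc (-Real.pi) Real.pi) (ht : t ∈ Icc (-Real.pi) Real.pi) (b : Fin T → ℂ) :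
    IsSaS α P fun ω => b ⬝ᵥ (Z t ω - Z s ω) :=
  (hZ.increments hα hs ht).comp_linear hα (fun _ => b) fun _ => by
    funext ω
    simp [dotProduct]

theorem HasSpectralDensity.stablePow_increment [IsProbabilityMeasure P] (hα : 0 < α)
    (hZ : IsSaSProcess α P Z) (hf : HasSpectralDensity α P Z f) {s t : ℝ} (hs : -Real.pi ≤ s)
    (hst : s ≤ t) (ht : t ≤ Real.pi) (b : Fin T → ℂ) :
    ((stablePow α P fun ω => b ⬝ᵥ (Z t ω - Z s ω)).toReal : ℂ)
      = ∫ θ in Ioc s t, pform α (f θ) b b := by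
  refine Eq.trans ?_ (hf.2 s t hs hst ht b b)
  exact (IsSaS.covariation_self hα
    (hZ.isSaS_dotProduct hα ⟨hs, hst.trans ht⟩ ⟨hs.trans hst, ht⟩ b)).symm

theorem HasSpectralDensity.integrable_pform (hf : HasSpectralDensity α P Z f) (a b : Fin T → ℂ) :
    IntegrableOn (fun θ => pform α (f θ) a b) (Ioc (-Real.pi) Real.pi) := by
  simp only [pform_eq_sum]
  exact integrable_finsetSum _ fun k _ => integrable_finsetSum _ fun l _ =>
    ((hf.1 k l).const_mul _).mul_const _

/-- The matrix integrated over $(s,t]$ has the integrated form, so statements about one matrix and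
one stable vector apply to an increment. -/
theorem integral_pform (hf : ∀ k l, IntegrableOn (fun θ => f θ k l) (Ioc (-Real.pi) Real.pi))
    {s t : ℝ} (hs : -Real.pi ≤ s) (ht : t ≤ Real.pi) (a b : Fin T → ℂ) :
    ∫ θ in Ioc s t, pform α (f θ) a b
      = pform α (Matrix.of fun k l => ∫ θ in Ioc s t, f θ k l) a b := by
  have hi : ∀ k l, IntegrableOn (fun θ => f θ k l) (Ioc s t) := fun k l =>
    (hf k l).mono_set (Ioc_subset_Ioc hs ht)
  simp only [pform_eq_sum]
  rw [integral_finsetSum _ fun k _ => integrable_finsetSum _ fun l _ =>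
    ((hi k l).const_mul _).mul_const _]
  refine Finset.sum_congr rfl fun k _ => ?_
  rw [integral_finsetSum _ fun l _ => ((hi k l).const_mul _).mul_const _]
  refine Finset.sum_congr rfl fun l _ => ?_
  rw [integral_mul_const, integral_const_mul, Matrix.of_apply]

theorem norm_convex_rpow_le (hα : 1 ≤ α) {r : ℝ} (h0 : 0 ≤ r) (h1 : r ≤ 1) (x y : ℂ) :
    ‖((1 - r : ℝ) : ℂ) * x + (r : ℂ) * y‖ ^ α ≤ (1 - r) * ‖x‖ ^ α + r * ‖y‖ ^ α := by
  have h2 : 0 ≤ 1 - r := by linarith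
  have h := (convexOn_rpow hα).2 (mem_Ici.2 (norm_nonneg x)) (mem_Ici.2 (norm_nonneg y)) h2 h0
    (by ring)
  simp only [smul_eq_mul] at h
  refine le_trans ?_ h
  refine Real.rpow_le_rpow (norm_nonneg _) ((norm_add_le _ _).trans (le_of_eq ?_)) (by linarith)
  rw [norm_mul, norm_mul, Complex.norm_real, Complex.norm_real, Real.norm_of_nonneg h2,
    Real.norm_of_nonneg h0]

theorem IsJointlySaS.stablePow_convex (hα : 1 ≤ α) {X Y : Ω → ℂ} (h : IsJointlySaS α P ![X, Y])
    {r : ℝ} (h0 : 0 ≤ r) (h1 : r ≤ 1) :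
    (stablePow α P (((1 - r : ℝ) : ℂ) • X + (r : ℂ) • Y)).toReal
      ≤ (1 - r) * (stablePow α P X).toReal + r * (stablePow α P Y).toReal := by
  have hα0 : 0 < α := by linarith
  obtain ⟨Γ, hfin, h2⟩ := h.exists_pair hα0
  have e1 := h2 1 0
  have e2 := h2 0 1
  simp only [one_smul, zero_smul, add_zero, zero_add, one_mul, zero_mul] at e1 e2
  have hm := EuclideanSpace.measurable_coord (ι := Fin 2)
  have h3 : stablePow α P (((1 - r : ℝ) : ℂ) • X + (r : ℂ) • Y)
      ≤ ENNReal.ofReal (1 - r) * stablePow α P X + ENNReal.ofReal r * stablePow α P Y := by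
    rw [h2, e1, e2, ← lintegral_const_mul _ (by fun_prop), ← lintegral_const_mul _ (by fun_prop),
      ← lintegral_add_left (by fun_prop)]
    refine lintegral_mono fun x => ?_
    have := norm_convex_rpow_le hα h0 h1 (x 0) (x 1)
    simp only [← ofReal_norm_rpow hα0.le]
    rw [← ENNReal.ofReal_mul (by linarith), ← ENNReal.ofReal_mul h0,
      ← ENNReal.ofReal_add (by have : 0 ≤ 1 - r := by linarith
                               positivity) (by positivity)]
    exact ENNReal.ofReal_le_ofReal this
  have hX : stablePow α P X ≠ ⊤ := by rw [e1]; exact (hfin 0).ne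
  have hY : stablePow α P Y ≠ ⊤ := by rw [e2]; exact (hfin 1).ne
  have hX' := ENNReal.mul_ne_top (ENNReal.ofReal_ne_top (r := 1 - r)) hX
  have hY' := ENNReal.mul_ne_top (ENNReal.ofReal_ne_top (r := r)) hY
  have h4 := ENNReal.toReal_mono (ENNReal.add_ne_top.2 ⟨hX', hY'⟩) h3
  rwa [ENNReal.toReal_add hX' hY', ENNReal.toReal_mul, ENNReal.toReal_mul,
    ENNReal.toReal_ofReal (by linarith), ENNReal.toReal_ofReal h0] at h4

/-- For `α < 2` a matrix whose form is the norm of the linear combinations of a stable vector is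
diagonal. -/
theorem apply_eq_zero_of_stablePow (hα₁ : 1 < α) (hα₂ : α < 2) {X : Fin T → Ω → ℂ}
    (hX : IsJointlySaS α P X) {A : Matrix (Fin T) (Fin T) ℂ}
    (hA : ∀ b : Fin T → ℂ, ((stablePow α P fun ω => b ⬝ᵥ fun k => X k ω).toReal : ℂ)
      = pform α A b b) {l k : Fin T} (hlk : l ≠ k) : A l k = 0 := by
  have hα0 : 0 < α := by linarith
  -- Along this line the form contains $A_{lk}z^{<\alpha-1>}$, of order $|z|^{\alpha-1}$. A convex
  -- function cannot have such a term with $\alpha-1<1$ pointing upwards in some direction at $z=0$.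
  let b : ℂ → Fin T → ℂ := fun z => Pi.single l 1 + z • Pi.single k 1
  have hbl : ∀ z, b z l = 1 := fun z => by simp [b, hlk]
  have hbk : ∀ z, b z k = z := fun z => by simp [b, hlk.symm]
  have hbj : ∀ z j, j ≠ l → j ≠ k → b z j = 0 := fun z j h1 h2 => by simp [b, h1, h2]
  have hp1 : ∀ z i, pform α A (Pi.single i 1) (b z)
      = A i l + A i k * signedPow (α - 1) z := fun z i => by
    rw [pform_eq_sum, Finset.sum_eq_single i (fun j _ hj => by simp [hj]) (by simp),
      Finset.sum_eq_add l k hlk (fun j _ hj => by rw [hbj z j hj.1 hj.2, signedPow_zero, mul_zero])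
      (by simp) (by simp), hbl, hbk, signedPow_one]
    simp
  have hp : ∀ z, pform α A (b z) (b z) = A l l + A l k * signedPow (α - 1) z
      + (z * A k l + A k k * ((‖z‖ ^ α : ℝ) : ℂ)) := fun z => by
    have e : pform α A (b z) (b z) = pform α A (Pi.single l 1 + z • Pi.single k 1) (b z) := rfl
    rw [e, pform_add_left, pform_smul_left, hp1, hp1, ← mul_signedPow_self hα0]
    ring
  let F : ℂ → ℝ := fun z => (stablePow α P fun ω => b z ⬝ᵥ fun k => X k ω).toReal
  have hF : ∀ z, F z = (A l l).re + (A l k * signedPow (α - 1) z).re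
      + ((z * A k l).re + (A k k).re * ‖z‖ ^ α) := fun z => by
    have := congrArg Complex.re (hA (b z))
    rw [Complex.ofReal_re, hp] at this
    simp only [F]
    rw [this, Complex.add_re, Complex.add_re, Complex.add_re, Complex.re_mul_ofReal]
  -- The direction `u` aligns the phase, so that the singular term at $ru$ is exactly
  -- $r^{\alpha-1}|A_{lk}|$.
  obtain ⟨u, hu1, hu⟩ : ∃ u : ℂ, ‖u‖ = 1 ∧ A l k * conj u = (‖A l k‖ : ℂ) := by
    by_cases h0 : A l k = 0
    · exact ⟨1, by simp, by simp [h0]⟩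
    · have hn : (‖A l k‖ : ℂ) ≠ 0 := by simpa using h0
      refine ⟨A l k / ‖A l k‖, by simp [h0], ?_⟩
      rw [map_div₀, Complex.conj_ofReal, mul_div_assoc', Complex.mul_conj,
        Complex.normSq_eq_norm_sq]
      field_simp
      push_cast
      ring
  have hconv : ∀ r : ℝ, 0 ≤ r → r ≤ 1 → F (r * u) ≤ (1 - r) * F 0 + r * F u := fun r h0 h1 => by
    have hpair : IsJointlySaS α P ![fun ω => b 0 ⬝ᵥ fun k => X k ω, fun ω => b u ⬝ᵥ fun k => X k ω] :=
      hX.comp_linear hα0 ![b 0, b u] fun j => by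
        funext ω
        fin_cases j <;> simp [dotProduct]
    have := hpair.stablePow_convex hα₁.le h0 h1
    convert this using 3
    funext ω
    have e : b (r * u) = ((1 - r : ℝ) : ℂ) • b 0 + (r : ℂ) • b u := by
      funext j
      simp only [b, Pi.add_apply, Pi.smul_apply, smul_eq_mul]
      push_cast
      ring
    rw [e, add_dotProduct, smul_dotProduct, smul_dotProduct]
    rfl
  set C : ℝ := F u - F 0 + |(u * A k l).re| + |(A k k).re| with hC
  -- Convexity gives $F(ru)-F(0)\le r(F(u)-F(0))$, and the remaining terms of `F` are $O(r)$.
  -- Dividing by $r^{\alpha-1}$ leaves a bound that tends to $0$ with $r$.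
  have hkey : ∀ r : ℝ, 0 < r → r ≤ 1 → ‖A l k‖ ≤ C * r ^ (2 - α) := fun r h0 h1 => by
    have h2 := hconv r h0.le h1
    have h3 : (A l k * signedPow (α - 1) (r * u)).re = r ^ (α - 1) * ‖A l k‖ := by
      have e1 : signedPow (α - 1) (r * u) = ((r ^ (α - 1) : ℝ) : ℂ) * conj u := by
        have hr1 : r ^ (α - 1 - 1) * r = r ^ (α - 1) := by
          nth_rewrite 2 [← Real.rpow_one r]
          rw [← Real.rpow_add h0]; congr 1; ring
        rw [signedPow, norm_mul, hu1, mul_one, Complex.norm_real, Real.norm_of_nonneg h0.le,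
          map_mul, Complex.conj_ofReal, ← mul_assoc, ← Complex.ofReal_mul, hr1]
      rw [e1, mul_left_comm, hu, ← Complex.ofReal_mul, Complex.ofReal_re]
    have h4 : ((r : ℂ) * u * A k l).re = r * (u * A k l).re := by
      rw [mul_assoc, Complex.re_ofReal_mul]
    have h5 : ‖(r : ℂ) * u‖ ^ α = r ^ α := by
      rw [norm_mul, hu1, mul_one, Complex.norm_real, Real.norm_of_nonneg h0.le]
    have hF0 : F 0 = (A l l).re := by
      rw [hF]; simp [signedPow_zero, Real.zero_rpow hα0.ne']
    rw [hF (r * u), h3, h4, h5] at h2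
    have h6 : r ^ α ≤ r := by
      simpa using Real.rpow_le_rpow_of_exponent_ge h0 h1 hα₁.le
    have h7 : -((A k k).re * r ^ α) ≤ |(A k k).re| * r := by
      have h8 := neg_abs_le (A k k).re
      have h9 : 0 ≤ r ^ α := by positivity
      have h10 := abs_nonneg (A k k).re
      nlinarith
    have h8 : -(r * (u * A k l).re) ≤ r * |(u * A k l).re| := by
      have := neg_abs_le (u * A k l).re
      nlinarith
    have h9 : r ^ (α - 1) * ‖A l k‖ ≤ C * r := by
      rw [hC]; nlinarith
    have h10 : r = r ^ (2 - α) * r ^ (α - 1) := by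
      rw [← Real.rpow_add h0]
      norm_num
    have h11 : r ^ (α - 1) * ‖A l k‖ ≤ r ^ (α - 1) * (C * r ^ (2 - α)) := by
      calc _ ≤ C * r := h9
        _ = C * (r ^ (2 - α) * r ^ (α - 1)) := by rw [← h10]
        _ = _ := by ring
    exact le_of_mul_le_mul_left h11 (by positivity)
  have hlim : Tendsto (fun r : ℝ => C * r ^ (2 - α)) (𝓝[>] 0) (𝓝 0) := by
    have h1 : ContinuousAt (fun r : ℝ => C * r ^ (2 - α)) 0 :=
      continuousAt_const.mul (Real.continuousAt_rpow_const _ _ (Or.inr (by linarith)))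
    have h2 := h1.tendsto
    rw [Real.zero_rpow (by linarith : 2 - α ≠ 0), mul_zero] at h2
    exact h2.mono_left nhdsWithin_le_nhds
  have : ‖A l k‖ ≤ 0 := by
    refine ge_of_tendsto hlim ?_
    filter_upwards [Ioo_mem_nhdsGT (zero_lt_one' ℝ)] with r hr
    exact hkey r hr.1 hr.2.le
  exact norm_le_zero_iff.1 this

theorem isClosed_nonnegReal : IsClosed {z : ℂ | 0 ≤ z.re ∧ z.im = 0} :=
  (isClosed_le continuous_const Complex.continuous_re).inter
    (isClosed_eq Complex.continuous_im continuous_const)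

theorem HasSpectralDensity.ae_pform_nonneg [IsProbabilityMeasure P] (hα : 0 < α)
    (hZ : IsSaSProcess α P Z) (hf : HasSpectralDensity α P Z f) (b : Fin T → ℂ) :
    ∀ᵐ θ ∂muC, 0 ≤ (pform α (f θ) b b).re ∧ (pform α (f θ) b b).im = 0 := by
  refine ae_mem_of_forall_integral_mem (hf.integrable_pform b b) isClosed_nonnegReal ?_ ?_
  · rintro r hr z ⟨h1, h2⟩
    refine ⟨?_, ?_⟩
    · rw [Complex.re_ofReal_mul]; positivity
    · rw [Complex.im_ofReal_mul, h2, mul_zero]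
  · intro s t hs hst ht
    rw [← hf.stablePow_increment hα hZ hs hst ht b]
    exact ⟨by simp, by simp⟩

open scoped ComplexOrder in
/-- `w` is an integrable matrix function whose values are positive semidefinite matrices of stable
forms, diagonal in the case `α < 2`. -/
structure IsDensity {T : ℕ} (α : ℝ) (w : ℝ → Matrix (Fin T) (Fin T) ℂ) : Prop where
  integrable : ∀ k l, Integrable (fun θ => w θ k l) muC
  stable : ∀ᵐ θ ∂muC, IsStableMatrix α (w θ)
  posSemidef : ∀ᵐ θ ∂muC, (w θ).PosSemidef
  diag : α < 2 → ∀ᵐ θ ∂muC, ∀ l k, l ≠ k → w θ l k = 0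

open scoped ComplexOrder in
theorem IsDensity.add {g : ℝ → Matrix (Fin T) (Fin T) ℂ} (hf : IsDensity α f)
    (hg : IsDensity α g) : IsDensity α (f + g) where
  integrable k l := (hf.integrable k l).add (hg.integrable k l)
  stable := by
    filter_upwards [hf.stable, hg.stable] with θ h1 h2 using h1.add h2
  posSemidef := by
    filter_upwards [hf.posSemidef, hg.posSemidef] with θ h1 h2 using h1.add h2
  diag h := by
    filter_upwards [hf.diag h, hg.diag h] with θ h1 h2 l k hlk
    simp [h1 l k hlk, h2 l k hlk]

/-- Every integral of an off-diagonal entry over $(s,t]$ is an off-diagonal entry of the matrix of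
an increment, hence zero; differentiation gives the density. -/
theorem HasSpectralDensity.ae_apply_eq_zero [IsProbabilityMeasure P] (hα₁ : 1 < α) (hα₂ : α < 2)
    (hZ : IsSaSProcess α P Z) (hf : HasSpectralDensity α P Z f) :
    ∀ᵐ θ ∂muC, ∀ l k, l ≠ k → f θ l k = 0 := by
  have hα0 : 0 < α := by linarith
  refine ae_all_iff.2 fun l => ae_all_iff.2 fun k => ?_
  by_cases hlk : l = k
  · exact Eventually.of_forall fun θ h => absurd hlk h
  have := ae_mem_of_forall_integral_mem (hf.1 l k) (isClosed_singleton (x := (0 : ℂ)))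
    (fun r _ z hz => by rw [mem_singleton_iff.1 hz]; simp) fun s t hs hst ht => by
      refine apply_eq_zero_of_stablePow hα₁ hα₂ (A := Matrix.of fun k l => ∫ θ in Ioc s t, f θ k l)
        (hZ.increments hα0 ⟨hs, hst.trans ht⟩ ⟨hs.trans hst, ht⟩) (fun b => ?_) hlk
      rw [← integral_pform hf.1 hs ht]
      exact hf.stablePow_increment hα0 hZ hs hst ht b
  filter_upwards [this] with θ hθ _ using hθ

open scoped ComplexOrder in
theorem HasSpectralDensity.isDensity [IsProbabilityMeasure P] (hα₁ : 1 < α) (hα₂ : α ≤ 2)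
    (hZ : IsSaSProcess α P Z) (hf : HasSpectralDensity α P Z f) : IsDensity α f := by
  have hα0 : 0 < α := by linarith
  rcases hα₂.lt_or_eq with hlt | rfl
  · have h1 : ∀ᵐ θ ∂muC, ∀ k, 0 ≤ (f θ k k).re ∧ (f θ k k).im = 0 := by
      refine ae_all_iff.2 fun k => ?_
      filter_upwards [hf.ae_pform_nonneg hα0 hZ (Pi.single k 1)] with θ hθ
      have : pform α (f θ) (Pi.single k 1) (Pi.single k 1) = f θ k k := by
        rw [pform_eq_sum, Finset.sum_eq_single k (fun j _ hj => by simp [hj]) (by simp),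
          Finset.sum_eq_single k (fun j _ hj => by simp [hj, signedPow_zero]) (by simp)]
        simp [signedPow_one]
      rwa [this] at hθ
    have h2 := hf.ae_apply_eq_zero hα₁ hlt hZ
    have h3 : ∀ᵐ θ ∂muC, ∃ d : Fin T → ℝ, (∀ k, 0 ≤ d k) ∧
        f θ = Matrix.diagonal fun k => ((d k : ℝ) : ℂ) := by
      filter_upwards [h1, h2] with θ ha hb
      refine ⟨fun k => (f θ k k).re, fun k => (ha k).1, ?_⟩
      ext l k
      by_cases hlk : l = k
      · subst hlk
        rw [Matrix.diagonal_apply_eq]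
        exact Complex.ext (by simp) (by simp [(ha l).2])
      · rw [Matrix.diagonal_apply_ne _ hlk, hb l k hlk]
    refine ⟨hf.1, ?_, ?_, fun _ => h2⟩
    · filter_upwards [h3] with θ ⟨d, hd, e⟩
      rw [e]
      exact isStableMatrix_diagonal hα0 hd
    · filter_upwards [h3] with θ ⟨d, hd, e⟩
      rw [e]
      exact Matrix.PosSemidef.diagonal fun k => by simpa using hd k
  -- The exceptional null set depends on the test vector. A countable dense set of vectors has a
  -- common one, and for $\alpha=2$ the form is continuous in the vector.
  · have h1 : ∀ᵐ θ ∂muC, ∀ n, 0 ≤ (pform 2 (f θ) (TopologicalSpace.denseSeq (Fin T → ℂ) n)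
        (TopologicalSpace.denseSeq (Fin T → ℂ) n)).re ∧
        (pform 2 (f θ) (TopologicalSpace.denseSeq (Fin T → ℂ) n)
        (TopologicalSpace.denseSeq (Fin T → ℂ) n)).im = 0 :=
      ae_all_iff.2 fun n => hf.ae_pform_nonneg hα0 hZ _
    have h2 : ∀ᵐ θ ∂muC, (f θ).PosSemidef := by
      filter_upwards [h1] with θ hθ
      refine posSemidef_of_pform_nonneg fun b => ?_
      have e1 : (2 - 1 : ℝ) = 1 := by norm_num
      have hc : Continuous fun b : Fin T → ℂ => pform 2 (f θ) b b := by
        simp only [pform_eq_sum, e1, signedPow_one_left]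
        fun_prop
      have hcl : IsClosed {b : Fin T → ℂ |
          0 ≤ (pform 2 (f θ) b b).re ∧ (pform 2 (f θ) b b).im = 0} :=
        isClosed_nonnegReal.preimage hc
      have hsub : range (TopologicalSpace.denseSeq (Fin T → ℂ))
          ⊆ {b : Fin T → ℂ | 0 ≤ (pform 2 (f θ) b b).re ∧ (pform 2 (f θ) b b).im = 0} := by
        rintro _ ⟨n, rfl⟩
        exact hθ n
      have hd := TopologicalSpace.denseRange_denseSeq (Fin T → ℂ)
      exact (closure_minimal hsub hcl) (hd b)
    refine ⟨hf.1, ?_, h2, fun h => absurd h (lt_irrefl _)⟩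
    filter_upwards [h2] with θ h using isStableMatrix_of_posSemidef h

end

/-! ### The spaces `L^α(w)` -/

section

variable {T : ℕ} {α : ℝ} {w f g : ℝ → Matrix (Fin T) (Fin T) ℂ} {u v : ℝ → Fin T → ℂ}

theorem aestronglyMeasurable_pform (hw : ∀ k l, AEStronglyMeasurable (fun θ => w θ k l) muC)
    (hu : AEStronglyMeasurable u muC) (hv : AEStronglyMeasurable v muC) :
    AEStronglyMeasurable (fun θ => pform α (w θ) (u θ) (v θ)) muC := by
  simp only [pform_eq_sum]
  refine Finset.aestronglyMeasurable_fun_sum _ fun k _ =>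
    Finset.aestronglyMeasurable_fun_sum _ fun l _ => ?_
  refine AEStronglyMeasurable.mul (AEStronglyMeasurable.mul
    ((continuous_apply k).comp_aestronglyMeasurable hu) (hw k l)) ?_
  exact ((measurable_signedPow _).comp_aemeasurable
    ((continuous_apply l).comp_aestronglyMeasurable hv).aemeasurable).aestronglyMeasurable

theorem IsDensity.aestronglyMeasurable_alphaForm (hw : IsDensity α w)
    (hu : AEStronglyMeasurable u muC) : AEStronglyMeasurable (alphaForm α w u) muC :=
  aestronglyMeasurable_pform (fun k l => (hw.integrable k l).1) hu hu

/-- The norm of `L^α(w)`. -/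
def lnorm (α : ℝ) (w : ℝ → Matrix (Fin T) (Fin T) ℂ) (u : ℝ → Fin T → ℂ) : ℝ≥0∞ :=
  lalphaPow α w u ^ (1 / α)

theorem lnorm_rpow (hα : 0 < α) : lnorm α w u ^ α = lalphaPow α w u := by
  rw [lnorm, ← ENNReal.rpow_mul, one_div_mul_cancel hα.ne', ENNReal.rpow_one]

theorem lalphaPow_smul (hα : 0 < α) (c : ℂ) (u : ℝ → Fin T → ℂ) :
    lalphaPow α w (c • u) = ‖c‖ₑ ^ α * lalphaPow α w u := by
  rw [lalphaPow, lalphaPow, ← lintegral_const_mul' _ _ (by simp [hα.le])]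
  refine lintegral_congr fun θ => ?_
  rw [alphaForm_eq_pform, Pi.smul_apply, pform_smul_smul hα, enorm_mul, ← ofReal_norm_rpow hα.le,
    ← ofReal_norm, Complex.norm_real, Real.norm_of_nonneg (by positivity)]
  rfl

theorem lnorm_smul (hα : 0 < α) (c : ℂ) (u : ℝ → Fin T → ℂ) :
    lnorm α w (c • u) = ‖c‖ₑ * lnorm α w u := by
  rw [lnorm, lalphaPow_smul hα, ENNReal.mul_rpow_of_nonneg _ _ (by positivity), ← ENNReal.rpow_mul,
    mul_one_div_cancel hα.ne', ENNReal.rpow_one, lnorm]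

theorem lalphaPow_zero (hα : 0 < α) : lalphaPow α w 0 = 0 := by
  have := lalphaPow_smul (w := w) hα 0 0
  simpa [hα] using this

theorem lnorm_zero (hα : 0 < α) : lnorm α w 0 = 0 := by
  rw [lnorm, lalphaPow_zero hα, ENNReal.zero_rpow_of_pos (by positivity)]

/-- Minkowski's inequality twice: pointwise for the matrix form, then in $L^\alpha$ for the
$\alpha$-th root of the form. -/
theorem IsDensity.lnorm_add_le (hα : 1 ≤ α) (hw : IsDensity α w) (hu : AEStronglyMeasurable u muC)
    (hv : AEStronglyMeasurable v muC) : lnorm α w (u + v) ≤ lnorm α w u + lnorm α w v := by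
  have hα0 : 0 < α := by linarith
  have hp : ∀ x : ℝ≥0∞, (x ^ (1 / α)) ^ α = x := fun x => by
    rw [← ENNReal.rpow_mul, one_div_mul_cancel hα0.ne', ENNReal.rpow_one]
  have h1 := ENNReal.lintegral_Lp_add_le
    ((hw.aestronglyMeasurable_alphaForm hu).enorm.pow_const (1 / α))
    ((hw.aestronglyMeasurable_alphaForm hv).enorm.pow_const (1 / α)) hα
  simp only [hp, Pi.add_apply] at h1
  refine le_trans (ENNReal.rpow_le_rpow (lintegral_mono_ae ?_) (by positivity)) h1
  filter_upwards [hw.stable] with θ hθ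
  rw [← hp ‖alphaForm α w (u + v) θ‖ₑ]
  exact ENNReal.rpow_le_rpow (hθ.rpow_add_le hα _ _) hα0.le

theorem lnorm_sub_comm (hα : 0 < α) (u v : ℝ → Fin T → ℂ) :
    lnorm α w (u - v) = lnorm α w (v - u) := by
  have e : u - v = (-1 : ℂ) • (v - u) := by simp
  rw [e, lnorm_smul hα]
  simp

theorem lnorm_lt_top_iff (hα : 0 < α) : lnorm α w u < ⊤ ↔ lalphaPow α w u < ⊤ := by
  rw [lnorm, ENNReal.rpow_lt_top_iff_of_pos (by positivity)]

theorem IsDensity.lalphaPow_add_density (hα : 0 < α) (hf : IsDensity α f) (hg : IsDensity α g)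
    (hu : AEStronglyMeasurable u muC) :
    lalphaPow α (f + g) u = lalphaPow α f u + lalphaPow α g u := by
  rw [lalphaPow, lalphaPow, lalphaPow,
    ← lintegral_add_left' (hf.aestronglyMeasurable_alphaForm hu).enorm]
  refine lintegral_congr_ae ?_
  filter_upwards [hf.stable, hg.stable] with θ h1 h2
  exact h1.enorm_add hα h2 _

theorem lalphaPow_le (hα : 1 < α) (w : ℝ → Matrix (Fin T) (Fin T) ℂ) (u : ℝ → Fin T → ℂ) :
    lalphaPow α w u ≤ ∫⁻ θ in Ioc (-Real.pi) Real.pi, (∑ k, ∑ l, ‖w θ k l‖ₑ) * ‖u θ‖ₑ ^ α := by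
  refine lintegral_mono fun θ => ?_
  rw [← ofReal_norm, ← ofReal_norm_rpow (by linarith)]
  have e : (∑ k, ∑ l, ‖w θ k l‖ₑ) = ENNReal.ofReal (∑ k, ∑ l, ‖w θ k l‖) := by
    rw [ENNReal.ofReal_sum_of_nonneg fun k _ => by positivity]
    refine Finset.sum_congr rfl fun k _ => ?_
    rw [ENNReal.ofReal_sum_of_nonneg fun l _ => by positivity]
    simp only [ofReal_norm]
  rw [e, ← ENNReal.ofReal_mul (by positivity)]
  exact ENNReal.ofReal_le_ofReal (norm_pform_self_le hα _)

theorem IsDensity.lintegral_lt_top (hw : IsDensity α w) :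
    ∫⁻ θ in Ioc (-Real.pi) Real.pi, (∑ k, ∑ l, ‖w θ k l‖ₑ) < ⊤ := by
  rw [lintegral_finsetSum' _ fun k _ =>
    Finset.aemeasurable_fun_sum _ fun l _ => (hw.integrable k l).1.enorm]
  refine ENNReal.sum_lt_top.2 fun k _ => ?_
  rw [lintegral_finsetSum' _ fun l _ => (hw.integrable k l).1.enorm]
  exact ENNReal.sum_lt_top.2 fun l _ => (hw.integrable k l).2

theorem lalphaPow_le_of_enorm_le (hα : 1 < α) {c : ℝ≥0∞} (hc : c ≠ ⊤)
    (h : ∀ θ ∈ Ioc (-Real.pi) Real.pi, ‖u θ‖ₑ ≤ c) : lalphaPow α w u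
      ≤ (∫⁻ θ in Ioc (-Real.pi) Real.pi, (∑ k, ∑ l, ‖w θ k l‖ₑ)) * c ^ α := by
  refine (lalphaPow_le hα w u).trans ?_
  rw [← lintegral_mul_const' _ _ (ENNReal.rpow_ne_top_of_nonneg (by linarith) hc)]
  refine setLIntegral_mono' measurableSet_Ioc fun θ hθ => ?_
  gcongr
  exact h θ hθ

theorem IsDensity.memLalpha_of_enorm_le (hα : 1 < α) (hw : IsDensity α w) {c : ℝ≥0∞} (hc : c ≠ ⊤)
    (hu : AEStronglyMeasurable u muC) (h : ∀ θ ∈ Ioc (-Real.pi) Real.pi, ‖u θ‖ₑ ≤ c) :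
    MemLalpha α w u :=
  ⟨hu, (lalphaPow_le_of_enorm_le hα hc h).trans_lt
    (ENNReal.mul_lt_top hw.lintegral_lt_top
      (ENNReal.rpow_ne_top_of_nonneg (by linarith) hc).lt_top)⟩

theorem IsDensity.memLalpha_add (hα : 1 ≤ α) (hw : IsDensity α w) (hu : MemLalpha α w u)
    (hv : MemLalpha α w v) : MemLalpha α w (u + v) := by
  have hα0 : 0 < α := by linarith
  refine ⟨hu.1.add hv.1, ?_⟩
  rw [← lnorm_lt_top_iff hα0]
  exact (hw.lnorm_add_le hα hu.1 hv.1).trans_lt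
    (ENNReal.add_lt_top.2 ⟨(lnorm_lt_top_iff hα0).2 hu.2, (lnorm_lt_top_iff hα0).2 hv.2⟩)

theorem memLalpha_smul (hα : 0 < α) (c : ℂ) (hu : MemLalpha α w u) :
    MemLalpha α w (c • u) :=
  ⟨hu.1.const_smul c, by
    rw [lalphaPow_smul hα]
    exact ENNReal.mul_lt_top (ENNReal.rpow_lt_top_of_nonneg hα.le enorm_ne_top) hu.2⟩

theorem IsDensity.memLalpha_sub (hα : 1 ≤ α) (hw : IsDensity α w) (hu : MemLalpha α w u)
    (hv : MemLalpha α w v) : MemLalpha α w (u - v) := by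
  have e : u - v = u + (-1 : ℂ) • v := by simp [sub_eq_add_neg]
  rw [e]
  exact hw.memLalpha_add hα hu (memLalpha_smul (by linarith) _ hv)

theorem memLalpha_zero (hα : 0 < α) : MemLalpha α w 0 :=
  ⟨aestronglyMeasurable_const, by rw [lalphaPow_zero hα]; exact ENNReal.zero_lt_top⟩

theorem IsDensity.memLalpha_left (hα : 0 < α) (hf : IsDensity α f) (hg : IsDensity α g)
    (hu : MemLalpha α (f + g) u) : MemLalpha α f u ∧ MemLalpha α g u := by
  have h := hu.2
  rw [hf.lalphaPow_add_density hα hg hu.1, ENNReal.add_lt_top] at h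
  exact ⟨⟨hu.1, h.1⟩, ⟨hu.1, h.2⟩⟩

theorem MemLalpha.integrable_alphaForm (hw : IsDensity α w) (hu : MemLalpha α w u) :
    Integrable (alphaForm α w u) muC :=
  ⟨hw.aestronglyMeasurable_alphaForm hu.1, hu.2⟩

theorem MemLalpha.integrable_pform (hα : 1 < α) (hw : IsDensity α w) (hu : MemLalpha α w u)
    (hv : MemLalpha α w v) : Integrable (fun θ => pform α (w θ) (u θ) (v θ)) muC := by
  refine Integrable.mono' ((hu.integrable_alphaForm hw).norm.add (hv.integrable_alphaForm hw).norm)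
    (aestronglyMeasurable_pform (fun k l => (hw.integrable k l).1) hu.1 hv.1) ?_
  filter_upwards [hw.stable] with θ hθ
  exact hθ.norm_pform_le hα _ _

/-- The norm of `L^α(w)` as an integral of real numbers. -/
theorem IsDensity.integral_alphaForm (hα : 0 < α) (hw : IsDensity α w)
    (hu : AEStronglyMeasurable u muC) :
    ∫ θ in Ioc (-Real.pi) Real.pi, alphaForm α w u θ = ((lalphaPow α w u).toReal : ℂ) := by
  rw [lalphaPow, ← integral_norm_eq_lintegral_enorm (hw.aestronglyMeasurable_alphaForm hu),
    ← integral_complex_ofReal]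
  refine integral_congr_ae ?_
  filter_upwards [hw.stable] with θ hθ
  exact (hθ.pform_self hα _).1

theorem IsDensity.toReal_lalphaPow (hw : IsDensity α w) (hu : AEStronglyMeasurable u muC) :
    (lalphaPow α w u).toReal = ∫ θ in Ioc (-Real.pi) Real.pi, ‖alphaForm α w u θ‖ := by
  rw [lalphaPow, ← integral_norm_eq_lintegral_enorm (hw.aestronglyMeasurable_alphaForm hu)]

end

/-! ### Minimality and completeness of `L^α(w)` -/

section

variable {T : ℕ} {α : ℝ} {w : ℝ → Matrix (Fin T) (Fin T) ℂ} {u v : ℝ → Fin T → ℂ}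

open scoped ComplexOrder in
/-- The values of a Hermitian form are bounded from below by the least eigenvalue. -/
theorem re_star_dotProduct_mulVec_ge {M : Matrix (Fin T) (Fin T) ℂ} (hM : M.IsHermitian) {r : ℝ}
    (hr : ∀ i, r ≤ hM.eigenvalues i) (x : Fin T → ℂ) :
    r * ∑ k, ‖x k‖ ^ 2 ≤ (star x ⬝ᵥ (M *ᵥ x)).re := by
  have h1 : (M - (r : ℂ) • (1 : Matrix (Fin T) (Fin T) ℂ)).PosSemidef := by
    have hd : (Matrix.diagonal fun i => ((hM.eigenvalues i - r : ℝ) : ℂ)).PosSemidef :=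
      Matrix.PosSemidef.diagonal fun i => by
        have := hr i
        simpa using this
    have h2 := hd.mul_mul_conjTranspose_same (hM.eigenvectorUnitary : Matrix (Fin T) (Fin T) ℂ)
    have hU : (hM.eigenvectorUnitary : Matrix (Fin T) (Fin T) ℂ)
        * (hM.eigenvectorUnitary : Matrix (Fin T) (Fin T) ℂ)ᴴ = 1 :=
      Unitary.mul_star_self_of_mem hM.eigenvectorUnitary.2
    convert h2 using 1
    have e : (Matrix.diagonal fun i => ((hM.eigenvalues i - r : ℝ) : ℂ))
        = Matrix.diagonal (fun i => ((hM.eigenvalues i : ℝ) : ℂ))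
          - (r : ℂ) • (1 : Matrix (Fin T) (Fin T) ℂ) := by
      ext i j
      by_cases hij : i = j
      · subst hij; simp
      · simp [hij]
    rw [e, Matrix.mul_sub, Matrix.sub_mul, Matrix.mul_smul, Matrix.smul_mul, Matrix.mul_one, hU]
    congr 1
    have := hM.spectral_theorem
    simpa [Unitary.conjStarAlgAut_apply, Matrix.star_eq_conjTranspose, Function.comp_def] using this
  have h3 := (Matrix.posSemidef_iff_dotProduct_mulVec.1 h1).2 x
  rw [Matrix.sub_mulVec, dotProduct_sub, Matrix.smul_mulVec, Matrix.one_mulVec,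
    dotProduct_smul, sub_nonneg] at h3
  have h4 := (Complex.le_def.1 h3).1
  refine le_trans (le_of_eq ?_) h4
  rw [smul_eq_mul, Complex.re_ofReal_mul, dotProduct, Complex.re_sum]
  congr 1
  refine Finset.sum_congr rfl fun k _ => ?_
  rw [Pi.star_apply, Complex.star_def, ← Complex.normSq_eq_conj_mul_self, Complex.ofReal_re,
    Complex.normSq_eq_norm_sq]

open scoped ComplexOrder in
/-- The form of a stable matrix is coercive in terms of the eigenvalues. -/
theorem IsStableMatrix.mul_norm_rpow_le (hα₂ : α ≤ 2) (hα : 0 < α) {M : Matrix (Fin T) (Fin T) ℂ}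
    (hM : M.PosSemidef) (hd : α < 2 → ∀ l k, l ≠ k → M l k = 0) {r : ℝ}
    (hr : ∀ i, r ≤ hM.1.eigenvalues i) (hr0 : 0 ≤ r) (a : Fin T → ℂ) (k : Fin T) :
    r * ‖a k‖ ^ α ≤ ‖pform α M a a‖ := by
  have h1 := re_star_dotProduct_mulVec_ge hM.1 hr
  refine le_trans ?_ (Complex.re_le_norm _)
  -- For $\alpha<2$ the matrix is diagonal, and basis vectors show that its diagonal entries are at
  -- least `r`. For $\alpha=2$ the form is the Hermitian form at $\bar a$.
  rcases hα₂.lt_or_eq with hlt | rfl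
  · have h2 : ∀ j, r ≤ (M j j).re := fun j => by
      have := h1 (Pi.single j 1)
      rw [Finset.sum_eq_single j (fun i _ hi => by simp [hi]) (by simp)] at this
      simpa [← Pi.single_star] using this
    have h3 : (pform α M a a).re = ∑ j, (M j j).re * ‖a j‖ ^ α := by
      rw [pform_eq_sum, Complex.re_sum]
      refine Finset.sum_congr rfl fun j _ => ?_
      rw [Finset.sum_eq_single j (fun i _ hi => by rw [hd hlt j i hi.symm]; simp) (by simp),
        mul_right_comm, mul_signedPow_self hα, Complex.re_ofReal_mul, mul_comm]
    rw [h3]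
    refine le_trans ?_ (Finset.single_le_sum (f := fun j => (M j j).re * ‖a j‖ ^ α)
      (fun j _ => mul_nonneg (hr0.trans (h2 j)) (by positivity)) (Finset.mem_univ k))
    exact mul_le_mul_of_nonneg_right (h2 k) (by positivity)
  · have e1 : (2 - 1 : ℝ) = 1 := by norm_num
    have e2 : vecSignedPow (2 - 1) a = star a := by
      funext k
      simp [vecSignedPow, e1, signedPow_one_left]
    have h2 := h1 (star a)
    rw [star_star] at h2
    rw [pform, e2]
    refine le_trans (mul_le_mul_of_nonneg_left ?_ hr0) h2
    refine le_trans (le_of_eq ?_) (Finset.single_le_sum (f := fun j => ‖star a j‖ ^ 2)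
      (fun j _ => by positivity) (Finset.mem_univ k))
    simp

open scoped ComplexOrder in
theorem _root_.Matrix.PosSemidef.eigenvalues_pos_of_det_ne_zero {M : Matrix (Fin T) (Fin T) ℂ}
    (hM : M.PosSemidef) (hdet : M.det ≠ 0) (i : Fin T) : 0 < hM.1.eigenvalues i := by
  refine lt_of_le_of_ne (hM.eigenvalues_nonneg i) fun h => hdet ?_
  rw [hM.1.det_eq_prod_eigenvalues]
  exact Finset.prod_eq_zero (Finset.mem_univ i) (by simp [← h])

open scoped ComplexOrder in
theorem apply_eq_zero_of_pform_eq_zero (hα₁ : 1 < α) (hα₂ : α ≤ 2)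
    {M : Matrix (Fin T) (Fin T) ℂ} (hM : M.PosSemidef) (hd : α < 2 → ∀ l k, l ≠ k → M l k = 0)
    (hdet : M.det ≠ 0) {a : Fin T → ℂ} (h : pform α M a a = 0) (k : Fin T) : a k = 0 := by
  have hα0 : 0 < α := by linarith
  obtain ⟨i, -, hi⟩ := Finset.exists_min_image Finset.univ hM.1.eigenvalues ⟨k, Finset.mem_univ k⟩
  have h1 := IsStableMatrix.mul_norm_rpow_le hα₂ hα0 hM hd (fun j => hi j (Finset.mem_univ j))
    (hM.eigenvalues_nonneg i) a k
  rw [h, norm_zero] at h1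
  have hpos := hM.eigenvalues_pos_of_det_ne_zero hdet i
  by_contra h2
  have h3 : 0 < ‖a k‖ := by simpa using h2
  have : 0 < hM.1.eigenvalues i * ‖a k‖ ^ α := by positivity
  linarith

open scoped ComplexOrder in
/-- A pointwise consequence of the minimality condition. -/
theorem enorm_rpow_le_tracePow (hα₁ : 1 < α) (hα₂ : α ≤ 2) {M : Matrix (Fin T) (Fin T) ℂ}
    (hM : M.PosSemidef) (hd : α < 2 → ∀ l k, l ≠ k → M l k = 0) (hdet : M.det ≠ 0)
    (a : Fin T → ℂ) (k : Fin T) :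
    ‖a k‖ₑ ^ α ≤ tracePow (-1 / (α - 1)) M ^ (α - 1) * ‖pform α M a a‖ₑ := by
  have hα0 : 0 < α := by linarith
  have hα1 : 0 < α - 1 := by linarith
  have hpos := hM.eigenvalues_pos_of_det_ne_zero hdet
  -- For the least eigenvalue $\lambda$, coercivity gives $\lambda|a_k|^\alpha\le$ form, and
  -- $\lambda^{-1}=(\lambda^{-1/(\alpha-1)})^{\alpha-1}$ is at most the trace to the power
  -- $\alpha-1$.
  obtain ⟨i, -, hi⟩ := Finset.exists_min_image Finset.univ hM.1.eigenvalues ⟨k, Finset.mem_univ k⟩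
  have h1 := IsStableMatrix.mul_norm_rpow_le hα₂ hα0 hM hd (fun j => hi j (Finset.mem_univ j))
    (hpos i).le a k
  have h2 : (ENNReal.ofReal (hM.1.eigenvalues i)) ^ (-1 / (α - 1)) ≤ tracePow (-1 / (α - 1)) M := by
    rw [tracePow, dif_pos hM.1]
    exact Finset.single_le_sum (f := fun i => ENNReal.ofReal (hM.1.eigenvalues i) ^ (-1 / (α - 1)))
      (fun _ _ => zero_le) (Finset.mem_univ i)
  have h3 : (ENNReal.ofReal (hM.1.eigenvalues i))⁻¹ ≤ tracePow (-1 / (α - 1)) M ^ (α - 1) := by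
    refine le_trans (le_of_eq ?_) (ENNReal.rpow_le_rpow h2 hα1.le)
    rw [← ENNReal.rpow_mul, div_mul_cancel₀ _ hα1.ne', ENNReal.rpow_neg_one]
  have h4 : ENNReal.ofReal (hM.1.eigenvalues i) * ‖a k‖ₑ ^ α ≤ ‖pform α M a a‖ₑ := by
    rw [← ofReal_norm_rpow hα0.le, ← ofReal_norm, ← ENNReal.ofReal_mul (hpos i).le]
    exact ENNReal.ofReal_le_ofReal h1
  have h5 : ENNReal.ofReal (hM.1.eigenvalues i) ≠ 0 := by simpa using hpos i
  calc ‖a k‖ₑ ^ α = (ENNReal.ofReal (hM.1.eigenvalues i))⁻¹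
        * (ENNReal.ofReal (hM.1.eigenvalues i) * ‖a k‖ₑ ^ α) := by
          rw [← mul_assoc, ENNReal.inv_mul_cancel h5 ENNReal.ofReal_ne_top, one_mul]
    _ ≤ _ := mul_le_mul' h3 h4

theorem tracePow_eq_top {M : Matrix (Fin T) (Fin T) ℂ} (hM : M.IsHermitian) (hdet : M.det = 0)
    {p : ℝ} (hp : p < 0) : tracePow p M = ⊤ := by
  rw [hM.det_eq_prod_eigenvalues, Finset.prod_eq_zero_iff] at hdet
  obtain ⟨i, hi, h⟩ := hdet
  have h0 : hM.eigenvalues i = 0 := by simpa using h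
  rw [tracePow, dif_pos hM, eq_top_iff]
  refine le_trans (le_of_eq ?_) (Finset.single_le_sum
    (f := fun i => ENNReal.ofReal (hM.eigenvalues i) ^ p) (fun _ _ => zero_le) hi)
  simp [h0, ENNReal.zero_rpow_of_neg hp]

/-- A singular matrix has infinite trace power, so singularity on a set of positive measure would
make the minimality integral infinite. -/
theorem Minimality.ae_det_ne_zero (hα : 1 < α) (hw : IsDensity α w) (hm : Minimality α w) :
    ∀ᵐ θ ∂muC, (w θ).det ≠ 0 := by
  have hmeas : AEStronglyMeasurable (fun θ => (w θ).det) muC := by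
    simp only [Matrix.det_apply]
    refine Finset.aestronglyMeasurable_fun_sum _ fun σ _ => AEStronglyMeasurable.const_smul ?_ _
    exact Finset.aestronglyMeasurable_fun_prod _ fun i _ => (hw.integrable _ _).1
  have hnull : NullMeasurableSet {θ | (w θ).det = 0} muC :=
    nullMeasurableSet_eq_fun hmeas.aemeasurable aemeasurable_const
  have h1 : ∫⁻ θ in Ioc (-Real.pi) Real.pi, ({θ | (w θ).det = 0}.indicator (fun _ => ⊤) θ : ℝ≥0∞)
      ≤ ∫⁻ θ in Ioc (-Real.pi) Real.pi, tracePow (-1 / (α - 1)) (w θ) := by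
    refine lintegral_mono_ae ?_
    filter_upwards [hw.posSemidef] with θ hθ
    by_cases h : (w θ).det = 0
    · rw [tracePow_eq_top hθ.1 h (div_neg_of_neg_of_pos (by norm_num) (by linarith))]
      exact le_top
    · simp [h]
  rw [lintegral_indicator₀ hnull, lintegral_const] at h1
  by_contra hne
  have h2 : muC {θ | (w θ).det = 0} ≠ 0 := by
    intro h
    exact hne (by rw [ae_iff]; simpa using h)
  rw [Measure.restrict_apply_univ, ENNReal.top_mul h2] at h1
  exact absurd hm (not_lt.2 h1)

/-- Under the minimality condition `L^α(w)` embeds into `L^1`. -/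
theorem Minimality.exists_lintegral_le (hα₁ : 1 < α) (hα₂ : α ≤ 2) (hw : IsDensity α w)
    (hm : Minimality α w) : ∃ C : ℝ≥0∞, C ≠ ⊤ ∧ ∀ u : ℝ → Fin T → ℂ, AEStronglyMeasurable u muC →
      ∫⁻ θ in Ioc (-Real.pi) Real.pi, ‖u θ‖ₑ ≤ C * lnorm α w u := by
  have hα0 : 0 < α := by linarith
  have hα1 : 0 < α - 1 := by linarith
  set K := ∫⁻ θ in Ioc (-Real.pi) Real.pi, tracePow (-1 / (α - 1)) (w θ) with hK
  refine ⟨∑ _k : Fin T, K ^ ((α - 1) / α), ?_, fun u hu => ?_⟩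
  · simpa using ENNReal.mul_ne_top (ENNReal.natCast_ne_top _)
      (ENNReal.rpow_ne_top_of_nonneg (by positivity) hm.ne)
  have hcoord : ∀ k, AEMeasurable (fun θ => ‖u θ k‖ₑ) muC := fun k =>
    ((continuous_apply k).comp_aestronglyMeasurable hu).enorm
  have hk : ∀ k, ∫⁻ θ in Ioc (-Real.pi) Real.pi, ‖u θ k‖ₑ
      ≤ K ^ ((α - 1) / α) * lnorm α w u := fun k => by
    -- Hölder's inequality wants measurable factors. The explicitly measurable `r` lies below the
    -- trace power and satisfies $|u_k|\le r^{(\alpha-1)/\alpha}\cdot\mathrm{form}^{1/\alpha}$; the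
    -- conjugate exponents are $\alpha/(\alpha-1)$ and $\alpha$. Where the form vanishes, $u_k=0$.
    let r : ℝ → ℝ≥0∞ := fun θ => (‖u θ k‖ₑ ^ α / ‖alphaForm α w u θ‖ₑ) ^ (1 / (α - 1))
    have hN := (hw.aestronglyMeasurable_alphaForm hu).enorm
    have hr : AEMeasurable r muC := (((hcoord k).pow_const α).div hN).pow_const _
    have hle : ∀ᵐ θ ∂muC, r θ ≤ tracePow (-1 / (α - 1)) (w θ)
        ∧ ‖u θ k‖ₑ ≤ r θ ^ ((α - 1) / α) * ‖alphaForm α w u θ‖ₑ ^ (1 / α) := by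
      have hdiag : ∀ᵐ θ ∂muC, α < 2 → ∀ l k, l ≠ k → w θ l k = 0 := by
        by_cases h : α < 2
        · filter_upwards [hw.diag h] with θ hθ _ using hθ
        · exact Eventually.of_forall fun θ h' => absurd h' h
      filter_upwards [hw.posSemidef, hdiag, hm.ae_det_ne_zero hα₁ hw] with θ h1 h2 h3
      have h4 := enorm_rpow_le_tracePow hα₁ hα₂ h1 h2 h3 (u θ) k
      rw [← alphaForm_eq_pform] at h4
      refine ⟨?_, ?_⟩
      · have := ENNReal.rpow_le_rpow (ENNReal.div_le_of_le_mul h4)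
          (by positivity : 0 ≤ 1 / (α - 1))
        rwa [← ENNReal.rpow_mul, mul_one_div_cancel hα1.ne', ENNReal.rpow_one] at this
      · have e : (1 / (α - 1)) * ((α - 1) / α) = 1 / α := by field_simp
        rw [← ENNReal.rpow_mul, e, ← ENNReal.mul_rpow_of_nonneg _ _ (by positivity)]
        by_cases h0 : ‖alphaForm α w u θ‖ₑ = 0
        · rw [apply_eq_zero_of_pform_eq_zero hα₁ hα₂ h1 h2 h3
            (enorm_eq_zero.1 h0 : pform α (w θ) (u θ) (u θ) = 0) k, enorm_zero]
          exact zero_le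
        · rw [ENNReal.div_mul_cancel h0 enorm_ne_top, ← ENNReal.rpow_mul,
            mul_one_div_cancel hα0.ne', ENNReal.rpow_one]
    have hpq : (α / (α - 1)).HolderConjugate α := by
      rw [Real.holderConjugate_iff]
      refine ⟨by rw [lt_div_iff₀ hα1]; linarith, by field_simp; ring⟩
    calc ∫⁻ θ in Ioc (-Real.pi) Real.pi, ‖u θ k‖ₑ
        ≤ ∫⁻ θ in Ioc (-Real.pi) Real.pi,
            ((fun θ => r θ ^ ((α - 1) / α)) * fun θ => ‖alphaForm α w u θ‖ₑ ^ (1 / α)) θ :=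
          lintegral_mono_ae (hle.mono fun θ h => h.2)
      _ ≤ _ := ENNReal.lintegral_mul_le_Lp_mul_Lq _ hpq (hr.pow_const _) (hN.pow_const _)
      _ = (∫⁻ θ in Ioc (-Real.pi) Real.pi, r θ) ^ ((α - 1) / α) * lnorm α w u := by
          have e1 : (α - 1) / α * (α / (α - 1)) = 1 := by field_simp
          have e2 : 1 / α * α = 1 := by field_simp
          simp only [← ENNReal.rpow_mul, e1, e2, ENNReal.rpow_one, one_div_div]
          rfl
      _ ≤ _ := by
          gcongr
          exact lintegral_mono_ae (hle.mono fun θ h => h.1)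
  calc ∫⁻ θ in Ioc (-Real.pi) Real.pi, ‖u θ‖ₑ
      ≤ ∫⁻ θ in Ioc (-Real.pi) Real.pi, ∑ k, ‖u θ k‖ₑ := by
        refine lintegral_mono fun θ => ?_
        have h : ‖u θ‖ ≤ ∑ k, ‖u θ k‖ :=
          (pi_norm_le_iff_of_nonneg (by positivity)).2 fun k =>
            Finset.single_le_sum (f := fun k => ‖u θ k‖) (fun _ _ => norm_nonneg _)
              (Finset.mem_univ k)
        simp only [← ofReal_norm]
        rw [← ENNReal.ofReal_sum_of_nonneg fun k _ => norm_nonneg _]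
        exact ENNReal.ofReal_le_ofReal h
    _ = ∑ k, ∫⁻ θ in Ioc (-Real.pi) Real.pi, ‖u θ k‖ₑ :=
        lintegral_finsetSum' _ fun k _ => hcoord k
    _ ≤ ∑ _k : Fin T, K ^ ((α - 1) / α) * lnorm α w u := Finset.sum_le_sum fun k _ => hk k
    _ = _ := by rw [Finset.sum_mul]

theorem MemLalpha.integrable (hα₁ : 1 < α) (hα₂ : α ≤ 2) (hw : IsDensity α w)
    (hm : Minimality α w) (hu : MemLalpha α w u) : Integrable u muC := by
  obtain ⟨C, hC, h⟩ := hm.exists_lintegral_le hα₁ hα₂ hw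
  exact ⟨hu.1, (h u hu.1).trans_lt
    (ENNReal.mul_lt_top hC.lt_top ((lnorm_lt_top_iff (by linarith)).2 hu.2))⟩

theorem Minimality.ae_eq_zero (hα₁ : 1 < α) (hα₂ : α ≤ 2) (hw : IsDensity α w)
    (hm : Minimality α w) (hu : AEStronglyMeasurable u muC) (h0 : lalphaPow α w u = 0) :
    u =ᵐ[muC] 0 := by
  obtain ⟨C, hC, h⟩ := hm.exists_lintegral_le hα₁ hα₂ hw
  have h1 := h u hu
  rw [lnorm, h0, ENNReal.zero_rpow_of_pos (by have : 0 < α := by linarith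
                                              positivity), mul_zero, nonpos_iff_eq_zero,
    lintegral_eq_zero_iff' hu.enorm] at h1
  filter_upwards [h1] with θ hθ
  simpa using hθ

theorem IsStableMatrix.tendsto_enorm_pform {ι : Type*} {l : Filter ι} (hα : 0 < α)
    {W : Matrix (Fin T) (Fin T) ℂ} (h : IsStableMatrix α W) {x : ι → Fin T → ℂ} {a : Fin T → ℂ}
    (hx : Tendsto x l (𝓝 a)) :
    Tendsto (fun i => ‖pform α W (x i) (x i)‖ₑ) l (𝓝 ‖pform α W a a‖ₑ) := by
  obtain ⟨m, v, hv⟩ := h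
  simp only [← ofReal_norm, IsStableMatrix.norm_pform_self hα hv]
  have hc : Continuous fun a : Fin T → ℂ => ∑ i, ‖v i ⬝ᵥ a‖ ^ α := by
    refine continuous_finsetSum _ fun i _ => Continuous.rpow_const ?_ fun _ => Or.inr hα.le
    exact (Continuous.dotProduct continuous_const continuous_id).norm
  exact ((ENNReal.continuous_ofReal.comp hc).tendsto a).comp hx

/-- `L^α(w)` is complete under the minimality condition. -/
theorem Minimality.exists_limit (hα₁ : 1 < α) (hα₂ : α ≤ 2) (hw : IsDensity α w)
    (hm : Minimality α w) {u : ℕ → ℝ → Fin T → ℂ} (hu : ∀ n, MemLalpha α w (u n))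
    (hc : ∀ ε : ℝ≥0∞, 0 < ε → ∃ N, ∀ m ≥ N, ∀ n ≥ N, lalphaPow α w (u m - u n) ≤ ε) :
    ∃ h, MemLalpha α w h ∧ ∀ ε : ℝ≥0∞, 0 < ε → ∃ N, ∀ n ≥ N, lalphaPow α w (h - u n) ≤ ε := by
  have hα0 : 0 < α := by linarith
  obtain ⟨C, hC, hCu⟩ := hm.exists_lintegral_le hα₁ hα₂ hw
  have hL : ∀ n, MemLp (u n) 1 muC := fun n =>
    memLp_one_iff_integrable.2 ((hu n).integrable hα₁ hα₂ hw hm)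
  -- The embedding in $L^1$ supplies a candidate limit and a subsequence converging almost
  -- everywhere.
  have hcau : CauchySeq fun n => (hL n).toLp := by
    rw [EMetric.cauchySeq_iff]
    intro ε hε
    have hlim : Tendsto (fun δ : ℝ≥0∞ => C * δ ^ (1 / α)) (𝓝 0) (𝓝 0) := by
      have h1 := (ENNReal.continuous_rpow_const (y := 1 / α)).tendsto 0
      rw [ENNReal.zero_rpow_of_pos (by positivity)] at h1
      simpa using ENNReal.Tendsto.const_mul h1 (Or.inr hC)
    obtain ⟨δ, hδ0, hδ⟩ : ∃ δ : ℝ≥0∞, 0 < δ ∧ C * δ ^ (1 / α) < ε := by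
      have h1 : ∀ᶠ δ in 𝓝[>] (0 : ℝ≥0∞), C * δ ^ (1 / α) < ε :=
        (hlim.mono_left nhdsWithin_le_nhds).eventually (gt_mem_nhds hε)
      obtain ⟨δ, h2, h3⟩ := (h1.and self_mem_nhdsWithin).exists
      exact ⟨δ, h3, h2⟩
    obtain ⟨N, hN⟩ := hc δ hδ0
    refine ⟨N, fun m hmN n hn => ?_⟩
    rw [Lp.edist_toLp_toLp, eLpNorm_one_eq_lintegral_enorm]
    refine lt_of_le_of_lt ((hCu _ ((hu m).1.sub (hu n).1)).trans ?_) hδ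
    gcongr
    exact ENNReal.rpow_le_rpow (hN m hmN n hn) (by positivity)
  obtain ⟨H, hH⟩ := cauchySeq_tendsto_of_complete hcau
  obtain ⟨φ, hφ, hae⟩ := (tendstoInMeasure_of_tendsto_Lp hH).exists_seq_tendsto_ae
  have hae' : ∀ᵐ θ ∂muC, Tendsto (fun i => u (φ i) θ) atTop (𝓝 (H θ)) := by
    have h1 : ∀ᵐ θ ∂muC, ∀ n, ((hL n).toLp : ℝ → Fin T → ℂ) θ = u n θ :=
      ae_all_iff.2 fun n => (hL n).coeFn_toLp
    filter_upwards [hae, h1] with θ h2 h3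
    simpa only [h3] using h2
  have hHm : AEStronglyMeasurable (H : ℝ → Fin T → ℂ) muC := Lp.aestronglyMeasurable H
  have key : ∀ ε : ℝ≥0∞, 0 < ε → ∃ N, ∀ n ≥ N, lalphaPow α w (H - u n) ≤ ε := by
    intro ε hε
    obtain ⟨N, hN⟩ := hc ε hε
    refine ⟨N, fun n hn => ?_⟩
    -- Fatou's lemma along the subsequence returns from pointwise convergence to convergence in
    -- $L^\alpha(w)$.
    calc lalphaPow α w (H - u n)
        ≤ ∫⁻ θ in Ioc (-Real.pi) Real.pi,
            liminf (fun i => ‖alphaForm α w (u (φ i) - u n) θ‖ₑ) atTop := by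
          refine lintegral_mono_ae ?_
          filter_upwards [hw.stable, hae'] with θ h1 h2
          exact ((h1.tendsto_enorm_pform hα0 (h2.sub_const (u n θ))).liminf_eq).ge
      _ ≤ liminf (fun i => lalphaPow α w (u (φ i) - u n)) atTop :=
          lintegral_liminf_le' fun i =>
            (hw.aestronglyMeasurable_alphaForm ((hu _).1.sub (hu n).1)).enorm
      _ ≤ ε := by
          refine liminf_le_of_frequently_le' (Eventually.frequently ?_)
          filter_upwards [hφ.tendsto_atTop.eventually_ge_atTop N] with i hi
          exact hN _ hi n hn
  refine ⟨H, ?_, key⟩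
  obtain ⟨N, hN⟩ := key 1 one_pos
  have h1 : MemLalpha α w (H - u N) := ⟨hHm.sub (hu N).1, (hN N le_rfl).trans_lt ENNReal.one_lt_top⟩
  have := hw.memLalpha_add hα₁.le h1 (hu N)
  rwa [sub_add_cancel] at this

end

/-! ### Approximation by trigonometric polynomials and by step functions -/

instance fact_two_pi_pos : Fact (0 < 2 * Real.pi) := ⟨Real.two_pi_pos⟩

/-- The space of trigonometric polynomials. -/
def trigSpace : Submodule ℂ (ℝ → ℂ) :=
  Submodule.span ℂ {v | ∃ n : ℤ, v = fun θ : ℝ => Complex.exp (Complex.I * n * θ)}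

theorem exists_mem_trigSpace_of_mem_span_fourier {q : C(AddCircle (2 * Real.pi), ℂ)}
    (hq : q ∈ Submodule.span ℂ (range (fourier (T := 2 * Real.pi)))) :
    (fun θ : ℝ => q θ) ∈ trigSpace := by
  induction hq using Submodule.span_induction with
  | mem q h =>
    obtain ⟨n, rfl⟩ := h
    refine Submodule.subset_span ⟨n, ?_⟩
    funext θ
    rw [fourier_coe_apply]
    congr 1
    have : (Real.pi : ℂ) ≠ 0 := by exact_mod_cast Real.pi_ne_zero
    push_cast
    field_simp
  | zero => exact Submodule.zero_mem _
  | add x y _ _ hx hy => exact Submodule.add_mem _ hx hy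
  | smul c x _ hx => exact Submodule.smul_mem _ c hx

/-- Trigonometric polynomials are dense in weighted spaces. -/
theorem exists_trigSpace_lintegral_lt {ρ : ℝ → ℝ≥0∞} (hρ : AEMeasurable ρ muC)
    (hfin : ∫⁻ θ in Ioc (-Real.pi) Real.pi, ρ θ < ⊤) {β : ℝ} (hβ : 1 ≤ β) {φ : ℝ → ℂ}
    (hφ : Measurable φ) {C : ℝ} (hC : ∀ θ, ‖φ θ‖ ≤ C) {ε : ℝ≥0∞} (hε : 0 < ε) :
    ∃ p ∈ trigSpace, ∫⁻ θ in Ioc (-Real.pi) Real.pi, ρ θ * ‖φ θ - p θ‖ₑ ^ β < ε := by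
  have hβ0 : 0 < β := by linarith
  have h2pi : -Real.pi + 2 * Real.pi = Real.pi := by ring
  -- The weight is moved into a finite measure on the circle. Trigonometric polynomials are
  -- uniformly dense in the continuous functions, which are dense in $L^\beta$ of any finite Borel
  -- measure there.
  let ν : Measure (AddCircle (2 * Real.pi)) :=
    (muC.withDensity ρ).map ((↑) : ℝ → AddCircle (2 * Real.pi))
  have hcoe : Measurable ((↑) : ℝ → AddCircle (2 * Real.pi)) := AddCircle.measurable_mk'
  have : IsFiniteMeasure (muC.withDensity ρ) := isFiniteMeasure_withDensity hfin.ne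
  have : IsFiniteMeasure ν := Measure.isFiniteMeasure_map _ _
  have : Fact ((1 : ℝ≥0∞) ≤ ENNReal.ofReal β) := ⟨by simpa using hβ⟩
  let φ' : AddCircle (2 * Real.pi) → ℂ := AddCircle.liftIoc (2 * Real.pi) (-Real.pi) φ
  have hφ' : Measurable φ' :=
    (hφ.comp measurable_subtype_coe).comp (AddCircle.measurableEquivIoc _ (-Real.pi)).measurable
  have hmem : MemLp φ' (ENNReal.ofReal β) ν :=
    MemLp.of_bound hφ'.aestronglyMeasurable C (Eventually.of_forall fun x => hC _)
  have hdense := (ContinuousMap.toLp_denseRange (p := ENNReal.ofReal β) ℂ ν ℂ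
    ENNReal.ofReal_ne_top).topologicalClosure_map_submodule
      (span_fourier_closure_eq_top (T := 2 * Real.pi))
  have hin : hmem.toLp ∈ closure (((Submodule.span ℂ (range (fourier (T := 2 * Real.pi)))).map
      (ContinuousMap.toLp (E := ℂ) (ENNReal.ofReal β) ν ℂ).toLinearMap : Set _)) := by
    rw [← Submodule.topologicalClosure_coe]
    erw [hdense]
    trivial
  obtain ⟨_, ⟨q, hq, rfl⟩, hlt⟩ := EMetric.mem_closure_iff.1 hin (ε ^ (1 / β))
    (ENNReal.rpow_pos_of_nonneg hε (by positivity))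
  refine ⟨_, exists_mem_trigSpace_of_mem_span_fourier hq, ?_⟩
  rw [Lp.edist_def] at hlt
  have e1 : eLpNorm (⇑(hmem.toLp) - ⇑(ContinuousMap.toLp (E := ℂ) (ENNReal.ofReal β) ν ℂ q))
      (ENNReal.ofReal β) ν = eLpNorm (φ' - ⇑q) (ENNReal.ofReal β) ν := by
    refine eLpNorm_congr_ae ?_
    exact (hmem.coeFn_toLp).sub (ContinuousMap.coeFn_toLp ν q)
  erw [e1] at hlt
  rw [eLpNorm_eq_lintegral_rpow_enorm_toReal (by simpa using hβ0) ENNReal.ofReal_ne_top,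
    ENNReal.toReal_ofReal hβ0.le, ENNReal.rpow_lt_rpow_iff (by positivity),
    lintegral_map (((hφ'.sub q.continuous.measurable).enorm).pow_const _) hcoe] at hlt
  have hm2 : Measurable fun θ : ℝ => ‖(φ' - ⇑q) (θ : AddCircle (2 * Real.pi))‖ₑ ^ β := by
    have : Measurable (φ' - ⇑q) := hφ'.sub q.continuous.measurable
    exact ((this.comp hcoe).enorm).pow_const _
  rw [lintegral_withDensity_eq_lintegral_mul₀ hρ hm2.aemeasurable] at hlt
  refine lt_of_le_of_lt (le_of_eq ?_) hlt
  refine setLIntegral_congr_fun measurableSet_Ioc fun θ hθ => ?_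
  have e2 : φ' (θ : AddCircle (2 * Real.pi)) = φ θ :=
    AddCircle.liftIoc_coe_apply (by rwa [h2pi])
  simp only [Pi.mul_apply, Pi.sub_apply, e2]

/-- An integrable function with zero Fourier coefficients vanishes almost everywhere. -/
theorem ae_eq_zero_of_fourier {φ : ℝ → ℂ} (hφ : Integrable φ muC)
    (h : ∀ n : ℤ, ∫ θ in Ioc (-Real.pi) Real.pi, Complex.exp (Complex.I * n * θ) * φ θ = 0) :
    φ =ᵐ[muC] 0 := by
  have hint : ∀ n : ℤ, Integrable (fun θ : ℝ => Complex.exp (Complex.I * n * θ) * φ θ) muC :=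
    fun n => by
      refine hφ.bdd_mul (c := 1) (by fun_prop) (Eventually.of_forall fun θ => ?_)
      rw [show Complex.I * n * (θ : ℂ) = ((n * θ : ℝ) : ℂ) * Complex.I by push_cast; ring,
        Complex.norm_exp_ofReal_mul_I]
  have htrig : ∀ p ∈ trigSpace, Integrable (fun θ => p θ * φ θ) muC ∧
      ∫ θ in Ioc (-Real.pi) Real.pi, p θ * φ θ = 0 := fun p hp => by
    induction hp using Submodule.span_induction with
    | mem q hq =>
      obtain ⟨n, rfl⟩ := hq
      exact ⟨hint n, h n⟩
    | zero => simp
    | add x y _ _ hx hy =>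
      simp only [Pi.add_apply, add_mul]
      exact ⟨hx.1.add hy.1, by rw [integral_add hx.1 hy.1, hx.2, hy.2, add_zero]⟩
    | smul c x _ hx =>
      simp only [Pi.smul_apply, smul_eq_mul, mul_assoc]
      exact ⟨hx.1.const_mul c, by rw [integral_const_mul, hx.2, mul_zero]⟩
  refine ae_mem_of_forall_integral_mem hφ (isClosed_singleton (x := (0 : ℂ)))
    (fun r _ z hz => by rw [mem_singleton_iff.1 hz]; simp) fun s t hs hst ht => ?_
  have hsub : Ioc s t ⊆ Ioc (-Real.pi) Real.pi := Ioc_subset_Ioc hs ht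
  have hle : ∀ ε : ℝ≥0∞, 0 < ε → ‖∫ θ in Ioc s t, φ θ‖ₑ ≤ ε := fun ε hε => by
    have hm : Measurable ((Ioc s t).indicator fun _ : ℝ => (1 : ℂ)) :=
      measurable_const.indicator measurableSet_Ioc
    -- The weight is $|\varphi|$ itself, with exponent $1$. Since $\int p\varphi=0$, one gets
    -- $\int_s^t\varphi=\int(1_{(s,t]}-p)\varphi$, which is as small as desired.
    obtain ⟨p, hp, hlt⟩ := exists_trigSpace_lintegral_lt (ρ := fun θ => ‖φ θ‖ₑ) hφ.1.enorm hφ.2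
      le_rfl hm (C := 1) (fun θ => by
        by_cases hθ : θ ∈ Ioc s t <;> simp [hθ]) hε
    have e : ∫ θ in Ioc s t, φ θ
        = ∫ θ in Ioc (-Real.pi) Real.pi,
          ((Ioc s t).indicator (fun _ => (1 : ℂ)) θ - p θ) * φ θ := by
      have e1 : ∀ θ, (Ioc s t).indicator (fun _ => (1 : ℂ)) θ * φ θ = (Ioc s t).indicator φ θ :=
        fun θ => by by_cases hθ : θ ∈ Ioc s t <;> simp [hθ]
      simp only [sub_mul, e1]
      rw [integral_sub (hφ.indicator measurableSet_Ioc) (htrig p hp).1, (htrig p hp).2, sub_zero,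
        integral_indicator measurableSet_Ioc, Measure.restrict_restrict measurableSet_Ioc,
        inter_eq_self_of_subset_left hsub]
    rw [e]
    refine (enorm_integral_le_lintegral_enorm _).trans (le_of_eq_of_le ?_ hlt.le)
    refine lintegral_congr fun θ => ?_
    rw [enorm_mul, ENNReal.rpow_one, mul_comm]
  have h0 : ‖∫ θ in Ioc s t, φ θ‖ₑ = 0 :=
    nonpos_iff_eq_zero.1 (le_of_forall_pos_le_add fun ε hε => by simpa using hle ε hε)
  exact enorm_eq_zero.1 h0

/-! ### Vector-valued trigonometric polynomials and step functions. -/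

section

variable {T : ℕ} {α : ℝ} {w : ℝ → Matrix (Fin T) (Fin T) ℂ} {u v : ℝ → Fin T → ℂ}

/-- The space of vector valued trigonometric polynomials. -/
def harmonicSpace (T : ℕ) (J : Set ℤ) : Submodule ℂ (ℝ → Fin T → ℂ) :=
  Submodule.span ℂ {v | ∃ (j : ℤ) (k : Fin T), j ∈ J ∧ v = harmonic j k}

theorem smul_mem_harmonicSpace {p : ℝ → ℂ} (hp : p ∈ trigSpace) (c : Fin T → ℂ) :
    (fun θ => p θ • c) ∈ harmonicSpace T univ := by
  induction hp using Submodule.span_induction with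
  | mem q hq =>
    obtain ⟨n, rfl⟩ := hq
    have e : (fun θ : ℝ => Complex.exp (Complex.I * n * θ) • c)
        = ∑ k, c k • harmonic (T := T) n k := by
      funext θ l
      simp [harmonic, Finset.sum_apply, Pi.single_apply, mul_comm]
    rw [e]
    exact Submodule.sum_mem _ fun k _ => Submodule.smul_mem _ _
      (Submodule.subset_span ⟨n, k, mem_univ _, rfl⟩)
  | zero => 
    simp only [Pi.zero_apply, zero_smul]
    exact Submodule.zero_mem _
  | add x y _ _ hx hy =>
    simp only [Pi.add_apply, add_smul]
    exact Submodule.add_mem _ hx hy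
  | smul a x _ hx =>
    simp only [Pi.smul_apply, smul_eq_mul, mul_smul]
    exact Submodule.smul_mem _ a hx

theorem continuous_harmonic (n : ℤ) (k : Fin T) : Continuous (harmonic n k) := by
  unfold harmonic
  fun_prop

theorem continuous_of_mem_harmonicSpace {J : Set ℤ} (hu : u ∈ harmonicSpace T J) :
    Continuous u := by
  induction hu using Submodule.span_induction with
  | mem q hq =>
    obtain ⟨n, k, -, rfl⟩ := hq
    exact continuous_harmonic n k
  | zero => exact continuous_const
  | add x y _ _ hx hy => exact hx.add hy
  | smul a x _ hx => exact hx.const_smul a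

theorem IsDensity.memLalpha_of_continuous (hα : 1 < α) (hw : IsDensity α w) (hu : Continuous u) :
    MemLalpha α w u := by
  obtain ⟨C, hC⟩ := isCompact_Icc.exists_bound_of_continuousOn
    (hu.continuousOn (s := Icc (-Real.pi) Real.pi))
  refine hw.memLalpha_of_enorm_le hα (c := ENNReal.ofReal C) ENNReal.ofReal_ne_top
    hu.aestronglyMeasurable fun θ hθ => ?_
  rw [← ofReal_norm]
  exact ENNReal.ofReal_le_ofReal (hC θ (Ioc_subset_Icc_self hθ))

theorem IsDensity.exists_harmonicSpace_lalphaPow_lt (hα : 1 < α) (hw : IsDensity α w) (s t : ℝ)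
    (c : Fin T → ℂ) {ε : ℝ≥0∞} (hε : 0 < ε) : ∃ p ∈ harmonicSpace T univ,
      lalphaPow α w ((Ioc s t).indicator (fun _ => c) - p) < ε := by
  have hα0 : 0 < α := by linarith
  have hm : Measurable ((Ioc s t).indicator fun _ : ℝ => (1 : ℂ)) :=
    measurable_const.indicator measurableSet_Ioc
  have hρ : AEMeasurable (fun θ => (∑ k, ∑ l, ‖w θ k l‖ₑ) * ‖c‖ₑ ^ α) muC :=
    (Finset.aemeasurable_fun_sum _ fun k _ => Finset.aemeasurable_fun_sum _ fun l _ =>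
      (hw.integrable k l).1.enorm).mul_const _
  have hc : ‖c‖ₑ ^ α ≠ ⊤ := ENNReal.rpow_ne_top_of_nonneg hα0.le enorm_ne_top
  obtain ⟨p, hp, hlt⟩ := exists_trigSpace_lintegral_lt hρ
    (by
      rw [lintegral_mul_const' _ _ hc]
      exact ENNReal.mul_lt_top hw.lintegral_lt_top hc.lt_top) hα.le hm (C := 1) (fun θ => by
        by_cases hθ : θ ∈ Ioc s t <;> simp [hθ]) hε
  refine ⟨_, smul_mem_harmonicSpace hp c, lt_of_le_of_lt (lalphaPow_le hα w _) ?_⟩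
  refine lt_of_le_of_lt (lintegral_mono fun θ => le_of_eq ?_) hlt
  have e : ((Ioc s t).indicator (fun _ => c) - fun θ => p θ • c) θ
      = ((Ioc s t).indicator (fun _ => (1 : ℂ)) θ - p θ) • c := by
    by_cases hθ : θ ∈ Ioc s t <;> simp [hθ, sub_smul]
  simp only [e]
  rw [enorm_smul, ENNReal.mul_rpow_of_nonneg _ _ hα0.le, mul_assoc, mul_comm (‖c‖ₑ ^ α)]

/-- Continuous functions are uniformly approximated by step functions. -/
theorem exists_stepFun_norm_sub_le (hu : Continuous u) {ε : ℝ} (hε : 0 < ε) :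
    ∃ (n : ℕ) (s t : Fin n → ℝ) (c : Fin n → Fin T → ℂ),
      (∀ i, -Real.pi ≤ s i ∧ s i ≤ t i ∧ t i ≤ Real.pi) ∧
      ∀ θ ∈ Ioc (-Real.pi) Real.pi, ‖u θ - stepFun s t c θ‖ ≤ ε := by
  have hpi := Real.pi_pos
  have huc := isCompact_Icc.uniformContinuousOn_of_continuous
    (hu.continuousOn (s := Icc (-Real.pi) Real.pi))
  obtain ⟨δ, hδ, hδu⟩ := Metric.uniformContinuousOn_iff_le.1 huc ε hε
  obtain ⟨n, hn⟩ := exists_nat_gt (2 * Real.pi / δ)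
  have hn0 : (0 : ℝ) < n := lt_trans (by positivity) hn
  have hstep : 2 * Real.pi / n ≤ δ := by
    rw [div_lt_iff₀ hδ] at hn
    rw [div_le_iff₀ hn0]
    linarith
  set d := 2 * Real.pi / n with hd
  have hd0 : 0 < d := by positivity
  have hnd : n * d = 2 * Real.pi := by rw [hd]; field_simp
  have hbd : ∀ i : Fin n, ((i : ℕ) : ℝ) + 1 ≤ n := fun i => by exact_mod_cast i.2
  have hval : ∀ i : Fin n, -Real.pi ≤ -Real.pi + i * d ∧
      -Real.pi + i * d ≤ -Real.pi + (i + 1) * d ∧ -Real.pi + (i + 1) * d ≤ Real.pi := fun i => by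
    refine ⟨?_, by linarith, ?_⟩
    · have : (0 : ℝ) ≤ ((i : ℕ) : ℝ) * d := by positivity
      linarith
    · have := mul_le_mul_of_nonneg_right (hbd i) hd0.le
      linarith
  refine ⟨n, fun i => -Real.pi + i * d, fun i => -Real.pi + (i + 1) * d,
    fun i => u (-Real.pi + (i + 1) * d), hval, fun θ hθ => ?_⟩
  set x := (θ + Real.pi) / d with hx
  have hx0 : 0 < x := div_pos (by linarith [hθ.1]) hd0
  have hxn : x ≤ n := by
    rw [hx, div_le_iff₀ hd0, hnd]
    linarith [hθ.2]
  have hθx : θ = -Real.pi + x * d := by rw [hx]; field_simp; ring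
  have hc0 : 0 < ⌈x⌉₊ := Nat.ceil_pos.2 hx0
  have hcn : ⌈x⌉₊ ≤ n := Nat.ceil_le.2 hxn
  have hcx : x ≤ ⌈x⌉₊ := Nat.le_ceil x
  have hcx' : (⌈x⌉₊ : ℝ) < x + 1 := Nat.ceil_lt_add_one hx0.le
  have hmem : ∀ j : Fin n, θ ∈ Ioc (-Real.pi + j * d) (-Real.pi + (j + 1) * d)
      ↔ (j : ℝ) < x ∧ x ≤ j + 1 := fun j => by
    rw [hθx, mem_Ioc, add_lt_add_iff_left, add_le_add_iff_left, mul_lt_mul_iff_left₀ hd0,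
      mul_le_mul_iff_left₀ hd0]
  -- The cells are open on the left and closed on the right, so $\theta$ belongs to the cell with
  -- index $\lceil x\rceil-1$.
  let i : Fin n := ⟨⌈x⌉₊ - 1, by omega⟩
  have hi : ((i : ℕ) : ℝ) + 1 = ⌈x⌉₊ := by
    simp only [i]
    rw [Nat.cast_sub (by omega)]
    simp
  have hin : θ ∈ Ioc (-Real.pi + i * d) (-Real.pi + (i + 1) * d) :=
    (hmem i).2 ⟨by linarith, by linarith⟩
  have hstepθ : stepFun (fun i : Fin n => -Real.pi + i * d) (fun i => -Real.pi + (i + 1) * d)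
      (fun i => u (-Real.pi + (i + 1) * d)) θ = u (-Real.pi + (i + 1) * d) := by
    rw [stepFun, Finset.sum_eq_single i, indicator_of_mem hin]
    · intro j _ hj
      refine indicator_of_notMem (fun h => hj ?_) _
      obtain ⟨h1, h2⟩ := (hmem j).1 h
      have h3 : ((j : ℕ) : ℝ) < ⌈x⌉₊ := by linarith
      have h4 : (⌈x⌉₊ : ℝ) < ((j : ℕ) : ℝ) + 2 := by linarith
      have h3' : (j : ℕ) < ⌈x⌉₊ := by exact_mod_cast h3
      have h4' : ⌈x⌉₊ < (j : ℕ) + 2 := by exact_mod_cast h4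
      exact Fin.ext (by simp only [i]; omega)
    · simp
  rw [hstepθ, ← dist_eq_norm]
  refine hδu θ (Ioc_subset_Icc_self hθ) _ ⟨?_, (hval i).2.2⟩ ?_
  · exact (hval i).1.trans (hval i).2.1
  · rw [Real.dist_eq, abs_le]
    have h1 := hin.1
    have h2 := hin.2
    constructor <;> nlinarith

theorem measurable_stepFun {n : ℕ} (s t : Fin n → ℝ) (c : Fin n → Fin T → ℂ) :
    Measurable (stepFun s t c) := by
  unfold stepFun
  exact Finset.measurable_fun_sum _ fun i _ => measurable_const.indicator measurableSet_Ioc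

theorem IsDensity.exists_stepFun_lalphaPow_lt (hα : 1 < α) (hw : IsDensity α w) (hu : Continuous u)
    {ε : ℝ≥0∞} (hε : 0 < ε) : ∃ (n : ℕ) (s t : Fin n → ℝ) (c : Fin n → Fin T → ℂ),
      (∀ i, -Real.pi ≤ s i ∧ s i ≤ t i ∧ t i ≤ Real.pi) ∧
      lalphaPow α w (u - stepFun s t c) < ε := by
  have hlim : Tendsto (fun δ : ℝ => (∫⁻ θ in Ioc (-Real.pi) Real.pi, (∑ k, ∑ l, ‖w θ k l‖ₑ))
      * ENNReal.ofReal δ ^ α) (𝓝[>] 0) (𝓝 0) := by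
    have h1 : Tendsto (fun δ : ℝ => ENNReal.ofReal δ ^ α) (𝓝 0) (𝓝 0) := by
      have h2 := ((ENNReal.continuous_rpow_const (y := α)).comp ENNReal.continuous_ofReal).tendsto 0
      simpa [ENNReal.zero_rpow_of_pos (by linarith : 0 < α), Function.comp_def] using h2
    have h2 := ENNReal.Tendsto.const_mul h1 (Or.inr hw.lintegral_lt_top.ne)
    rw [mul_zero] at h2
    exact h2.mono_left nhdsWithin_le_nhds
  obtain ⟨δ, h1, h2⟩ := ((hlim.eventually (gt_mem_nhds hε)).and self_mem_nhdsWithin).exists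
  obtain ⟨n, s, t, c, hst, hle⟩ := exists_stepFun_norm_sub_le hu (ε := δ) h2
  refine ⟨n, s, t, c, hst, lt_of_le_of_lt (lalphaPow_le_of_enorm_le hα ENNReal.ofReal_ne_top
    fun θ hθ => ?_) h1⟩
  rw [← ofReal_norm]
  exact ENNReal.ofReal_le_ofReal (hle θ hθ)

end

/-! ### Integrals of step functions -/

section

variable {T : ℕ} {α : ℝ} {P : Measure Ω} {Z : ℝ → Ω → Fin T → ℂ}
  {w : ℝ → Matrix (Fin T) (Fin T) ℂ}

/-- `Z` is a symmetric stable process with independent increments and spectral density `w`. -/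
structure IsSpectralProcess (α : ℝ) (P : Measure Ω) (Z : ℝ → Ω → Fin T → ℂ)
    (w : ℝ → Matrix (Fin T) (Fin T) ℂ) : Prop where
  stable : IsSaSProcess α P Z
  indep : IndepIncrements P Z
  density : HasSpectralDensity α P Z w

theorem IsSpectralProcess.isDensity [IsProbabilityMeasure P] (hα₁ : 1 < α) (hα₂ : α ≤ 2)
    (hZ : IsSpectralProcess α P Z w) : IsDensity α w :=
  hZ.density.isDensity hα₁ hα₂ hZ.stable

/-- The span of the values of a stable process. -/
def processSpan (Z : ℝ → Ω → Fin T → ℂ) : Submodule ℂ (Ω → ℂ) :=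
  Submodule.span ℂ (range fun (p : Icc (-Real.pi) Real.pi × Fin T) ω => Z p.1 ω p.2)

/-- Finitely many elements of the span involve finitely many times, so the family is a linear image
of one finite family of values. -/
theorem IsSaSProcess.processSpan_saSSpace (hα : 0 < α) (hZ : IsSaSProcess α P Z) :
    SaSSpace α P (processSpan Z) := by
  classical
  intro n X hX
  choose c hc using fun k => Finsupp.mem_span_range_iff_exists_finsupp.1 (hX k)
  let S : Finset (Icc (-Real.pi) Real.pi) :=
    Finset.univ.biUnion fun k => (c k).support.image Prod.fst
  let e := S.equivFin
  refine (hZ S.card (fun i => ((e.symm i : S) : Icc (-Real.pi) Real.pi)) fun i =>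
    ((e.symm i : S) : Icc (-Real.pi) Real.pi).2).comp_linear hα
      (fun k p => c k (((e.symm p.1 : S) : Icc (-Real.pi) Real.pi), p.2)) fun k => ?_
  rw [← hc k, Finsupp.sum_of_support_subset (s := S ×ˢ Finset.univ) _ ?_ _ (by simp),
    Finset.sum_product, Fintype.sum_prod_type,
    ← Finset.sum_coe_sort S, ← e.symm.sum_comp]
  intro p hp
  refine Finset.mem_product.2 ⟨?_, Finset.mem_univ _⟩
  exact Finset.mem_biUnion.2 ⟨k, Finset.mem_univ _, Finset.mem_image_of_mem _ hp⟩

/-- The step function `c 1_{(s, t]}` together with its integral. -/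
def stepPair (Z : ℝ → Ω → Fin T → ℂ) (s t : ℝ) :
    (Fin T → ℂ) →ₗ[ℂ] (ℝ → Fin T → ℂ) × (Ω → ℂ) where
  toFun c := ((Ioc s t).indicator fun _ => c, fun ω => c ⬝ᵥ (Z t ω - Z s ω))
  map_add' c d := by
    refine Prod.ext ?_ ?_
    · exact Set.indicator_add _ _ _
    · funext ω
      exact add_dotProduct c d (Z t ω - Z s ω)
  map_smul' a c := by
    refine Prod.ext ?_ ?_
    · exact Set.indicator_const_smul _ _ _
    · funext ω
      exact smul_dotProduct a c (Z t ω - Z s ω)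

theorem sum_stepPair {n : ℕ} (s t : Fin n → ℝ) (c : Fin n → Fin T → ℂ) :
    ∑ i, stepPair Z (s i) (t i) (c i) = (stepFun s t c, stepIntegral Z s t c) := by
  refine Prod.ext ?_ ?_
  · rw [Prod.fst_sum]
    funext θ
    simp [stepPair, stepFun]
  · rw [Prod.snd_sum]
    funext ω
    simp [stepPair, stepIntegral]

/-- The space of the step functions together with their integrals. -/
def stepPairs (Z : ℝ → Ω → Fin T → ℂ) : Submodule ℂ ((ℝ → Fin T → ℂ) × (Ω → ℂ)) where
  carrier := {x | ∃ (n : ℕ) (s t : Fin n → ℝ) (c : Fin n → Fin T → ℂ),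
    (∀ i, -Real.pi ≤ s i ∧ s i ≤ t i ∧ t i ≤ Real.pi) ∧ x = (stepFun s t c, stepIntegral Z s t c)}
  zero_mem' := ⟨0, Fin.elim0, Fin.elim0, Fin.elim0, fun i => i.elim0, by
    rw [← sum_stepPair]; simp⟩
  add_mem' := by
    rintro _ _ ⟨n, s, t, c, h, rfl⟩ ⟨m, s', t', c', h', rfl⟩
    refine ⟨n + m, Fin.append s s', Fin.append t t', Fin.append c c', fun i => ?_, ?_⟩
    · refine Fin.addCases (fun i => ?_) (fun i => ?_) i
      · simpa using h i
      · simpa using h' i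
    · rw [← sum_stepPair, ← sum_stepPair, ← sum_stepPair, Fin.sum_univ_add]
      simp
  smul_mem' := by
    rintro a _ ⟨n, s, t, c, h, rfl⟩
    refine ⟨n, s, t, fun i => a • c i, h, ?_⟩
    rw [← sum_stepPair, ← sum_stepPair, Finset.smul_sum]
    simp

theorem isStochIntegral_iff {u : ℝ → Fin T → ℂ} {Y : Ω → ℂ} :
    IsStochIntegral α P Z w u Y ↔ MemLalpha α w u ∧ ∀ ε : ℝ≥0∞, 0 < ε → ∃ x ∈ stepPairs Z,
      lalphaPow α w (u - x.1) < ε ∧ stableNorm α P (Y - x.2) < ε := by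
  refine and_congr_right fun _ => forall₂_congr fun ε _ => ?_
  constructor
  · rintro ⟨n, s, t, c, h1, h2, h3⟩
    exact ⟨_, ⟨n, s, t, c, h1, rfl⟩, h2, h3⟩
  · rintro ⟨_, ⟨n, s, t, c, h1, rfl⟩, h2, h3⟩
    exact ⟨n, s, t, c, h1, h2, h3⟩

/-- A telescoping sum, for functions and integrals at once:
$1_{(s,t]}c=1_{(-\infty,t]}c-1_{(-\infty,s]}c$ matches $c\cdot Z(t)-c\cdot Z(s)$. -/
theorem stepPair_sum_Ico {τ : ℕ → ℝ} (hτ : Monotone τ) {p q : ℕ} (hpq : p ≤ q) (c : Fin T → ℂ) :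
    ∑ j ∈ Finset.Ico p q, stepPair Z (τ j) (τ (j + 1)) c = stepPair Z (τ p) (τ q) c := by
  let F : ℕ → (ℝ → Fin T → ℂ) × (Ω → ℂ) := fun j =>
    ((Iic (τ j)).indicator fun _ => c, fun ω => c ⬝ᵥ Z (τ j) ω)
  have hF : ∀ {i j}, i ≤ j → stepPair Z (τ i) (τ j) c = F j - F i := fun {i j} hij => by
    refine Prod.ext ?_ ?_
    · funext θ
      have h := hτ hij
      simp only [stepPair, LinearMap.coe_mk, AddHom.coe_mk, F, Prod.fst_sub, Pi.sub_apply,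
        indicator_apply, mem_Ioc, mem_Iic]
      by_cases h1 : θ ≤ τ i
      · simp [h1, h1.trans h, not_lt.2 h1]
      · simp [h1, not_le.1 h1]
    · funext ω
      exact dotProduct_sub c (Z (τ j) ω) (Z (τ i) ω)
  rw [hF hpq, ← Finset.sum_Ico_sub F hpq]
  exact Finset.sum_congr rfl fun j _ => hF (Nat.le_succ j)

/-- Every step function is a step function over a partition. -/
theorem exists_eq_sum_stepPair {x : (ℝ → Fin T → ℂ) × (Ω → ℂ)} (hx : x ∈ stepPairs Z) :
    ∃ (τ : ℕ → ℝ) (m : ℕ) (d : ℕ → Fin T → ℂ), Monotone τ ∧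
      (∀ j, τ j ∈ Icc (-Real.pi) Real.pi) ∧
      x = ∑ j ∈ Finset.range m, stepPair Z (τ j) (τ (j + 1)) (d j) := by
  classical
  obtain ⟨n, s, t, c, h, rfl⟩ := hx
  -- The endpoint $-\pi$ keeps the set nonempty when there are no intervals.
  let S : Finset ℝ := insert (-Real.pi) (Finset.univ.image s ∪ Finset.univ.image t)
  have hS : ∀ x ∈ S, x ∈ Icc (-Real.pi) Real.pi := fun x hx => by
    have hpi := Real.pi_pos
    simp only [S, Finset.mem_insert, Finset.mem_union, Finset.mem_image, Finset.mem_univ,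
      true_and] at hx
    rcases hx with rfl | ⟨i, rfl⟩ | ⟨i, rfl⟩
    · exact ⟨le_rfl, by linarith⟩
    · exact ⟨(h i).1, (h i).2.1.trans (h i).2.2⟩
    · exact ⟨(h i).1.trans (h i).2.1, (h i).2.2⟩
  have hcard : 0 < S.card := Finset.card_pos.2 ⟨_, Finset.mem_insert_self _ _⟩
  let o := S.orderEmbOfFin rfl
  -- The index is clamped, so $\tau$ is constant past the last node and the final cell is empty.
  let τ : ℕ → ℝ := fun j => o ⟨min j (S.card - 1), by omega⟩
  have hτ : Monotone τ := fun i j hij => o.monotone (Fin.mk_le_mk.2 (by omega))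
  have hex : ∀ x ∈ S, ∃ p, p < S.card ∧ τ p = x := fun x hx => by
    have : x ∈ range o := by rw [Finset.range_orderEmbOfFin]; exact hx
    obtain ⟨p, rfl⟩ := this
    exact ⟨p, p.2, congrArg o (Fin.ext (by simp; omega))⟩
  choose p hp hps using fun i => hex (s i) (by simp [S])
  choose q hq hqt using fun i => hex (t i) (by simp [S])
  have hpq : ∀ i, p i ≤ q i := fun i => by
    have h1 : τ (p i) ≤ τ (q i) := by rw [hps, hqt]; exact (h i).2.1
    have h2 := o.le_iff_le.1 h1
    have h3 := Fin.mk_le_mk.1 h2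
    have := hp i
    have := hq i
    omega
  -- On each cell the coefficient is the sum of the values of all the given intervals that cover it.
  refine ⟨τ, S.card, fun j => ∑ i, if j ∈ Finset.Ico (p i) (q i) then c i else 0, hτ,
    fun j => hS _ (Finset.orderEmbOfFin_mem _ _ _), ?_⟩
  simp only [map_sum]
  rw [← sum_stepPair, Finset.sum_comm]
  refine Finset.sum_congr rfl fun i _ => ?_
  simp only [apply_ite (stepPair Z _ _), map_zero]
  rw [Finset.sum_ite_mem, Finset.inter_eq_right.2, stepPair_sum_Ico hτ (hpq i), hps, hqt]
  intro j hj
  have := (Finset.mem_Ico.1 hj).2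
  have := hq i
  exact Finset.mem_range.2 (by omega)

theorem stepPair_snd_mem_processSpan {s t : ℝ} (hs : s ∈ Icc (-Real.pi) Real.pi)
    (ht : t ∈ Icc (-Real.pi) Real.pi) (c : Fin T → ℂ) : (stepPair Z s t c).2 ∈ processSpan Z := by
  have e : (stepPair Z s t c).2
      = ∑ k, c k • ((fun ω => Z t ω k) - fun ω => Z s ω k) := by
    funext ω
    simp [stepPair, dotProduct]
  rw [e]
  exact Submodule.sum_mem _ fun k _ => Submodule.smul_mem _ _ (Submodule.sub_mem _
    (Submodule.subset_span ⟨(⟨t, ht⟩, k), rfl⟩) (Submodule.subset_span ⟨(⟨s, hs⟩, k), rfl⟩))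

theorem snd_mem_processSpan {x : (ℝ → Fin T → ℂ) × (Ω → ℂ)} (hx : x ∈ stepPairs Z) :
    x.2 ∈ processSpan Z := by
  obtain ⟨τ, m, d, -, hτ, rfl⟩ := exists_eq_sum_stepPair hx
  rw [Prod.snd_sum]
  exact Submodule.sum_mem _ fun j _ => stepPair_snd_mem_processSpan (hτ _) (hτ _) _

theorem IndepIncrements.cf_sum [IsProbabilityMeasure P] (hZ : IsSaSProcess α P Z) (hα : 0 < α)
    (hI : IndepIncrements P Z) {τ : ℕ → ℝ} (hτ : Monotone τ)
    (hτm : ∀ j, τ j ∈ Icc (-Real.pi) Real.pi) (d : ℕ → Fin T → ℂ) (m : ℕ) :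
    cf P (∑ j ∈ Finset.range m, (stepPair Z (τ j) (τ (j + 1)) (d j)).2)
      = ∏ j ∈ Finset.range m, cf P (stepPair Z (τ j) (τ (j + 1)) (d j)).2 := by
  have h := (hI m (fun i => τ i) (fun i j hij => hτ hij) fun i => hτm _).integral_fun_prod_comp
    (f := fun (i : Fin m) (x : Fin T → ℂ) => Complex.exp (Complex.I * (((d i ⬝ᵥ x).re : ℝ) : ℂ)))
    (fun i => aemeasurable_pi_lambda _ fun k => (hZ.increments hα (hτm _) (hτm _)).1 k)
    (fun i => Continuous.aestronglyMeasurable (by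
      have : Continuous fun x : Fin T → ℂ => d i ⬝ᵥ x :=
        Continuous.dotProduct continuous_const continuous_id
      fun_prop))
  rw [Finset.prod_range]
  refine Eq.trans ?_ h
  refine integral_congr_ae (Eventually.of_forall fun ω => ?_)
  simp only [Finset.sum_apply]
  rw [← Complex.exp_sum, Complex.re_sum, ← Finset.mul_sum, Finset.sum_range]
  push_cast
  rfl

theorem stepPair_fst_of_notMem {s t : ℝ} (c : Fin T → ℂ) {θ : ℝ} (h : θ ∉ Ioc s t) :
    (stepPair Z s t c).1 θ = 0 := indicator_of_notMem h fun _ => c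

theorem measurable_stepPair_fst (s t : ℝ) (c : Fin T → ℂ) : Measurable (stepPair Z s t c).1 :=
  measurable_const.indicator measurableSet_Ioc

theorem measurable_fst_of_mem_stepPairs {x : (ℝ → Fin T → ℂ) × (Ω → ℂ)} (hx : x ∈ stepPairs Z) :
    Measurable x.1 := by
  obtain ⟨n, s, t, c, h, rfl⟩ := hx
  exact measurable_stepFun s t c

theorem IsDensity.lalphaPow_add_of_disjoint (hw : IsDensity α w)
    {u v : ℝ → Fin T → ℂ} (hu : AEStronglyMeasurable u muC) (h : ∀ θ, u θ = 0 ∨ v θ = 0) :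
    lalphaPow α w (u + v) = lalphaPow α w u + lalphaPow α w v := by
  rw [lalphaPow, lalphaPow, lalphaPow,
    ← lintegral_add_left' (hw.aestronglyMeasurable_alphaForm hu).enorm]
  refine lintegral_congr fun θ => ?_
  have h0 : pform α (w θ) 0 0 = 0 := by simp [pform]
  simp only [alphaForm_eq_pform, Pi.add_apply]
  rcases h θ with h | h <;> simp [h, h0]

theorem IsSpectralProcess.stablePow_stepPair [IsProbabilityMeasure P] (hα₁ : 1 < α) (hα₂ : α ≤ 2)
    (hZ : IsSpectralProcess α P Z w) {s t : ℝ} (hs : -Real.pi ≤ s) (hst : s ≤ t)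
    (ht : t ≤ Real.pi) (c : Fin T → ℂ) :
    stablePow α P (stepPair Z s t c).2 = lalphaPow α w (stepPair Z s t c).1 := by
  have hα0 : 0 < α := by linarith
  have hw := hZ.isDensity hα₁ hα₂
  have hfin : lalphaPow α w (stepPair Z s t c).1 ≠ ⊤ :=
    ((hw.memLalpha_of_enorm_le hα₁ (c := ‖c‖ₑ) enorm_ne_top
      (measurable_stepPair_fst s t c).aestronglyMeasurable fun θ _ => by
        by_cases h : θ ∈ Ioc s t <;> simp [stepPair, h]).2).ne
  have hS := hZ.stable.isSaS_dotProduct hα0 ⟨hs, hst.trans ht⟩ ⟨hs.trans hst, ht⟩ c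
  change IsSaS α P (stepPair Z s t c).2 at hS
  rw [← ENNReal.toReal_eq_toReal_iff' (hS.stablePow_lt_top hα0).ne hfin]
  have h1 := hZ.density.stablePow_increment hα0 hZ.stable hs hst ht c
  have h2 := hw.integral_alphaForm hα0 (u := (stepPair Z s t c).1)
    (measurable_stepPair_fst s t c).aestronglyMeasurable
  have h3 : ∫ θ in Ioc (-Real.pi) Real.pi, alphaForm α w (stepPair Z s t c).1 θ
      = ∫ θ in Ioc s t, pform α (w θ) c c := by
    have e : alphaForm α w (stepPair Z s t c).1
        = (Ioc s t).indicator fun θ => pform α (w θ) c c := by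
      funext θ
      have h0 : pform α (w θ) 0 0 = 0 := by simp [pform]
      by_cases h : θ ∈ Ioc s t <;> simp [alphaForm_eq_pform, stepPair, h, h0]
    rw [e, integral_indicator measurableSet_Ioc, Measure.restrict_restrict measurableSet_Ioc,
      inter_eq_self_of_subset_left (Ioc_subset_Ioc hs ht)]
  rw [h3, ← h1] at h2
  exact_mod_cast h2

/-- The integrals of step functions define an isometry. -/
theorem IsSpectralProcess.stablePow_eq_of_mem_stepPairs [IsProbabilityMeasure P] (hα₁ : 1 < α)
    (hα₂ : α ≤ 2) (hZ : IsSpectralProcess α P Z w) {x : (ℝ → Fin T → ℂ) × (Ω → ℂ)}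
    (hx : x ∈ stepPairs Z) : stablePow α P x.2 = lalphaPow α w x.1 := by
  have hα0 : 0 < α := by linarith
  have hw := hZ.isDensity hα₁ hα₂
  obtain ⟨τ, m, d, hτ, hτm, rfl⟩ := exists_eq_sum_stepPair hx
  clear hx
  rw [Prod.snd_sum, Prod.fst_sum]
  induction m with
  | zero =>
    simp only [Finset.range_zero, Finset.sum_empty]
    rw [lalphaPow_zero hα0, stablePow_zero]
  | succ m ih =>
    have hV := hZ.stable.processSpan_saSSpace hα0
    have hmem : ∀ j, (stepPair Z (τ j) (τ (j + 1)) (d j)).2 ∈ processSpan Z :=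
      fun j => stepPair_snd_mem_processSpan (hτm _) (hτm _) _
    have hcf : ∀ (a : ℂ) (m : ℕ),
        cf P (∑ j ∈ Finset.range m, a • (stepPair Z (τ j) (τ (j + 1)) (d j)).2)
          = ∏ j ∈ Finset.range m, cf P (a • (stepPair Z (τ j) (τ (j + 1)) (d j)).2) := fun a m => by
      have := hZ.indep.cf_sum hZ.stable hα0 hτ hτm (fun j => a • d j) m
      simpa only [map_smul, Prod.smul_snd] using this
    -- Both sides are additive over the last cell: the stable power by independence of increments,
    -- the $L^\alpha(w)$ power by disjointness of supports.
    rw [Finset.sum_range_succ, Finset.sum_range_succ,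
      IsSaS.stablePow_add hα0 (hV.isSaS (Submodule.sum_mem _ fun j _ => hmem j))
        (hV.isSaS (hmem m)), ih,
      hZ.stablePow_stepPair hα₁ hα₂ (hτm _).1 (hτ (Nat.le_succ m)) (hτm _).2,
      hw.lalphaPow_add_of_disjoint]
    · refine Measurable.aestronglyMeasurable ?_
      have h1 := Finset.measurable_sum (f := fun j => (stepPair Z (τ j) (τ (j + 1)) (d j)).1)
        (Finset.range m) fun j _ => measurable_stepPair_fst (τ j) (τ (j + 1)) (d j)
      simpa only [← Finset.sum_apply] using h1
    · intro θ
      by_cases h : θ ∈ Ioc (τ m) (τ (m + 1))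
      · left
        rw [Finset.sum_apply]
        refine Finset.sum_eq_zero fun j hj => stepPair_fst_of_notMem _ fun h' => ?_
        have h1 := hτ (Finset.mem_range.1 hj : j + 1 ≤ m)
        exact absurd (h'.2.trans h1) (not_le.2 h.1)
      · exact Or.inr (stepPair_fst_of_notMem _ h)
    · intro a
      rw [Finset.smul_sum, ← Finset.sum_range_succ, hcf, hcf, Finset.prod_range_succ]

end

/-! ### Stochastic integrals -/

section

variable {α : ℝ} {P : Measure Ω} {V : Submodule ℂ (Ω → ℂ)} [IsProbabilityMeasure P]

theorem SaSSpace.stableNorm_add_le (hα : 1 ≤ α) (hV : SaSSpace α P V) {X Y : Ω → ℂ} (hX : X ∈ V)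
    (hY : Y ∈ V) : stableNorm α P (X + Y) ≤ stableNorm α P X + stableNorm α P Y :=
  (hV.pair hX hY).stableNorm_add_le hα

theorem SaSSpace.stableNorm_sub_comm (hα : 0 < α) (hV : SaSSpace α P V) {X Y : Ω → ℂ} (hX : X ∈ V)
    (hY : Y ∈ V) : stableNorm α P (X - Y) = stableNorm α P (Y - X) := by
  have e : X - Y = (-1 : ℂ) • (Y - X) := by simp
  rw [e, (hV.isSaS (V.sub_mem hY hX)).stableNorm_smul hα]
  simp

theorem SaSSpace.stableNorm_sub_le (hα : 1 ≤ α) (hV : SaSSpace α P V) {X Y W : Ω → ℂ} (hX : X ∈ V)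
    (hY : Y ∈ V) (hW : W ∈ V) :
    stableNorm α P (X - W) ≤ stableNorm α P (X - Y) + stableNorm α P (Y - W) := by
  have := hV.stableNorm_add_le hα (V.sub_mem hX hY) (V.sub_mem hY hW)
  rwa [sub_add_sub_cancel] at this

end

section

variable {T : ℕ} {α : ℝ} {P : Measure Ω} {Z : ℝ → Ω → Fin T → ℂ}
  {w : ℝ → Matrix (Fin T) (Fin T) ℂ} {u v : ℝ → Fin T → ℂ} {X Y : Ω → ℂ}

theorem isStochIntegral_iff_lnorm (hα : 0 < α) :
    IsStochIntegral α P Z w u Y ↔ MemLalpha α w u ∧ ∀ ε : ℝ≥0∞, 0 < ε → ∃ x ∈ stepPairs Z,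
      lnorm α w (u - x.1) < ε ∧ stableNorm α P (Y - x.2) < ε := by
  rw [isStochIntegral_iff]
  refine and_congr_right fun _ => ⟨fun h ε hε => ?_, fun h ε hε => ?_⟩
  · obtain ⟨x, hx, h1, h2⟩ := h (min ε (ε ^ α))
      (lt_min hε (ENNReal.rpow_pos_of_nonneg hε hα.le))
    refine ⟨x, hx, ?_, h2.trans_le (min_le_left _ _)⟩
    rw [← ENNReal.rpow_lt_rpow_iff hα, lnorm_rpow hα]
    exact h1.trans_le (min_le_right _ _)
  · have hα' : 0 < 1 / α := by positivity
    obtain ⟨x, hx, h1, h2⟩ := h (min ε (ε ^ (1 / α)))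
      (lt_min hε (ENNReal.rpow_pos_of_nonneg hε hα'.le))
    refine ⟨x, hx, ?_, h2.trans_le (min_le_left _ _)⟩
    rw [← ENNReal.rpow_lt_rpow_iff hα']
    exact h1.trans_le (min_le_right _ _)

variable [IsProbabilityMeasure P]

theorem IsSpectralProcess.stableNorm_eq_of_mem_stepPairs (hα₁ : 1 < α) (hα₂ : α ≤ 2)
    (hZ : IsSpectralProcess α P Z w) {x : (ℝ → Fin T → ℂ) × (Ω → ℂ)} (hx : x ∈ stepPairs Z) :
    stableNorm α P x.2 = lnorm α w x.1 := by
  have hα0 : 0 < α := by linarith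
  rw [((hZ.stable.processSpan_saSSpace hα0).isSaS (snd_mem_processSpan hx)).stableNorm_eq hα0,
    hZ.stablePow_eq_of_mem_stepPairs hα₁ hα₂ hx, lnorm]

/-- The closed linear span of the values of a stable process. -/
def IsSpectralProcess.space (hα₁ : 1 < α) (hα₂ : α ≤ 2) (hZ : IsSpectralProcess α P Z w) :
    Submodule ℂ (Ω → ℂ) :=
  (hZ.stable.processSpan_saSSpace (by linarith)).closure hα₁.le hα₂

theorem IsSpectralProcess.space_saSSpace (hα₁ : 1 < α) (hα₂ : α ≤ 2)
    (hZ : IsSpectralProcess α P Z w) : SaSSpace α P (hZ.space hα₁ hα₂) :=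
  SaSSpace.closure_saSSpace _ _ _

theorem IsSpectralProcess.snd_mem_space (hα₁ : 1 < α) (hα₂ : α ≤ 2)
    (hZ : IsSpectralProcess α P Z w) {x : (ℝ → Fin T → ℂ) × (Ω → ℂ)} (hx : x ∈ stepPairs Z) :
    x.2 ∈ hZ.space hα₁ hα₂ :=
  SaSSpace.le_closure _ _ _ (snd_mem_processSpan hx)

theorem IsSpectralProcess.mem_space (hα₁ : 1 < α) (hα₂ : α ≤ 2)
    (hZ : IsSpectralProcess α P Z w) (h : IsStochIntegral α P Z w u Y) :
    Y ∈ hZ.space hα₁ hα₂ := by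
  refine (SaSSpace.mem_closure_iff hα₁.le hα₂ _).2 fun ε hε => ?_
  obtain ⟨x, hx, -, h2⟩ := (isStochIntegral_iff.1 h).2 ε hε
  exact ⟨x.2, snd_mem_processSpan hx, h2⟩

/-- The isometry on step functions passes to limits by the triangle inequality in both spaces.
Consequently an integral is determined by its integrand up to norm zero. -/
theorem IsSpectralProcess.stableNorm_eq (hα₁ : 1 < α) (hα₂ : α ≤ 2)
    (hZ : IsSpectralProcess α P Z w) (h : IsStochIntegral α P Z w u Y) :
    stableNorm α P Y = lnorm α w u := by
  have hα0 : 0 < α := by linarith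
  have hw := hZ.isDensity hα₁ hα₂
  have hS := hZ.space_saSSpace hα₁ hα₂
  have hY := hZ.mem_space hα₁ hα₂ h
  have h' := (isStochIntegral_iff_lnorm hα0).1 h
  refine le_antisymm ?_ ?_ <;> refine ENNReal.le_of_forall_pos_le_add fun ε hε _ => ?_
  all_goals
    have hε2 : (0 : ℝ≥0∞) < (ε / 2 : NNReal) := by exact_mod_cast half_pos hε
    obtain ⟨x, hx, h1, h2⟩ := h'.2 _ hε2
    have hxm := (measurable_fst_of_mem_stepPairs hx).aestronglyMeasurable (μ := muC)
    have e := hZ.stableNorm_eq_of_mem_stepPairs hα₁ hα₂ hx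
    have hx2 := hZ.snd_mem_space hα₁ hα₂ hx
    have hsum : ((ε / 2 : NNReal) : ℝ≥0∞) + (ε / 2 : NNReal) = ε := by
      exact_mod_cast add_halves ε
  · have h3 : stableNorm α P Y ≤ stableNorm α P (Y - x.2) + stableNorm α P x.2 := by
      have := hS.stableNorm_add_le hα₁.le ((hZ.space hα₁ hα₂).sub_mem hY hx2) hx2
      rwa [sub_add_cancel] at this
    have h4 : lnorm α w x.1 ≤ lnorm α w (u - x.1) + lnorm α w u := by
      have := hw.lnorm_add_le hα₁.le (hxm.sub h.1.1) h.1.1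
      rwa [sub_add_cancel, lnorm_sub_comm hα0] at this
    calc stableNorm α P Y ≤ stableNorm α P (Y - x.2) + (lnorm α w (u - x.1) + lnorm α w u) := by
          rw [e] at h3; exact h3.trans (by gcongr)
      _ ≤ (ε / 2 : NNReal) + ((ε / 2 : NNReal) + lnorm α w u) := by gcongr
      _ = lnorm α w u + ε := by rw [← add_assoc, hsum, add_comm]
  · have h3 : stableNorm α P x.2 ≤ stableNorm α P (Y - x.2) + stableNorm α P Y := by
      have := hS.stableNorm_add_le hα₁.le ((hZ.space hα₁ hα₂).sub_mem hx2 hY) hY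
      rwa [sub_add_cancel, hS.stableNorm_sub_comm hα0 hx2 hY] at this
    have h4 : lnorm α w u ≤ lnorm α w (u - x.1) + lnorm α w x.1 := by
      have := hw.lnorm_add_le hα₁.le (h.1.1.sub hxm) hxm
      rwa [sub_add_cancel] at this
    calc lnorm α w u ≤ lnorm α w (u - x.1) + (stableNorm α P (Y - x.2) + stableNorm α P Y) := by
          rw [← e] at h4; exact h4.trans (by gcongr)
      _ ≤ (ε / 2 : NNReal) + ((ε / 2 : NNReal) + stableNorm α P Y) := by gcongr
      _ = stableNorm α P Y + ε := by rw [← add_assoc, hsum, add_comm]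

theorem IsSpectralProcess.stablePow_eq (hα₁ : 1 < α) (hα₂ : α ≤ 2)
    (hZ : IsSpectralProcess α P Z w) (h : IsStochIntegral α P Z w u Y) :
    stablePow α P Y = lalphaPow α w u := by
  have hα0 : 0 < α := by linarith
  rw [((hZ.space_saSSpace hα₁ hα₂).isSaS (hZ.mem_space hα₁ hα₂ h)).stablePow_eq_rpow hα0,
    hZ.stableNorm_eq hα₁ hα₂ h, lnorm_rpow hα0]

/-- The space of the functions of `L^α(w)` together with their stochastic integrals. -/
def IsSpectralProcess.stochPairs (hα₁ : 1 < α) (hα₂ : α ≤ 2) (hZ : IsSpectralProcess α P Z w) :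
    Submodule ℂ ((ℝ → Fin T → ℂ) × (Ω → ℂ)) where
  carrier := {x | IsStochIntegral α P Z w x.1 x.2}
  zero_mem' := by
    have hα0 : 0 < α := by linarith
    refine (isStochIntegral_iff_lnorm hα0).2 ⟨memLalpha_zero hα0, fun ε hε =>
      ⟨0, Submodule.zero_mem _, ?_, ?_⟩⟩
    · simpa [lnorm_zero hα0] using hε
    · have := hZ.stableNorm_eq_of_mem_stepPairs hα₁ hα₂ (Submodule.zero_mem (stepPairs Z))
      simp only [Prod.snd_zero, Prod.fst_zero, lnorm_zero hα0] at this
      simpa [this] using hε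
  add_mem' := by
    rintro ⟨u, X⟩ ⟨v, Y⟩ hu hv
    have hα0 : 0 < α := by linarith
    have hw := hZ.isDensity hα₁ hα₂
    refine (isStochIntegral_iff_lnorm hα0).2 ⟨hw.memLalpha_add hα₁.le hu.1 hv.1, fun ε hε => ?_⟩
    obtain ⟨x, hx, hx1, hx2⟩ := ((isStochIntegral_iff_lnorm hα0).1 hu).2 _ (ENNReal.half_pos hε.ne')
    obtain ⟨y, hy, hy1, hy2⟩ := ((isStochIntegral_iff_lnorm hα0).1 hv).2 _ (ENNReal.half_pos hε.ne')
    have hxm := (measurable_fst_of_mem_stepPairs hx).aestronglyMeasurable (μ := muC)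
    have hym := (measurable_fst_of_mem_stepPairs hy).aestronglyMeasurable (μ := muC)
    refine ⟨x + y, Submodule.add_mem _ hx hy, ?_, ?_⟩
    · simp only [Prod.fst_add, add_sub_add_comm]
      refine (hw.lnorm_add_le hα₁.le (hu.1.1.sub hxm) (hv.1.1.sub hym)).trans_lt ?_
      exact (ENNReal.add_lt_add hx1 hy1).trans_eq (ENNReal.add_halves ε)
    · simp only [Prod.snd_add, add_sub_add_comm]
      refine ((hZ.space_saSSpace hα₁ hα₂).stableNorm_add_le hα₁.le
        (Submodule.sub_mem _ (hZ.mem_space hα₁ hα₂ hu) (hZ.snd_mem_space hα₁ hα₂ hx))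
        (Submodule.sub_mem _ (hZ.mem_space hα₁ hα₂ hv) (hZ.snd_mem_space hα₁ hα₂ hy))).trans_lt ?_
      exact (ENNReal.add_lt_add hx2 hy2).trans_eq (ENNReal.add_halves ε)
  smul_mem' := by
    rintro a ⟨u, X⟩ hu
    have hα0 : 0 < α := by linarith
    refine (isStochIntegral_iff_lnorm hα0).2 ⟨memLalpha_smul hα0 a hu.1, fun ε hε => ?_⟩
    obtain ⟨x, hx, hx1, hx2⟩ := ((isStochIntegral_iff_lnorm hα0).1 hu).2 (ε / (‖a‖ₑ + 1))
      (ENNReal.div_pos hε.ne' (by simp))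
    have hle : ∀ r : ℝ≥0∞, r < ε / (‖a‖ₑ + 1) → ‖a‖ₑ * r < ε := fun r hr => by
      rw [ENNReal.lt_div_iff_mul_lt (by simp) (by simp)] at hr
      refine lt_of_le_of_lt ?_ hr
      rw [mul_comm]
      gcongr
      exact le_self_add
    refine ⟨a • x, Submodule.smul_mem _ a hx, ?_, ?_⟩
    · simp only [Prod.smul_fst, ← smul_sub]
      rw [lnorm_smul hα0]
      exact hle _ hx1
    · simp only [Prod.smul_snd, ← smul_sub]
      rw [((hZ.space_saSSpace hα₁ hα₂).isSaS (Submodule.sub_mem _ (hZ.mem_space hα₁ hα₂ hu)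
        (hZ.snd_mem_space hα₁ hα₂ hx))).stableNorm_smul hα0]
      exact hle _ hx2

/-- The stochastic integral is closed. -/
theorem IsSpectralProcess.isStochIntegral_of_forall (hα₁ : 1 < α) (hα₂ : α ≤ 2)
    (hZ : IsSpectralProcess α P Z w) (hu : MemLalpha α w u)
    (h : ∀ ε : ℝ≥0∞, 0 < ε → ∃ v X, IsStochIntegral α P Z w v X ∧ lnorm α w (u - v) < ε ∧
      stableNorm α P (Y - X) < ε) : IsStochIntegral α P Z w u Y := by
  have hα0 : 0 < α := by linarith
  have hw := hZ.isDensity hα₁ hα₂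
  have hS := hZ.space_saSSpace hα₁ hα₂
  have hY : Y ∈ hS.closure hα₁.le hα₂ := (hS.mem_closure_iff hα₁.le hα₂).2 fun ε hε => by
    obtain ⟨v, X, h1, -, h3⟩ := h ε hε
    exact ⟨X, hZ.mem_space hα₁ hα₂ h1, h3⟩
  refine (isStochIntegral_iff_lnorm hα0).2 ⟨hu, fun ε hε => ?_⟩
  obtain ⟨v, X, h1, h2, h3⟩ := h _ (ENNReal.half_pos hε.ne')
  obtain ⟨x, hx, h4, h5⟩ := ((isStochIntegral_iff_lnorm hα0).1 h1).2 _ (ENNReal.half_pos hε.ne')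
  have hxm := (measurable_fst_of_mem_stepPairs hx).aestronglyMeasurable (μ := muC)
  refine ⟨x, hx, ?_, ?_⟩
  · have h6 := hw.lnorm_add_le hα₁.le (hu.1.sub h1.1.1) (h1.1.1.sub hxm)
    rw [sub_add_sub_cancel] at h6
    exact (h6.trans_lt (ENNReal.add_lt_add h2 h4)).trans_eq (ENNReal.add_halves ε)
  · have h6 := (hS.closure_saSSpace hα₁.le hα₂).stableNorm_sub_le hα₁.le hY
      (hS.le_closure hα₁.le hα₂ (hZ.mem_space hα₁ hα₂ h1))
      (hS.le_closure hα₁.le hα₂ (hZ.snd_mem_space hα₁ hα₂ hx))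
    exact (h6.trans_lt (ENNReal.add_lt_add h3 h5)).trans_eq (ENNReal.add_halves ε)

/-- Functions that have a stochastic integral are limits of trigonometric polynomials. -/
theorem IsSpectralProcess.exists_harmonicSpace_lnorm_lt (hα₁ : 1 < α) (hα₂ : α ≤ 2)
    (hZ : IsSpectralProcess α P Z w) (h : IsStochIntegral α P Z w u Y) {ε : ℝ≥0∞} (hε : 0 < ε) :
    ∃ p ∈ harmonicSpace T univ, lnorm α w (u - p) < ε := by
  have hα0 : 0 < α := by linarith
  have hw := hZ.isDensity hα₁ hα₂
  have key : ∀ x ∈ stepPairs Z, ∀ ε : ℝ≥0∞, 0 < ε →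
      ∃ p ∈ harmonicSpace T univ, lnorm α w (x.1 - p) < ε := by
    intro x hx
    obtain ⟨τ, m, d, -, -, rfl⟩ := exists_eq_sum_stepPair hx
    clear hx
    induction m with
    | zero => exact fun ε hε => ⟨0, Submodule.zero_mem _, by simpa [lnorm_zero hα0] using hε⟩
    | succ m ih =>
      intro ε hε
      obtain ⟨p, hp, h1⟩ := ih _ (ENNReal.half_pos hε.ne')
      obtain ⟨q, hq, h2⟩ := hw.exists_harmonicSpace_lalphaPow_lt hα₁ (τ m) (τ (m + 1)) (d m)
        (ε := (ε / 2) ^ α) (ENNReal.rpow_pos_of_nonneg (ENNReal.half_pos hε.ne') hα0.le)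
      refine ⟨p + q, Submodule.add_mem _ hp hq, ?_⟩
      rw [← lnorm_rpow hα0, ENNReal.rpow_lt_rpow_iff hα0] at h2
      rw [Finset.sum_range_succ, Prod.fst_add, add_sub_add_comm]
      have hm1 : Measurable (∑ j ∈ Finset.range m, stepPair Z (τ j) (τ (j + 1)) (d j)).1 := by
        rw [Prod.fst_sum]
        have h1 := Finset.measurable_sum (f := fun j => (stepPair Z (τ j) (τ (j + 1)) (d j)).1)
          (Finset.range m) fun j _ => measurable_stepPair_fst (τ j) (τ (j + 1)) (d j)
        simpa only [← Finset.sum_apply] using h1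
      refine (hw.lnorm_add_le hα₁.le
        (hm1.aestronglyMeasurable.sub (continuous_of_mem_harmonicSpace hp).aestronglyMeasurable)
        ((measurable_stepPair_fst _ _ _).aestronglyMeasurable.sub
          (continuous_of_mem_harmonicSpace hq).aestronglyMeasurable)).trans_lt ?_
      exact (ENNReal.add_lt_add h1 h2).trans_eq (ENNReal.add_halves ε)
  obtain ⟨x, hx, h1, -⟩ := ((isStochIntegral_iff_lnorm hα0).1 h).2 _ (ENNReal.half_pos hε.ne')
  obtain ⟨p, hp, h2⟩ := key x hx _ (ENNReal.half_pos hε.ne')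
  have hxm := (measurable_fst_of_mem_stepPairs hx).aestronglyMeasurable (μ := muC)
  have h3 := hw.lnorm_add_le hα₁.le (h.1.1.sub hxm)
    (hxm.sub (continuous_of_mem_harmonicSpace hp).aestronglyMeasurable)
  rw [sub_add_sub_cancel] at h3
  exact ⟨p, hp, (h3.trans_lt (ENNReal.add_lt_add h1 h2)).trans_eq (ENNReal.add_halves ε)⟩

end

/-! ### Projections in spaces of stable random variables -/

section

variable {α : ℝ} {P : Measure Ω} {K V W : Submodule ℂ (Ω → ℂ)}

theorem SaSSpace.mono (hW : SaSSpace α P W) (h : V ≤ W) : SaSSpace α P V :=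
  fun n X hX => hW n X fun k => h (hX k)

variable [IsProbabilityMeasure P]

/-- Near-minimizers are close to each other: uniform convexity is applied to $A-X$ and $A-Y$, and
the midpoint of $X$ and $Y$, being in `K`, cannot come closer to $A$ than `I` allows. -/
theorem SaSSpace.exists_stablePow_sub_le (hα₁ : 1 < α) (hW : SaSSpace α P W) (hK : K ≤ W)
    {A : Ω → ℂ} (hA : A ∈ W) {I : ℝ≥0∞} (hI : I ≠ ⊤) (hIle : ∀ X ∈ K, I ≤ stablePow α P (A - X))
    {δ : ℝ} (hδ : 0 < δ) : ∃ κ : ℝ, 0 < κ ∧ ∀ X ∈ K, ∀ Y ∈ K,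
      stablePow α P (A - X) ≤ I + ENNReal.ofReal κ → stablePow α P (A - Y) ≤ I + ENNReal.ofReal κ →
      stablePow α P (X - Y) ≤ ENNReal.ofReal δ := by
  have hα0 : 0 < α := by linarith
  lift I to NNReal using hI
  set i : ℝ := NNReal.toReal I with hi
  have hi0 : 0 ≤ i := I.2
  -- After cancelling $Ci$ the bound reads $2\varepsilon i+(2\varepsilon+C)\kappa$. The choices of
  -- $\varepsilon$ and $\kappa$ make each summand at most $\delta/2$.
  have hε : 0 < δ / (4 * (i + 1)) := by positivity
  set ε := δ / (4 * (i + 1)) with hεd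
  obtain ⟨C, hC, h⟩ := exists_uniform_convexity_stablePow (P := P) hα₁ hε
  have hκ : 0 < δ / (2 * (2 * ε + C)) := by positivity
  set κ := δ / (2 * (2 * ε + C)) with hκd
  refine ⟨κ, hκ, fun X hX Y hY h1 h2 => ?_⟩
  have h3 := h (hW.pair (W.sub_mem hA (hK hY)) (W.sub_mem hA (hK hX)))
  have e1 : A - Y - (A - X) = X - Y := by abel
  have e2 : (1 / 2 : ℂ) • (A - Y + (A - X)) = A - (1 / 2 : ℂ) • (X + Y) := by
    funext ω
    simp
    ring
  rw [e1, e2] at h3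
  have h4 := hIle _ (K.smul_mem (1 / 2) (K.add_mem hX hY))
  have hfin : stablePow α P (X - Y) ≠ ⊤ :=
    ((hW.isSaS (W.sub_mem (hK hX) (hK hY))).stablePow_lt_top hα0).ne
  have hIi : (I : ℝ≥0∞) = ENNReal.ofReal i := by simp [hi]
  have h5 : stablePow α P (X - Y) + ENNReal.ofReal (C * i)
      ≤ ENNReal.ofReal ((ε + C / 2) * (i + κ + (i + κ))) := by
    calc stablePow α P (X - Y) + ENNReal.ofReal (C * i)
        ≤ stablePow α P (X - Y) + ENNReal.ofReal C * stablePow α P (A - (1 / 2 : ℂ) • (X + Y)) := by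
          rw [ENNReal.ofReal_mul hC, ← hIi]
          gcongr
      _ ≤ _ := h3
      _ ≤ ENNReal.ofReal (ε + C / 2) * (ENNReal.ofReal (i + κ) + ENNReal.ofReal (i + κ)) := by
          rw [ENNReal.ofReal_add hi0 hκ.le, ← hIi]
          gcongr
      _ = _ := by
          rw [← ENNReal.ofReal_add (by positivity) (by positivity),
            ← ENNReal.ofReal_mul (by positivity)]
  have h6 := ENNReal.toReal_mono ENNReal.ofReal_ne_top h5
  rw [ENNReal.toReal_add hfin ENNReal.ofReal_ne_top, ENNReal.toReal_ofReal (by positivity),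
    ENNReal.toReal_ofReal (by positivity)] at h6
  rw [← ENNReal.ofReal_toReal hfin]
  refine ENNReal.ofReal_le_ofReal ?_
  have h7 : (2 * ε + C) * κ = δ / 2 := by rw [hκd]; field_simp
  have h8 : ε * i ≤ δ / 4 := by
    rw [hεd, div_mul_eq_mul_div, div_le_div_iff₀ (by positivity) (by norm_num)]
    nlinarith
  nlinarith

/-- Best approximation by a closed subspace. -/
theorem SaSSpace.exists_projection (hα₁ : 1 < α) (hα₂ : α ≤ 2) (hW : SaSSpace α P W) (hK : K ≤ W)
    (hcl : ∀ Y, (∀ ε : ℝ≥0∞, 0 < ε → ∃ X ∈ K, stableNorm α P (Y - X) < ε) → Y ∈ K)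
    {A : Ω → ℂ} (hA : A ∈ W) : ∃ Y ∈ K,
      (∀ X ∈ K, stablePow α P (A - Y) ≤ stablePow α P (A - X)) ∧
      ∀ X ∈ K, stablePow α P (A - X) ≤ stablePow α P (A - Y) → X =ᵐ[P] Y := by
  have hα0 : 0 < α := by linarith
  have hα' : 0 < 1 / α := by positivity
  set I : ℝ≥0∞ := ⨅ X : K, stablePow α P (A - X) with hI
  have hIle : ∀ X ∈ K, I ≤ stablePow α P (A - X) := fun X hX => iInf_le_of_le ⟨X, hX⟩ le_rfl
  have hItop : I ≠ ⊤ :=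
    ((hIle 0 K.zero_mem).trans_lt
      ((hW.isSaS (W.sub_mem hA W.zero_mem)).stablePow_lt_top hα0)).ne
  have hseq : ∀ n : ℕ, ∃ X ∈ K, stablePow α P (A - X) < I + ENNReal.ofReal (1 / (n + 1)) :=
    fun n => by
      have hlt : I < I + ENNReal.ofReal (1 / ((n : ℝ) + 1)) :=
        ENNReal.lt_add_right hItop (by simpa using by positivity)
      obtain ⟨X, hX⟩ := iInf_lt_iff.1 hlt
      exact ⟨X, X.2, hX⟩
  choose X hXK hX using hseq
  have hcau : ∀ ε : ℝ≥0∞, 0 < ε → ∃ N, ∀ m ≥ N, ∀ n ≥ N, stablePow α P (X m - X n) ≤ ε := by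
    intro ε hε
    obtain ⟨δ, hδ, hδε⟩ : ∃ δ : ℝ, 0 < δ ∧ ENNReal.ofReal δ ≤ ε := by
      obtain ⟨r, hr0, hr⟩ := ENNReal.lt_iff_exists_nnreal_btwn.1 hε
      exact ⟨r, by exact_mod_cast hr0, by simpa using hr.le⟩
    obtain ⟨κ, hκ, h⟩ := hW.exists_stablePow_sub_le hα₁ hK hA hItop hIle hδ
    obtain ⟨N, hN⟩ := exists_nat_one_div_lt hκ
    have hle : ∀ n ≥ N, stablePow α P (A - X n) ≤ I + ENNReal.ofReal κ := fun n hn => by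
      refine (hX n).le.trans ?_
      gcongr
      refine le_trans ?_ hN.le
      have : (N : ℝ) ≤ n := by exact_mod_cast hn
      exact one_div_le_one_div_of_le (by positivity) (by linarith)
    exact ⟨N, fun m hm n hn => (h _ (hXK m) _ (hXK n) (hle m hm) (hle n hn)).trans hδε⟩
  obtain ⟨Y, hY⟩ := (hW.mono hK).exists_limit hα0 hα₂ hXK hcau
  have hYlim : Tendsto (fun n => stableNorm α P (Y - X n)) atTop (𝓝 0) := by
    rw [ENNReal.tendsto_atTop_zero]
    intro ε hε
    obtain ⟨N, hN⟩ := hY (ε ^ α) (ENNReal.rpow_pos_of_nonneg hε hα0.le)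
    refine ⟨N, fun n hn => ?_⟩
    rw [(hN n hn).1.stableNorm_eq hα0]
    have := ENNReal.rpow_le_rpow (hN n hn).2 hα'.le
    rwa [← ENNReal.rpow_mul, mul_one_div_cancel hα0.ne', ENNReal.rpow_one] at this
  have hYK : Y ∈ K := hcl Y fun ε hε => by
    obtain ⟨n, hn⟩ := (hYlim.eventually (gt_mem_nhds hε)).exists
    exact ⟨X n, hXK n, hn⟩
  have hYI : stablePow α P (A - Y) ≤ I := by
    rw [← ENNReal.rpow_le_rpow_iff hα',
      ← (hW.isSaS (W.sub_mem hA (hK hYK))).stableNorm_eq hα0]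
    have h1 : Tendsto (fun n : ℕ => (I + ENNReal.ofReal (1 / ((n : ℝ) + 1))) ^ (1 / α)
        + stableNorm α P (Y - X n)) atTop (𝓝 (I ^ (1 / α) + 0)) := by
      refine Tendsto.add ?_ hYlim
      have h2 : Tendsto (fun n : ℕ => I + ENNReal.ofReal (1 / ((n : ℝ) + 1))) atTop
          (𝓝 (I + ENNReal.ofReal 0)) :=
        tendsto_const_nhds.add (ENNReal.tendsto_ofReal tendsto_one_div_add_atTop_nhds_zero_nat)
      rw [ENNReal.ofReal_zero, add_zero] at h2
      exact ((ENNReal.continuous_rpow_const (y := 1 / α)).tendsto I).comp h2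
    rw [add_zero] at h1
    refine ge_of_tendsto' h1 fun n => ?_
    refine (hW.stableNorm_sub_le hα₁.le hA (hK (hXK n)) (hK hYK)).trans ?_
    rw [hW.stableNorm_sub_comm hα0 (hK (hXK n)) (hK hYK),
      (hW.isSaS (W.sub_mem hA (hK (hXK n)))).stableNorm_eq hα0]
    gcongr
    exact (hX n).le
  refine ⟨Y, hYK, fun X hX => hYI.trans (hIle X hX), fun X hXK' hXle => ?_⟩
  have h0 : stablePow α P (X - Y) = 0 := by
    refine nonpos_iff_eq_zero.1 (ENNReal.le_of_forall_pos_le_add fun δ hδ _ => ?_)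
    obtain ⟨κ, hκ, h⟩ := hW.exists_stablePow_sub_le hα₁ hK hA hItop hIle (δ := δ)
      (by exact_mod_cast hδ)
    have := h _ hXK' _ hYK ((hXle.trans hYI).trans le_self_add) (hYI.trans le_self_add)
    simpa using this
  have h1 := (hW.isSaS (W.sub_mem (hK hXK') (hK hYK))).ae_eq_zero hα0 h0
  filter_upwards [h1] with ω hω
  exact sub_eq_zero.1 hω

/-- The characteristic functions of independent linear combinations. -/
theorem cf_add_of_indepFun {ξ η : ℤ → Ω → ℂ}
    (hindep : IndepFun (fun ω (n : ℤ) => ξ n ω) (fun ω (n : ℤ) => η n ω) P) {X Y : Ω → ℂ}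
    (hX : X ∈ Submodule.span ℂ (range ξ)) (hY : Y ∈ Submodule.span ℂ (range η))
    (hXm : AEMeasurable X P) (hYm : AEMeasurable Y P) : cf P (X + Y) = cf P X * cf P Y := by
  -- Every linear combination is a measurable function of the whole sequence, so independence of the
  -- sequences suffices.
  have key : ∀ {ζ : ℤ → Ω → ℂ} {X : Ω → ℂ}, X ∈ Submodule.span ℂ (range ζ) →
      ∃ F : (ℤ → ℂ) → ℂ, Measurable F ∧ X = F ∘ fun ω n => ζ n ω := fun {ζ X} hX => by
    induction hX using Submodule.span_induction with
    | mem X h =>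
      obtain ⟨n, rfl⟩ := h
      exact ⟨fun x => x n, measurable_pi_apply n, rfl⟩
    | zero => exact ⟨0, measurable_const, rfl⟩
    | add X Y _ _ hX hY =>
      obtain ⟨F, hF, rfl⟩ := hX
      obtain ⟨G, hG, rfl⟩ := hY
      exact ⟨F + G, hF.add hG, rfl⟩
    | smul a X _ hX =>
      obtain ⟨F, hF, rfl⟩ := hX
      exact ⟨a • F, hF.const_smul a, rfl⟩
  obtain ⟨F, hF, rfl⟩ := key hX
  obtain ⟨G, hG, rfl⟩ := key hY
  have hc : Continuous fun z : ℂ => Complex.exp (Complex.I * ((z.re : ℝ) : ℂ)) := by fun_prop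
  have h := (hindep.comp hF hG).integral_fun_comp_mul_comp hXm hYm hc.aestronglyMeasurable
    hc.aestronglyMeasurable
  refine Eq.trans ?_ h
  refine integral_congr_ae (Eventually.of_forall fun ω => ?_)
  simp only [Pi.add_apply]
  rw [← Complex.exp_add, ← mul_add, Complex.add_re, Complex.ofReal_add]

end

/-! ### Integrals with respect to a pair of independent processes -/

section

variable {T : ℕ} {α : ℝ} {P : Measure Ω} {Z Z' : ℝ → Ω → Fin T → ℂ}
  {f g : ℝ → Matrix (Fin T) (Fin T) ℂ} {U V : Submodule ℂ (Ω → ℂ)} {u v a : ℝ → Fin T → ℂ}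
  {X Y A : Ω → ℂ}

/-- Two spectral processes whose integrals belong to independent spaces `U` and `V`. -/
structure IndepProcesses (α : ℝ) (P : Measure Ω) (Z Z' : ℝ → Ω → Fin T → ℂ)
    (f g : ℝ → Matrix (Fin T) (Fin T) ℂ) (U V : Submodule ℂ (Ω → ℂ)) : Prop where
  left : IsSpectralProcess α P Z f
  right : IsSpectralProcess α P Z' g
  saS_left : SaSSpace α P U
  saS_right : SaSSpace α P V
  mem_left : ∀ {u Y}, IsStochIntegral α P Z f u Y → Y ∈ U
  mem_right : ∀ {u Y}, IsStochIntegral α P Z' g u Y → Y ∈ V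
  cf_add : ∀ X ∈ U, ∀ Y ∈ V, cf P (X + Y) = cf P X * cf P Y

/-- `X = ∫ uᵀ dZ + ∫ uᵀ dZ'`. -/
def IsPairIntegral (α : ℝ) (P : Measure Ω) (Z Z' : ℝ → Ω → Fin T → ℂ)
    (f g : ℝ → Matrix (Fin T) (Fin T) ℂ) (u : ℝ → Fin T → ℂ) (X : Ω → ℂ) : Prop :=
  ∃ Y Y', IsStochIntegral α P Z f u Y ∧ IsStochIntegral α P Z' g u Y' ∧ X = Y + Y'

theorem IndepProcesses.saSSpace (hα : 0 < α) (h : IndepProcesses α P Z Z' f g U V) :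
    SaSSpace α P (U ⊔ V) := h.saS_left.sup hα h.saS_right h.cf_add

theorem IndepProcesses.add_mem (h : IndepProcesses α P Z Z' f g U V)
    (hX : IsStochIntegral α P Z f u X) (hY : IsStochIntegral α P Z' g v Y) : X + Y ∈ U ⊔ V :=
  Submodule.add_mem_sup (h.mem_left hX) (h.mem_right hY)

theorem IndepProcesses.mem_sup (h : IndepProcesses α P Z Z' f g U V)
    (hX : IsPairIntegral α P Z Z' f g u X) : X ∈ U ⊔ V := by
  obtain ⟨Y, Y', h1, h2, rfl⟩ := hX
  exact h.add_mem h1 h2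

variable [IsProbabilityMeasure P]

theorem IndepProcesses.isPairIntegral_add (hα₁ : 1 < α) (hα₂ : α ≤ 2)
    (h : IndepProcesses α P Z Z' f g U V) (hX : IsPairIntegral α P Z Z' f g u X)
    (hY : IsPairIntegral α P Z Z' f g v Y) : IsPairIntegral α P Z Z' f g (u + v) (X + Y) := by
  obtain ⟨X₁, X₂, h1, h2, rfl⟩ := hX
  obtain ⟨Y₁, Y₂, h3, h4, rfl⟩ := hY
  exact ⟨X₁ + Y₁, X₂ + Y₂,
    (h.left.stochPairs hα₁ hα₂).add_mem (x := (u, X₁)) (y := (v, Y₁)) h1 h3,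
    (h.right.stochPairs hα₁ hα₂).add_mem (x := (u, X₂)) (y := (v, Y₂)) h2 h4, by abel⟩

theorem IndepProcesses.isPairIntegral_smul (hα₁ : 1 < α) (hα₂ : α ≤ 2)
    (h : IndepProcesses α P Z Z' f g U V) (c : ℂ) (hX : IsPairIntegral α P Z Z' f g u X) :
    IsPairIntegral α P Z Z' f g (c • u) (c • X) := by
  obtain ⟨X₁, X₂, h1, h2, rfl⟩ := hX
  exact ⟨c • X₁, c • X₂, (h.left.stochPairs hα₁ hα₂).smul_mem c (x := (u, X₁)) h1,
    (h.right.stochPairs hα₁ hα₂).smul_mem c (x := (u, X₂)) h2, smul_add _ _ _⟩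

theorem IndepProcesses.isPairIntegral_sub (hα₁ : 1 < α) (hα₂ : α ≤ 2)
    (h : IndepProcesses α P Z Z' f g U V) (hX : IsPairIntegral α P Z Z' f g u X)
    (hY : IsPairIntegral α P Z Z' f g v Y) : IsPairIntegral α P Z Z' f g (u - v) (X - Y) := by
  have := h.isPairIntegral_add hα₁ hα₂ hX (h.isPairIntegral_smul hα₁ hα₂ (-1) hY)
  simpa [sub_eq_add_neg] using this

theorem IndepProcesses.stablePow_add (hα₁ : 1 < α) (hα₂ : α ≤ 2)
    (h : IndepProcesses α P Z Z' f g U V) (hX : IsStochIntegral α P Z f u X)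
    (hY : IsStochIntegral α P Z' g v Y) :
    stablePow α P (X + Y) = lalphaPow α f u + lalphaPow α g v := by
  rw [stablePow_add_of_cf_add (by linarith) h.saS_left h.saS_right h.cf_add (h.mem_left hX)
    (h.mem_right hY), h.left.stablePow_eq hα₁ hα₂ hX, h.right.stablePow_eq hα₁ hα₂ hY]

theorem IndepProcesses.isDensity_add (hα₁ : 1 < α) (hα₂ : α ≤ 2)
    (h : IndepProcesses α P Z Z' f g U V) : IsDensity α (f + g) :=
  (h.left.isDensity hα₁ hα₂).add (h.right.isDensity hα₁ hα₂)

theorem IndepProcesses.memLalpha (hα₁ : 1 < α) (hα₂ : α ≤ 2)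
    (h : IndepProcesses α P Z Z' f g U V) (hX : IsPairIntegral α P Z Z' f g u X) :
    MemLalpha α (f + g) u := by
  obtain ⟨Y, Y', h1, h2, rfl⟩ := hX
  refine ⟨h1.1.1, ?_⟩
  rw [(h.left.isDensity hα₁ hα₂).lalphaPow_add_density (by linarith)
    (h.right.isDensity hα₁ hα₂) h1.1.1]
  exact ENNReal.add_lt_top.2 ⟨h1.1.2, h2.1.2⟩

theorem IndepProcesses.stablePow_eq (hα₁ : 1 < α) (hα₂ : α ≤ 2)
    (h : IndepProcesses α P Z Z' f g U V) (hX : IsPairIntegral α P Z Z' f g u X) :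
    stablePow α P X = lalphaPow α (f + g) u := by
  obtain ⟨Y, Y', h1, h2, rfl⟩ := hX
  rw [h.stablePow_add hα₁ hα₂ h1 h2, (h.left.isDensity hα₁ hα₂).lalphaPow_add_density (by linarith)
    (h.right.isDensity hα₁ hα₂) h1.1.1]

theorem IndepProcesses.stableNorm_eq (hα₁ : 1 < α) (hα₂ : α ≤ 2)
    (h : IndepProcesses α P Z Z' f g U V) (hX : IsPairIntegral α P Z Z' f g u X) :
    stableNorm α P X = lnorm α (f + g) u := by
  have hα0 : 0 < α := by linarith
  rw [((h.saSSpace hα0).isSaS (h.mem_sup hX)).stableNorm_eq hα0, h.stablePow_eq hα₁ hα₂ hX, lnorm]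

/-- The distance from an integral with respect to the first process. -/
theorem IndepProcesses.stablePow_sub (hα₁ : 1 < α) (hα₂ : α ≤ 2)
    (h : IndepProcesses α P Z Z' f g U V) (hA : IsStochIntegral α P Z f a A)
    (hX : IsPairIntegral α P Z Z' f g u X) :
    stablePow α P (A - X) = lalphaPow α f (a - u) + lalphaPow α g u := by
  obtain ⟨Y, Y', h1, h2, rfl⟩ := hX
  have e : A - (Y + Y') = (A - Y) + (-1 : ℂ) • Y' := by
    simp only [neg_smul, one_smul]
    abel
  have h3 : IsStochIntegral α P Z f (a - u) (A - Y) :=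
    (h.left.stochPairs hα₁ hα₂).sub_mem (x := (a, A)) (y := (u, Y)) hA h1
  have h4 : IsStochIntegral α P Z' g ((-1 : ℂ) • u) ((-1 : ℂ) • Y') :=
    (h.right.stochPairs hα₁ hα₂).smul_mem _ (x := (u, Y')) h2
  rw [e, h.stablePow_add hα₁ hα₂ h3 h4, lalphaPow_smul (by linarith)]
  simp

/-- The relation between functions and integrals is closed under the minimality condition. -/
theorem IndepProcesses.exists_isPairIntegral_of_tendsto (hα₁ : 1 < α) (hα₂ : α ≤ 2)
    (h : IndepProcesses α P Z Z' f g U V) (hm : Minimality α (f + g)) {p : ℕ → ℝ → Fin T → ℂ}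
    {X : ℕ → Ω → ℂ} (hp : ∀ n, IsPairIntegral α P Z Z' f g (p n) (X n))
    (hY : Tendsto (fun n => stableNorm α P (Y - X n)) atTop (𝓝 0)) :
    ∃ u, IsPairIntegral α P Z Z' f g u Y ∧
      Tendsto (fun n => lnorm α (f + g) (u - p n)) atTop (𝓝 0) := by
  have hα0 : 0 < α := by linarith
  have hα' : 0 < 1 / α := by positivity
  have hf := h.left.isDensity hα₁ hα₂
  have hg := h.right.isDensity hα₁ hα₂
  have hw := h.isDensity_add hα₁ hα₂
  have hS := h.saSSpace hα0
  have hS' := hS.closure_saSSpace hα₁.le hα₂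
  have hcl : ∀ {X}, X ∈ U ⊔ V → X ∈ hS.closure hα₁.le hα₂ := fun hX => hS.le_closure _ _ hX
  have hYm : Y ∈ hS.closure hα₁.le hα₂ := (hS.mem_closure_iff hα₁.le hα₂).2 fun ε hε => by
    obtain ⟨n, hn⟩ := (hY.eventually (gt_mem_nhds hε)).exists
    exact ⟨X n, h.mem_sup (hp n), hn⟩
  -- The isometry turns convergence of $X_n$ into the Cauchy property of the integrands; minimality
  -- then provides their limit.
  have hcau : ∀ ε : ℝ≥0∞, 0 < ε → ∃ N, ∀ m ≥ N, ∀ n ≥ N,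
      lalphaPow α (f + g) (p m - p n) ≤ ε := by
    intro ε hε
    obtain ⟨N, hN⟩ := ENNReal.tendsto_atTop_zero.1 hY (ε ^ (1 / α) / 2)
      (ENNReal.half_pos (ENNReal.rpow_pos_of_nonneg hε hα'.le).ne')
    refine ⟨N, fun m hm n hn => ?_⟩
    rw [← ENNReal.rpow_le_rpow_iff hα']
    have e := h.stableNorm_eq hα₁ hα₂ (h.isPairIntegral_sub hα₁ hα₂ (hp m) (hp n))
    rw [lnorm] at e
    rw [← e]
    refine (hS'.stableNorm_sub_le hα₁.le (hcl (h.mem_sup (hp m))) hYm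
      (hcl (h.mem_sup (hp n)))).trans ?_
    rw [hS'.stableNorm_sub_comm hα0 (hcl (h.mem_sup (hp m))) hYm]
    exact (add_le_add (hN m hm) (hN n hn)).trans_eq (ENNReal.add_halves _)
  obtain ⟨u, hu, hlim⟩ := hm.exists_limit hα₁ hα₂ hw (fun n => h.memLalpha hα₁ hα₂ (hp n)) hcau
  choose Y₁ Y₂ h1 h2 h12 using hp
  -- Only the sums $Y_1+Y_2$ are known to converge. The second summands are Cauchy on their own
  -- because the $L^\alpha(g)$ power is dominated by that of $L^\alpha(f+g)$; subtracting their
  -- limit from $Y$ gives the first component.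
  have hcau2 : ∀ ε : ℝ≥0∞, 0 < ε → ∃ N, ∀ m ≥ N, ∀ n ≥ N, stablePow α P (Y₂ m - Y₂ n) ≤ ε := by
    intro ε hε
    obtain ⟨N, hN⟩ := hcau ε hε
    refine ⟨N, fun m hm n hn => le_trans ?_ (hN m hm n hn)⟩
    have h3 : IsStochIntegral α P Z' g (p m - p n) (Y₂ m - Y₂ n) :=
      (h.right.stochPairs hα₁ hα₂).sub_mem (x := (p m, Y₂ m)) (y := (p n, Y₂ n)) (h2 m) (h2 n)
    rw [h.right.stablePow_eq hα₁ hα₂ h3,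
      hf.lalphaPow_add_density hα0 hg ((h1 m).1.1.sub (h1 n).1.1)]
    exact le_add_self
  obtain ⟨Y', hY'⟩ := h.saS_right.exists_limit hα0 hα₂ (fun n => h.mem_right (h2 n)) hcau2
  have hrpow : Tendsto (fun n => lnorm α (f + g) (u - p n)) atTop (𝓝 0) := by
    rw [ENNReal.tendsto_atTop_zero]
    intro ε hε
    obtain ⟨N, hN⟩ := hlim (ε ^ α) (ENNReal.rpow_pos_of_nonneg hε hα0.le)
    refine ⟨N, fun n hn => ?_⟩
    rw [← ENNReal.rpow_le_rpow_iff hα0, lnorm_rpow hα0]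
    exact hN n hn
  have hY'lim : Tendsto (fun n => stableNorm α P (Y' - Y₂ n)) atTop (𝓝 0) := by
    rw [ENNReal.tendsto_atTop_zero]
    intro ε hε
    obtain ⟨N, hN⟩ := hY' (ε ^ α) (ENNReal.rpow_pos_of_nonneg hε hα0.le)
    refine ⟨N, fun n hn => ?_⟩
    rw [← ENNReal.rpow_le_rpow_iff hα0, ← (hN n hn).1.stablePow_eq_rpow hα0]
    exact (hN n hn).2
  have hY'm : Y' ∈ hS.closure hα₁.le hα₂ := (hS.mem_closure_iff hα₁.le hα₂).2 fun ε hε => by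
    obtain ⟨n, hn⟩ := (hY'lim.eventually (gt_mem_nhds hε)).exists
    exact ⟨Y₂ n, Submodule.mem_sup_right (h.mem_right (h2 n)), hn⟩
  obtain ⟨huf, hug⟩ := hf.memLalpha_left hα0 hg hu
  have hle : ∀ n, lnorm α f (u - p n) ≤ lnorm α (f + g) (u - p n) ∧
      lnorm α g (u - p n) ≤ lnorm α (f + g) (u - p n) := fun n => by
    have e := hf.lalphaPow_add_density hα0 hg (hu.1.sub (h1 n).1.1)
    refine ⟨ENNReal.rpow_le_rpow ?_ hα'.le, ENNReal.rpow_le_rpow ?_ hα'.le⟩ <;> rw [e]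
    · exact le_self_add
    · exact le_add_self
  refine ⟨u, ⟨Y - Y', Y', ?_, ?_, (sub_add_cancel _ _).symm⟩, hrpow⟩
  · refine h.left.isStochIntegral_of_forall hα₁ hα₂ huf fun ε hε => ?_
    have h3 := hY.add hY'lim
    rw [add_zero] at h3
    obtain ⟨n, hn1, hn2⟩ := ((hrpow.eventually (gt_mem_nhds hε)).and
      (h3.eventually (gt_mem_nhds hε))).exists
    refine ⟨p n, Y₁ n, h1 n, (hle n).1.trans_lt hn1, lt_of_le_of_lt ?_ hn2⟩
    have e : Y - Y' - Y₁ n = (Y - X n) + (Y₂ n - Y') := by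
      rw [h12 n]; abel
    have hY2n : Y₂ n ∈ hS.closure hα₁.le hα₂ := hcl (Submodule.mem_sup_right (h.mem_right (h2 n)))
    have hXn : X n ∈ hS.closure hα₁.le hα₂ := by
      rw [h12 n]; exact hcl (h.add_mem (h1 n) (h2 n))
    rw [e, hS'.stableNorm_sub_comm hα0 hY'm hY2n]
    exact hS'.stableNorm_add_le hα₁.le (Submodule.sub_mem _ hYm hXn)
      (Submodule.sub_mem _ hY2n hY'm)
  · refine h.right.isStochIntegral_of_forall hα₁ hα₂ hug fun ε hε => ?_
    obtain ⟨n, hn1, hn2⟩ := ((hrpow.eventually (gt_mem_nhds hε)).and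
      (hY'lim.eventually (gt_mem_nhds hε))).exists
    exact ⟨p n, Y₂ n, h2 n, (hle n).2.trans_lt hn1, hn2⟩

theorem IsSpectralProcess.isStochIntegral_of_mem_stepPairs (hα₁ : 1 < α) (hα₂ : α ≤ 2)
    (hZ : IsSpectralProcess α P Z f) {x : (ℝ → Fin T → ℂ) × (Ω → ℂ)} (hx : x ∈ stepPairs Z) :
    IsStochIntegral α P Z f x.1 x.2 := by
  have hα0 : 0 < α := by linarith
  refine isStochIntegral_iff.2 ⟨⟨(measurable_fst_of_mem_stepPairs hx).aestronglyMeasurable, ?_⟩,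
    fun ε hε => ⟨x, hx, ?_, ?_⟩⟩
  · rw [← hZ.stablePow_eq_of_mem_stepPairs hα₁ hα₂ hx]
    exact ((hZ.stable.processSpan_saSSpace hα0).isSaS (snd_mem_processSpan hx)).stablePow_lt_top hα0
  · rwa [sub_self, lalphaPow_zero hα0]
  · have := hZ.stableNorm_eq_of_mem_stepPairs hα₁ hα₂ (Submodule.zero_mem (stepPairs Z))
    simp only [Prod.snd_zero, Prod.fst_zero, lnorm_zero hα0] at this
    rwa [sub_self, this]

/-- The sum of the integrals is the integral with respect to the sum of the processes. -/
theorem IndepProcesses.isStochIntegral_add (hα₁ : 1 < α) (hα₂ : α ≤ 2)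
    (h : IndepProcesses α P Z Z' f g U V) (hX : IsPairIntegral α P Z Z' f g u X)
    (hu : ∀ ε : ℝ≥0∞, 0 < ε → ∃ p, Continuous p ∧ lnorm α (f + g) (u - p) < ε) :
    IsStochIntegral α P (Z + Z') (f + g) u X := by
  have hα0 : 0 < α := by linarith
  have hw := h.isDensity_add hα₁ hα₂
  have hum := h.memLalpha hα₁ hα₂ hX
  refine (isStochIntegral_iff_lnorm hα0).2 ⟨hum, fun ε hε => ?_⟩
  -- The two integrals may come with different approximating step functions. Passing through a
  -- continuous function yields a single step function that is close in $L^\alpha(f+g)$ and serves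
  -- both processes.
  obtain ⟨p, hp, h1⟩ := hu _ (ENNReal.half_pos hε.ne')
  obtain ⟨n, s, t, c, hst, h2⟩ := hw.exists_stepFun_lalphaPow_lt hα₁ hp
    (ENNReal.rpow_pos_of_nonneg (ENNReal.half_pos hε.ne') hα0.le)
  rw [← lnorm_rpow hα0, ENNReal.rpow_lt_rpow_iff hα0] at h2
  have hlt : lnorm α (f + g) (u - stepFun s t c) < ε := by
    have h3 := hw.lnorm_add_le hα₁.le (hum.1.sub hp.aestronglyMeasurable)
      (hp.aestronglyMeasurable.sub (measurable_stepFun s t c).aestronglyMeasurable)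
    rw [sub_add_sub_cancel] at h3
    exact (h3.trans_lt (ENNReal.add_lt_add h1 h2)).trans_eq (ENNReal.add_halves ε)
  refine ⟨(stepFun s t c, stepIntegral (Z + Z') s t c), ⟨n, s, t, c, hst, rfl⟩, hlt, ?_⟩
  have e : stepIntegral (Z + Z') s t c = stepIntegral Z s t c + stepIntegral Z' s t c := by
    funext ω
    simp only [stepIntegral, Pi.add_apply]
    rw [← Finset.sum_add_distrib]
    refine Finset.sum_congr rfl fun i _ => ?_
    rw [← dotProduct_add]
    congr 1
    abel
  have hstep : IsPairIntegral α P Z Z' f g (stepFun s t c) (stepIntegral (Z + Z') s t c) :=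
    ⟨_, _, h.left.isStochIntegral_of_mem_stepPairs hα₁ hα₂ ⟨n, s, t, c, hst, rfl⟩,
      h.right.isStochIntegral_of_mem_stepPairs hα₁ hα₂ ⟨n, s, t, c, hst, rfl⟩, e⟩
  change stableNorm α P (X - stepIntegral (Z + Z') s t c) < ε
  rwa [h.stableNorm_eq hα₁ hα₂ (h.isPairIntegral_sub hα₁ hα₂ hX hstep)]

end

/-! ### Periodically harmonizable sequences -/

section

variable {T N : ℕ} {α : ℝ} {P : Measure Ω} {ξ η : ℤ → Ω → ℂ} {Zξ Zη : ℝ → Ω → Fin T → ℂ}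
  {f g : ℝ → Matrix (Fin T) (Fin T) ℂ}

theorem IsPeriodicallyHarmonizableWith.isSpectralProcess
    (hξ : IsPeriodicallyHarmonizableWith α P T ξ Zξ f) : IsSpectralProcess α P Zξ f :=
  ⟨hξ.stable, hξ.indep, hξ.density⟩

theorem IsPeriodicallyHarmonizableWith.isStochIntegral
    (hξ : IsPeriodicallyHarmonizableWith α P T ξ Zξ f) (n : ℤ) (k : Fin T) :
    IsStochIntegral α P Zξ f (harmonic n k) (ξ (n * (T : ℤ) + ((k : ℕ) : ℤ))) := hξ.repr n k

theorem exists_eq_mul_add (hT : 1 ≤ T) (j : ℤ) :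
    ∃ (n : ℤ) (k : Fin T), j = n * (T : ℤ) + ((k : ℕ) : ℤ) := by
  have hT' : (0 : ℤ) < T := by exact_mod_cast hT
  have h0 := Int.emod_nonneg j hT'.ne'
  have h1 := Int.emod_lt_of_pos j hT'
  refine ⟨j / T, ⟨(j % T).toNat, by omega⟩, ?_⟩
  rw [Int.toNat_of_nonneg h0]
  exact (Int.ediv_mul_add_emod j T).symm

/-- The unobserved window consists of the whole blocks $0,\dots,N$, so missing times correspond
exactly to missing frequencies. -/
theorem mul_add_mem_Ico_iff (n : ℤ) (k : Fin T) :
    n * (T : ℤ) + ((k : ℕ) : ℤ) ∈ Ico (0 : ℤ) ((T : ℤ) * ((N : ℤ) + 1)) ↔ n ∈ Icc (0 : ℤ) N := by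
  have hk : ((k : ℕ) : ℤ) < T := by exact_mod_cast k.2
  have hk0 : (0 : ℤ) ≤ ((k : ℕ) : ℤ) := by positivity
  have hT : (0 : ℤ) < T := by linarith
  rw [mem_Ico, mem_Icc]
  constructor
  · rintro ⟨h1, h2⟩
    constructor
    · by_contra h
      have : n + 1 ≤ 0 := by omega
      nlinarith
    · by_contra h
      have : (N : ℤ) + 1 ≤ n := by omega
      nlinarith
  · rintro ⟨h1, h2⟩
    exact ⟨by positivity, by nlinarith⟩

variable [IsProbabilityMeasure P]

theorem IsPeriodicallyHarmonizableWith.exists_mem_span (hα₁ : 1 < α) (hα₂ : α ≤ 2)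
    (hξ : IsPeriodicallyHarmonizableWith α P T ξ Zξ f) {p : ℝ → Fin T → ℂ}
    (hp : p ∈ harmonicSpace T univ) :
    ∃ Y ∈ Submodule.span ℂ (range ξ), IsStochIntegral α P Zξ f p Y := by
  induction hp using Submodule.span_induction with
  | mem p h =>
    obtain ⟨n, k, -, rfl⟩ := h
    exact ⟨_, Submodule.subset_span (mem_range_self _), hξ.isStochIntegral n k⟩
  | zero =>
    exact ⟨0, Submodule.zero_mem _, (hξ.isSpectralProcess.stochPairs hα₁ hα₂).zero_mem⟩
  | add x y _ _ hx hy =>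
    obtain ⟨X, hX, h1⟩ := hx
    obtain ⟨Y, hY, h2⟩ := hy
    exact ⟨X + Y, Submodule.add_mem _ hX hY,
      (hξ.isSpectralProcess.stochPairs hα₁ hα₂).add_mem (x := (x, X)) (y := (y, Y)) h1 h2⟩
  | smul a x _ hx =>
    obtain ⟨X, hX, h1⟩ := hx
    exact ⟨a • X, Submodule.smul_mem _ a hX,
      (hξ.isSpectralProcess.stochPairs hα₁ hα₂).smul_mem a (x := (x, X)) h1⟩

theorem IsPeriodicallyHarmonizableWith.saSSpace (hα₁ : 1 < α) (hα₂ : α ≤ 2) (hT : 1 ≤ T)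
    (hξ : IsPeriodicallyHarmonizableWith α P T ξ Zξ f) :
    SaSSpace α P (Submodule.span ℂ (range ξ)) := by
  refine (hξ.isSpectralProcess.space_saSSpace hα₁ hα₂).mono (Submodule.span_le.2 ?_)
  rintro _ ⟨j, rfl⟩
  obtain ⟨n, k, rfl⟩ := exists_eq_mul_add hT j
  exact hξ.isSpectralProcess.mem_space hα₁ hα₂ (hξ.isStochIntegral n k)

/-- Density of trigonometric polynomials shows that the process contributes nothing outside the
closed span of the sequence. This is how independence of $\xi$ and $\eta$ reaches their spectral
processes. -/
theorem IsPeriodicallyHarmonizableWith.mem_closure (hα₁ : 1 < α) (hα₂ : α ≤ 2) (hT : 1 ≤ T)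
    (hξ : IsPeriodicallyHarmonizableWith α P T ξ Zξ f) {u : ℝ → Fin T → ℂ} {Y : Ω → ℂ}
    (hY : IsStochIntegral α P Zξ f u Y) : Y ∈ (hξ.saSSpace hα₁ hα₂ hT).closure hα₁.le hα₂ := by
  refine (SaSSpace.mem_closure_iff hα₁.le hα₂ _).2 fun ε hε => ?_
  obtain ⟨p, hp, h1⟩ := hξ.isSpectralProcess.exists_harmonicSpace_lnorm_lt hα₁ hα₂ hY hε
  obtain ⟨X, hX, h2⟩ := hξ.exists_mem_span hα₁ hα₂ hp
  have h3 : IsStochIntegral α P Zξ f (u - p) (Y - X) :=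
    (hξ.isSpectralProcess.stochPairs hα₁ hα₂).sub_mem (x := (u, Y)) (y := (p, X)) hY h2
  refine ⟨X, hX, ?_⟩
  rwa [hξ.isSpectralProcess.stableNorm_eq hα₁ hα₂ h3]

/-- The spectral processes of independent sequences are independent. -/
theorem IsPeriodicallyHarmonizableWith.indepProcesses (hα₁ : 1 < α) (hα₂ : α ≤ 2) (hT : 1 ≤ T)
    (hξ : IsPeriodicallyHarmonizableWith α P T ξ Zξ f)
    (hη : IsPeriodicallyHarmonizableWith α P T η Zη g)
    (hindep : IndepFun (fun ω (n : ℤ) => ξ n ω) (fun ω (n : ℤ) => η n ω) P) :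
    IndepProcesses α P Zξ Zη f g ((hξ.saSSpace hα₁ hα₂ hT).closure hα₁.le hα₂)
      ((hη.saSSpace hα₁ hα₂ hT).closure hα₁.le hα₂) where
  left := hξ.isSpectralProcess
  right := hη.isSpectralProcess
  saS_left := SaSSpace.closure_saSSpace _ _ _
  saS_right := SaSSpace.closure_saSSpace _ _ _
  mem_left := hξ.mem_closure hα₁ hα₂ hT
  mem_right := hη.mem_closure hα₁ hα₂ hT
  cf_add := by
    have hα0 : 0 < α := by linarith
    have hSξ := hξ.saSSpace hα₁ hα₂ hT
    have hSη := hη.saSSpace hα₁ hα₂ hT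
    -- The factorization is extended to the closures one argument at a time.
    have h1 : ∀ Y ∈ Submodule.span ℂ (range η), ∀ X ∈ hSξ.closure hα₁.le hα₂,
        cf P (X + Y) = cf P X * cf P Y := fun Y hY X hX =>
      cf_add_of_mem_closedManifold hα0 (hSη.isSaS hY).aemeasurable
        (fun X hX => (hSξ.isSaS hX).aemeasurable)
        (fun X hX => cf_add_of_indepFun hindep hX hY (hSξ.isSaS hX).aemeasurable
          (hSη.isSaS hY).aemeasurable) hX
    intro X hX Y hY
    rw [add_comm X Y, mul_comm]
    refine cf_add_of_mem_closedManifold hα0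
      ((hSξ.closure_saSSpace hα₁.le hα₂).isSaS hX).aemeasurable
      (fun X hX => (hSη.isSaS hX).aemeasurable) (fun Y hY => ?_) hY
    rw [add_comm Y X, mul_comm]
    exact h1 Y hY X hX

/-- The linear span of the observations. -/
def observedSpan (T N : ℕ) (ξ η : ℤ → Ω → ℂ) : Submodule ℂ (Ω → ℂ) :=
  Submodule.span ℂ {X | ∃ j : ℤ, j ∉ Ico (0 : ℤ) ((T : ℤ) * ((N : ℤ) + 1)) ∧ X = ξ j + η j}

theorem mem_observed_iff {Y : Ω → ℂ} : Y ∈ observed α P T N ξ η ↔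
    ∀ ε : ℝ≥0∞, 0 < ε → ∃ X ∈ observedSpan T N ξ η, stableNorm α P (Y - X) < ε := Iff.rfl

theorem IsPeriodicallyHarmonizableWith.isPairIntegral
    (hξ : IsPeriodicallyHarmonizableWith α P T ξ Zξ f)
    (hη : IsPeriodicallyHarmonizableWith α P T η Zη g) (n : ℤ) (k : Fin T) :
    IsPairIntegral α P Zξ Zη f g (harmonic n k)
      (ξ (n * (T : ℤ) + ((k : ℕ) : ℤ)) + η (n * (T : ℤ) + ((k : ℕ) : ℤ))) :=
  ⟨_, _, hξ.isStochIntegral n k, hη.isStochIntegral n k, rfl⟩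

theorem isPairIntegral_zero (hα₁ : 1 < α) (hα₂ : α ≤ 2) (hξ : IsSpectralProcess α P Zξ f)
    (hη : IsSpectralProcess α P Zη g) : IsPairIntegral α P Zξ Zη f g 0 0 :=
  ⟨0, 0, (hξ.stochPairs hα₁ hα₂).zero_mem, (hη.stochPairs hα₁ hα₂).zero_mem, (add_zero 0).symm⟩

/-- Used to produce admissible variations of the estimate from trigonometric polynomials; the
converse below represents observations by such polynomials. -/
theorem exists_observedSpan_isPairIntegral (hα₁ : 1 < α) (hα₂ : α ≤ 2) (hT : 1 ≤ T)
    (hξ : IsPeriodicallyHarmonizableWith α P T ξ Zξ f)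
    (hη : IsPeriodicallyHarmonizableWith α P T η Zη g)
    (hindep : IndepFun (fun ω (n : ℤ) => ξ n ω) (fun ω (n : ℤ) => η n ω) P) {p : ℝ → Fin T → ℂ}
    (hp : p ∈ harmonicSpace T (Icc (0 : ℤ) N)ᶜ) :
    ∃ X ∈ observedSpan T N ξ η, IsPairIntegral α P Zξ Zη f g p X := by
  have h := hξ.indepProcesses hα₁ hα₂ hT hη hindep
  induction hp using Submodule.span_induction with
  | mem p hp =>
    obtain ⟨n, k, hn, rfl⟩ := hp
    refine ⟨_, Submodule.subset_span ⟨n * (T : ℤ) + ((k : ℕ) : ℤ), ?_, rfl⟩,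
      hξ.isPairIntegral hη n k⟩
    rw [mul_add_mem_Ico_iff]
    exact hn
  | zero =>
    exact ⟨0, Submodule.zero_mem _, isPairIntegral_zero hα₁ hα₂ h.left h.right⟩
  | add x y _ _ hx hy =>
    obtain ⟨X, hX, h1⟩ := hx
    obtain ⟨Y, hY, h2⟩ := hy
    exact ⟨X + Y, Submodule.add_mem _ hX hY, h.isPairIntegral_add hα₁ hα₂ h1 h2⟩
  | smul a x _ hx =>
    obtain ⟨X, hX, h1⟩ := hx
    exact ⟨a • X, Submodule.smul_mem _ a hX, h.isPairIntegral_smul hα₁ hα₂ a h1⟩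

theorem exists_harmonicSpace_isPairIntegral (hα₁ : 1 < α) (hα₂ : α ≤ 2) (hT : 1 ≤ T)
    (hξ : IsPeriodicallyHarmonizableWith α P T ξ Zξ f)
    (hη : IsPeriodicallyHarmonizableWith α P T η Zη g)
    (hindep : IndepFun (fun ω (n : ℤ) => ξ n ω) (fun ω (n : ℤ) => η n ω) P) {X : Ω → ℂ}
    (hX : X ∈ observedSpan T N ξ η) :
    ∃ p ∈ harmonicSpace T (Icc (0 : ℤ) N)ᶜ, IsPairIntegral α P Zξ Zη f g p X := by
  have h := hξ.indepProcesses hα₁ hα₂ hT hη hindep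
  induction hX using Submodule.span_induction with
  | mem X hX =>
    obtain ⟨j, hj, rfl⟩ := hX
    obtain ⟨n, k, rfl⟩ := exists_eq_mul_add hT j
    rw [mul_add_mem_Ico_iff] at hj
    exact ⟨_, Submodule.subset_span ⟨n, k, hj, rfl⟩, hξ.isPairIntegral hη n k⟩
  | zero =>
    exact ⟨0, Submodule.zero_mem _, isPairIntegral_zero hα₁ hα₂ h.left h.right⟩
  | add x y _ _ hx hy =>
    obtain ⟨X, hX, h1⟩ := hx
    obtain ⟨Y, hY, h2⟩ := hy
    exact ⟨X + Y, Submodule.add_mem _ hX hY, h.isPairIntegral_add hα₁ hα₂ h1 h2⟩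
  | smul a x _ hx =>
    obtain ⟨X, hX, h1⟩ := hx
    exact ⟨a • X, Submodule.smul_mem _ a hX, h.isPairIntegral_smul hα₁ hα₂ a h1⟩

theorem IsPeriodicallyHarmonizableWith.isStochIntegral_functional (hα₁ : 1 < α) (hα₂ : α ≤ 2)
    (hξ : IsPeriodicallyHarmonizableWith α P T ξ Zξ f) (a : Fin (N + 1) → Fin T → ℂ) :
    IsStochIntegral α P Zξ f (polyA a) (functional a ξ) := by
  have e : (polyA a, functional a ξ) = ∑ j : Fin (N + 1), ∑ k : Fin T,
      a j k • (harmonic (T := T) (((j : ℕ) : ℤ)) k,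
        ξ (((j : ℕ) : ℤ) * (T : ℤ) + ((k : ℕ) : ℤ))) := by
    refine Prod.ext ?_ ?_
    · simp only [Prod.fst_sum, Prod.smul_mk]
      funext θ l
      simp only [polyA, harmonic, Finset.sum_apply, Pi.smul_apply, smul_eq_mul]
      refine Finset.sum_congr rfl fun j _ => ?_
      rw [Finset.sum_eq_single l (fun k _ hk => by simp [hk.symm]) (by simp)]
      simp [mul_comm]
    · simp only [Prod.snd_sum, Prod.smul_mk]
      funext ω
      simp [functional, Finset.sum_apply]
  change (polyA a, functional a ξ) ∈ hξ.isSpectralProcess.stochPairs hα₁ hα₂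
  rw [e]
  exact Submodule.sum_mem _ fun j _ => Submodule.sum_mem _ fun k _ =>
    Submodule.smul_mem _ _ (hξ.isStochIntegral _ k)

end

/-! ### The equation for the spectral characteristic -/

theorem integral_exp_int (n : ℤ) :
    ∫ θ in Ioc (-Real.pi) Real.pi, Complex.exp (Complex.I * n * (θ : ℂ))
      = if n = 0 then 2 * (Real.pi : ℂ) else 0 := by
  have hle : -Real.pi ≤ Real.pi := by linarith [Real.pi_pos]
  split_ifs with h
  · subst h
    simp only [Int.cast_zero, mul_zero, zero_mul, Complex.exp_zero]
    rw [← intervalIntegral.integral_of_le hle, intervalIntegral.integral_const,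
      Complex.real_smul]
    push_cast
    ring
  · rw [← intervalIntegral.integral_of_le hle, integral_exp_mul_complex (by simpa using h),
      div_eq_zero_iff, sub_eq_zero]
    left
    rw [Complex.exp_eq_exp_iff_exists_int]
    refine ⟨n, ?_⟩
    push_cast
    ring

theorem norm_exp_I_mul_int (n : ℤ) (θ : ℝ) : ‖Complex.exp (Complex.I * n * (θ : ℂ))‖ = 1 := by
  rw [show Complex.I * n * (θ : ℂ) = ((n * θ : ℝ) : ℂ) * Complex.I by push_cast; ring,
    Complex.norm_exp_ofReal_mul_I]

theorem exp_neg_eq (k : ℕ) (θ : ℝ) : Complex.exp (-(Complex.I * (k : ℂ) * (θ : ℂ)))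
    = Complex.exp (Complex.I * ((-(k : ℤ) : ℤ) : ℂ) * (θ : ℂ)) := by
  congr 1
  push_cast
  ring

section

variable {T N : ℕ} {α : ℝ} {w f g : ℝ → Matrix (Fin T) (Fin T) ℂ} {u v h : ℝ → Fin T → ℂ}

/-- The Fourier coefficients of the polynomial `C_N`. -/
theorem integral_exp_mul_polyC (c : Fin (N + 1) → Fin T → ℂ) (n : ℤ) (k : Fin T) :
    ∫ θ in Ioc (-Real.pi) Real.pi, Complex.exp (Complex.I * n * (θ : ℂ)) * polyC c θ k
      = ∑ j : Fin (N + 1), if n = ((j : ℕ) : ℤ) then 2 * (Real.pi : ℂ) * c j k else 0 := by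
  have e : ∀ θ : ℝ, Complex.exp (Complex.I * n * (θ : ℂ)) * polyC c θ k
      = ∑ j : Fin (N + 1), Complex.exp (Complex.I * ((n - ((j : ℕ) : ℤ) : ℤ) : ℂ) * (θ : ℂ))
        * c j k := fun θ => by
    simp only [polyC, Finset.sum_apply, Pi.smul_apply, smul_eq_mul, Finset.mul_sum, ← mul_assoc,
      ← Complex.exp_add]
    refine Finset.sum_congr rfl fun j _ => ?_
    congr 2
    push_cast
    ring
  simp only [e]
  rw [integral_finsetSum]
  · refine Finset.sum_congr rfl fun j _ => ?_
    rw [integral_mul_const, integral_exp_int]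
    simp only [sub_eq_zero]
    split_ifs <;> simp
  · intro j _
    exact (Continuous.integrableOn_Icc (by fun_prop)).mono_set Ioc_subset_Icc_self

theorem continuous_polyC (c : Fin (N + 1) → Fin T → ℂ) : Continuous (polyC c) := by
  unfold polyC
  fun_prop

theorem polyC_sub (c c' : Fin (N + 1) → Fin T → ℂ) (θ : ℝ) :
    polyC (c - c') θ = polyC c θ - polyC c' θ := by
  simp [polyC, smul_sub, Finset.sum_sub_distrib]

/-- An integrable function with frequencies in `{0, …, N}` is a polynomial. -/
theorem exists_eq_polyC {D : ℝ → Fin T → ℂ} (hD : ∀ k, Integrable (fun θ => D θ k) muC)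
    (h : ∀ n : ℤ, n ∉ Icc (0 : ℤ) N → ∀ k,
      ∫ θ in Ioc (-Real.pi) Real.pi, Complex.exp (Complex.I * n * (θ : ℂ)) * D θ k = 0) :
    ∃ c : Fin (N + 1) → Fin T → ℂ, ∀ᵐ θ ∂muC, D θ = polyC c θ := by
  have hpi : (2 * (Real.pi : ℂ)) ≠ 0 := by
    simp
  -- The coefficient of $e^{-ij\theta}$ is found by integrating against $e^{+ij\theta}$, which is
  -- why the hypothesis has $e^{in\theta}$ with a positive sign.
  let c : Fin (N + 1) → Fin T → ℂ := fun j k => (2 * (Real.pi : ℂ))⁻¹ *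
    ∫ θ in Ioc (-Real.pi) Real.pi, Complex.exp (Complex.I * (((j : ℕ) : ℤ) : ℂ) * (θ : ℂ)) * D θ k
  refine ⟨c, ?_⟩
  have hk : ∀ k, (fun θ => D θ k - polyC c θ k) =ᵐ[muC] 0 := fun k => by
    have hC : Integrable (fun θ => polyC c θ k) muC :=
      (Continuous.integrableOn_Icc ((continuous_apply k).comp (continuous_polyC c))).mono_set
        Ioc_subset_Icc_self
    have hbdd : ∀ (n : ℤ) {φ : ℝ → ℂ}, Integrable φ muC →
        Integrable (fun θ : ℝ => Complex.exp (Complex.I * n * (θ : ℂ)) * φ θ) muC := fun n φ hφ =>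
      hφ.bdd_mul (c := 1) (by fun_prop)
        (Eventually.of_forall fun θ => (norm_exp_I_mul_int n θ).le)
    refine ae_eq_zero_of_fourier ((hD k).sub hC) fun n => ?_
    simp only [mul_sub]
    rw [integral_sub (hbdd n (hD k)) (hbdd n hC), integral_exp_mul_polyC, sub_eq_zero]
    by_cases hn : n ∈ Icc (0 : ℤ) N
    · obtain ⟨m, rfl⟩ := Int.eq_ofNat_of_zero_le hn.1
      have hm : m < N + 1 := by
        have : (m : ℤ) ≤ N := hn.2
        omega
      rw [Finset.sum_eq_single (⟨m, hm⟩ : Fin (N + 1))]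
      · simp only [if_true, c]
        rw [mul_inv_cancel_left₀ hpi]
      · intro j _ hj
        rw [if_neg]
        intro h'
        exact hj (Fin.ext (by simpa using (Int.natCast_inj.1 h').symm))
      · simp
    · rw [h n hn k]
      refine (Finset.sum_eq_zero fun j _ => if_neg ?_).symm
      rintro rfl
      exact hn ⟨by positivity, by have := j.2; exact_mod_cast Nat.lt_succ_iff.1 this⟩
  filter_upwards [ae_all_iff.2 hk] with θ hθ
  funext k
  exact sub_eq_zero.1 (hθ k)

theorem polyC_injective {c c' : Fin (N + 1) → Fin T → ℂ}
    (h : ∀ᵐ θ ∂muC, polyC c θ = polyC c' θ) : c = c' := by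
  have hpi : (2 * (Real.pi : ℂ)) ≠ 0 := by
    simp
  funext j k
  have e : ∀ c : Fin (N + 1) → Fin T → ℂ, ∫ θ in Ioc (-Real.pi) Real.pi,
      Complex.exp (Complex.I * (((j : ℕ) : ℤ) : ℂ) * (θ : ℂ)) * polyC c θ k
        = 2 * (Real.pi : ℂ) * c j k := fun c => by
    rw [integral_exp_mul_polyC, Finset.sum_eq_single j]
    · simp
    · intro i _ hi
      rw [if_neg]
      intro h'
      exact hi (Fin.ext (Int.natCast_inj.1 h').symm)
    · simp
  have h1 := e c
  rw [integral_congr_ae (g := fun θ : ℝ =>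
    Complex.exp (Complex.I * (((j : ℕ) : ℤ) : ℂ) * (θ : ℂ)) * polyC c' θ k), e c'] at h1
  · exact (mul_left_cancel₀ hpi h1).symm
  · filter_upwards [h] with θ hθ
    rw [hθ]

/-! ### First variation of the error. -/

/-- The first order expansion of the norm of `L^α(w)`. -/
theorem IsDensity.toReal_lalphaPow_add_le (hα₁ : 1 < α) (hα₂ : α ≤ 2) (hw : IsDensity α w)
    (hu : MemLalpha α w u) (hv : MemLalpha α w v) :
    (lalphaPow α w (u + v)).toReal ≤ (lalphaPow α w u).toReal
      + α * (∫ θ in Ioc (-Real.pi) Real.pi, pform α (w θ) (v θ) (u θ)).re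
      + 6 * (lalphaPow α w v).toReal := by
  have huv := hw.memLalpha_add hα₁.le hu hv
  have hi := hv.integrable_pform hα₁ hw hu
  have hre : Integrable (fun θ => (pform α (w θ) (v θ) (u θ)).re) muC := hi.re
  have hsum : Integrable (fun θ => ‖alphaForm α w u θ‖ + α * (pform α (w θ) (v θ) (u θ)).re) muC :=
    (hu.integrable_alphaForm hw).norm.add (hre.const_mul α)
  have e : (∫ θ in Ioc (-Real.pi) Real.pi, pform α (w θ) (v θ) (u θ)).re
      = ∫ θ in Ioc (-Real.pi) Real.pi, (pform α (w θ) (v θ) (u θ)).re := (integral_re hi).symm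
  rw [hw.toReal_lalphaPow huv.1, hw.toReal_lalphaPow hu.1, hw.toReal_lalphaPow hv.1, e,
    ← integral_const_mul, ← integral_const_mul,
    ← integral_add (hu.integrable_alphaForm hw).norm (hre.const_mul α),
    ← integral_add hsum ((hv.integrable_alphaForm hw).norm.const_mul 6)]
  refine integral_mono_ae (huv.integrable_alphaForm hw).norm
    (hsum.add ((hv.integrable_alphaForm hw).norm.const_mul 6)) ?_
  filter_upwards [hw.stable] with θ hθ
  exact hθ.norm_pform_add_le hα₁ hα₂ (u θ) (v θ)

/-- The Euler-Lagrange equation. -/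
theorem integral_pform_eq_of_minimal (hα₁ : 1 < α) (hα₂ : α ≤ 2) (hf : IsDensity α f)
    (hg : IsDensity α g) {A p : ℝ → Fin T → ℂ} (hA : MemLalpha α f A)
    (hh : MemLalpha α (f + g) h) (hp : MemLalpha α (f + g) p)
    (hmin : ∀ z : ℂ, lalphaPow α f (A - h) + lalphaPow α g h
      ≤ lalphaPow α f (A - (h + z • p)) + lalphaPow α g (h + z • p)) :
    ∫ θ in Ioc (-Real.pi) Real.pi, pform α (f θ) (p θ) (A θ - h θ)
      = ∫ θ in Ioc (-Real.pi) Real.pi, pform α (g θ) (p θ) (h θ) := by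
  have hα0 : 0 < α := by linarith
  obtain ⟨hhf, hhg⟩ := hf.memLalpha_left hα0 hg hh
  obtain ⟨hpf, hpg⟩ := hf.memLalpha_left hα0 hg hp
  have hAh := hf.memLalpha_sub hα₁.le hA hhf
  set E₁ := ∫ θ in Ioc (-Real.pi) Real.pi, pform α (f θ) (p θ) (A θ - h θ) with hE₁
  set E₂ := ∫ θ in Ioc (-Real.pi) Real.pi, pform α (g θ) (p θ) (h θ) with hE₂
  set K := (lalphaPow α f p).toReal + (lalphaPow α g p).toReal with hK
  -- Minimality bounds the error at $h+zp$ from below, the first order expansion bounds it from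
  -- above; the zeroth order terms cancel.
  have key : ∀ z : ℂ, α * (z * (E₁ - E₂)).re ≤ 6 * (‖z‖ ^ α * K) := fun z => by
    have hzf := memLalpha_smul hα0 z hpf
    have hzf' := memLalpha_smul hα0 (-z) hpf
    have hzg := memLalpha_smul hα0 z hpg
    have e : A - (h + z • p) = (A - h) + (-z) • p := by
      rw [neg_smul]; abel
    have h1 := hmin z
    rw [e] at h1
    have hfin1 := (hf.memLalpha_add hα₁.le hAh hzf').2.ne
    have hfin2 := (hg.memLalpha_add hα₁.le hhg hzg).2.ne
    have h2 := ENNReal.toReal_mono (ENNReal.add_ne_top.2 ⟨hfin1, hfin2⟩) h1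
    rw [ENNReal.toReal_add hAh.2.ne hhg.2.ne, ENNReal.toReal_add hfin1 hfin2] at h2
    have h3 := hf.toReal_lalphaPow_add_le hα₁ hα₂ hAh hzf'
    have h4 := hg.toReal_lalphaPow_add_le hα₁ hα₂ hhg hzg
    have hn : (‖z‖ₑ ^ α).toReal = ‖z‖ ^ α := by
      rw [← ENNReal.toReal_rpow, toReal_enorm]
    have e1 : ∫ θ in Ioc (-Real.pi) Real.pi, pform α (f θ) (((-z) • p) θ) ((A - h) θ)
        = -(z * E₁) := by
      rw [hE₁, ← neg_mul, ← integral_const_mul]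
      simp only [Pi.smul_apply, pform_smul_left, Pi.sub_apply]
    have e2 : ∫ θ in Ioc (-Real.pi) Real.pi, pform α (g θ) ((z • p) θ) (h θ) = z * E₂ := by
      rw [hE₂, ← integral_const_mul]
      simp only [Pi.smul_apply, pform_smul_left]
    rw [e1, lalphaPow_smul hα0, enorm_neg, ENNReal.toReal_mul, hn, Complex.neg_re] at h3
    rw [e2, lalphaPow_smul hα0, ENNReal.toReal_mul, hn] at h4
    rw [mul_sub, Complex.sub_re, hK]
    nlinarith
  set E := E₁ - E₂ with hE
  have hlim : Tendsto (fun t : ℝ => 6 * (t ^ (α - 1) * (‖E‖ ^ α * K))) (𝓝[>] 0) (𝓝 0) := by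
    have h1 : ContinuousAt (fun t : ℝ => 6 * (t ^ (α - 1) * (‖E‖ ^ α * K))) 0 :=
      continuousAt_const.mul ((Real.continuousAt_rpow_const _ _ (Or.inr (by linarith))).mul
        continuousAt_const)
    have h2 := h1.tendsto
    rw [Real.zero_rpow (by linarith : α - 1 ≠ 0), zero_mul, mul_zero] at h2
    exact h2.mono_left nhdsWithin_le_nhds
  have hle : α * ‖E‖ ^ 2 ≤ 0 := by
    refine ge_of_tendsto hlim ?_
    -- The choice $z=t\bar E$ makes the left side $\alpha t|E|^2$, while the right side is of order
    -- $t^\alpha$. Since $\alpha>1$, division by $t$ and $t\to0$ give $E=0$.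
    filter_upwards [self_mem_nhdsWithin] with t (ht : 0 < t)
    have h1 := key ((t : ℂ) * conj E)
    have e1 : ((t : ℂ) * conj E * E).re = t * ‖E‖ ^ 2 := by
      rw [mul_assoc, Complex.re_ofReal_mul, ← Complex.normSq_eq_conj_mul_self, Complex.ofReal_re,
        Complex.normSq_eq_norm_sq]
    have e2 : ‖(t : ℂ) * conj E‖ ^ α = t * (t ^ (α - 1) * ‖E‖ ^ α) := by
      rw [norm_mul, Complex.norm_real, Real.norm_of_nonneg ht.le, RCLike.norm_conj,
        Real.mul_rpow ht.le (norm_nonneg _), ← mul_assoc]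
      congr 1
      nth_rewrite 2 [← Real.rpow_one t]
      rw [← Real.rpow_add ht]
      congr 1
      ring
    rw [e1, e2] at h1
    refine le_of_mul_le_mul_left ?_ ht
    nlinarith
  have h0 : ‖E‖ ^ 2 = 0 := by
    have : 0 ≤ ‖E‖ ^ 2 := by positivity
    nlinarith
  rw [← sub_eq_zero, ← hE]
  simpa using h0

/-- The equation that characterizes the minimizing function. -/
theorem exists_polyC_of_minimal (hα₁ : 1 < α) (hα₂ : α ≤ 2) (hf : IsDensity α f)
    (hg : IsDensity α g) {A : ℝ → Fin T → ℂ} (hA : MemLalpha α f A)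
    (hh : MemLalpha α (f + g) h)
    (hmin : ∀ p ∈ harmonicSpace T (Icc (0 : ℤ) N)ᶜ, lalphaPow α f (A - h) + lalphaPow α g h
      ≤ lalphaPow α f (A - (h + p)) + lalphaPow α g (h + p)) :
    ∃ c : Fin (N + 1) → Fin T → ℂ, ∀ᵐ θ ∂muC,
      f θ *ᵥ vecSignedPow (α - 1) (A θ - h θ) - g θ *ᵥ vecSignedPow (α - 1) (h θ) = polyC c θ := by
  have hα0 : 0 < α := by linarith
  obtain ⟨hhf, hhg⟩ := hf.memLalpha_left hα0 hg hh
  have hAh := hf.memLalpha_sub hα₁.le hA hhf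
  have hpf : ∀ (n : ℤ) (k : Fin T), Integrable
      (fun θ => pform α (f θ) (harmonic n k θ) (A θ - h θ)) muC := fun n k =>
    (hf.memLalpha_of_continuous hα₁ (continuous_harmonic n k)).integrable_pform hα₁ hf hAh
  have hpg : ∀ (n : ℤ) (k : Fin T), Integrable
      (fun θ => pform α (g θ) (harmonic n k θ) (h θ)) muC := fun n k =>
    (hg.memLalpha_of_continuous hα₁ (continuous_harmonic n k)).integrable_pform hα₁ hg hhg
  have e : ∀ (W : Matrix (Fin T) (Fin T) ℂ) (n : ℤ) (k : Fin T) (θ : ℝ) (b : Fin T → ℂ),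
      pform α W (harmonic n k θ) b
        = Complex.exp (Complex.I * n * (θ : ℂ)) * (W *ᵥ vecSignedPow (α - 1) b) k :=
    fun W n k θ b => by
      rw [pform, harmonic, smul_dotProduct, single_dotProduct, one_mul, smul_eq_mul]
  have e' : ∀ (n : ℤ) (k : Fin T) (θ : ℝ), Complex.exp (Complex.I * n * (θ : ℂ)) *
      (f θ *ᵥ vecSignedPow (α - 1) (A θ - h θ) - g θ *ᵥ vecSignedPow (α - 1) (h θ)) k
        = pform α (f θ) (harmonic n k θ) (A θ - h θ) - pform α (g θ) (harmonic n k θ) (h θ) :=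
    fun n k θ => by rw [e, e, Pi.sub_apply, mul_sub]
  refine exists_eq_polyC (fun k => ?_) fun n hn k => ?_
  -- At frequency $0$ the exponential is $1$, so the integrand is the component itself and its
  -- integrability follows.
  · have h1 := (hpf 0 k).sub (hpg 0 k)
    refine h1.congr (Eventually.of_forall fun θ => ?_)
    have := e' 0 k θ
    simp only [Int.cast_zero, mul_zero, zero_mul, Complex.exp_zero, one_mul] at this
    exact this.symm
  · simp only [e']
    rw [integral_sub (hpf n k) (hpg n k), sub_eq_zero]
    refine integral_pform_eq_of_minimal hα₁ hα₂ hf hg hA hh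
      ((hf.add hg).memLalpha_of_continuous hα₁ (continuous_harmonic n k)) fun z => hmin _ ?_
    exact Submodule.smul_mem _ z (Submodule.subset_span ⟨n, k, hn, rfl⟩)

/-! ### Vanishing Fourier coefficients and uniqueness. -/

theorem integrable_exp_smul (k : Fin (N + 1)) {p : ℝ → Fin T → ℂ} (hp : Integrable p muC) :
    Integrable (fun θ : ℝ => Complex.exp (-(Complex.I * ((k : ℕ) : ℂ) * θ)) • p θ) muC :=
  Integrable.bdd_smul (φ := fun θ : ℝ => Complex.exp (-(Complex.I * ((k : ℕ) : ℂ) * θ))) hp 1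
    (by fun_prop : Continuous fun θ : ℝ =>
      Complex.exp (-(Complex.I * ((k : ℕ) : ℂ) * θ))).aestronglyMeasurable
    (Eventually.of_forall fun θ => by rw [exp_neg_eq, norm_exp_I_mul_int])

theorem integral_exp_smul_eq_zero_of_mem {p : ℝ → Fin T → ℂ}
    (hp : p ∈ harmonicSpace T (Icc (0 : ℤ) N)ᶜ) (k : Fin (N + 1)) :
    ∫ θ in Ioc (-Real.pi) Real.pi, Complex.exp (-(Complex.I * ((k : ℕ) : ℂ) * θ)) • p θ = 0 := by
  have hint : ∀ {p : ℝ → Fin T → ℂ}, Continuous p → Integrable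
      (fun θ : ℝ => Complex.exp (-(Complex.I * ((k : ℕ) : ℂ) * θ)) • p θ) muC := fun hp =>
    (Continuous.integrableOn_Icc (by fun_prop)).mono_set Ioc_subset_Icc_self
  induction hp using Submodule.span_induction with
  | mem p h =>
    obtain ⟨n, l, hn, rfl⟩ := h
    have e : ∀ θ : ℝ, Complex.exp (-(Complex.I * ((k : ℕ) : ℂ) * θ)) • harmonic n l θ
        = Complex.exp (Complex.I * ((n - ((k : ℕ) : ℤ) : ℤ) : ℂ) * (θ : ℂ))
          • (Pi.single l 1 : Fin T → ℂ) := fun θ => by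
      rw [harmonic, smul_smul, ← Complex.exp_add]
      congr 2
      push_cast
      ring
    simp only [e]
    rw [integral_smul_const, integral_exp_int, if_neg, zero_smul]
    intro h0
    refine hn ?_
    rw [sub_eq_zero.1 h0]
    exact ⟨by positivity, by have := k.2; exact_mod_cast Nat.lt_succ_iff.1 this⟩
  | zero => simp
  | add x y hx hy h1 h2 =>
    simp only [Pi.add_apply, smul_add]
    rw [integral_add (hint (continuous_of_mem_harmonicSpace hx))
      (hint (continuous_of_mem_harmonicSpace hy)), h1, h2, add_zero]
  | smul a x hx h1 =>
    simp only [Pi.smul_apply, smul_comm _ a]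
    rw [integral_smul, h1, smul_zero]

/-- Fourier coefficients are continuous on $L^\alpha(w)$ through the embedding in $L^1$, and they
vanish on the approximating polynomials by orthogonality. -/
theorem integral_exp_smul_eq_zero (hα₁ : 1 < α) (hα₂ : α ≤ 2) (hw : IsDensity α w)
    (hm : Minimality α w) (hu : MemLalpha α w u)
    (happ : ∀ ε : ℝ≥0∞, 0 < ε → ∃ p ∈ harmonicSpace T (Icc (0 : ℤ) N)ᶜ, lnorm α w (u - p) < ε)
    (k : Fin (N + 1)) :
    ∫ θ in Ioc (-Real.pi) Real.pi, Complex.exp (-(Complex.I * ((k : ℕ) : ℂ) * θ)) • u θ = 0 := by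
  obtain ⟨C, hC, hCu⟩ := hm.exists_lintegral_le hα₁ hα₂ hw
  have hint : ∀ {p : ℝ → Fin T → ℂ}, Integrable p muC → Integrable
      (fun θ : ℝ => Complex.exp (-(Complex.I * ((k : ℕ) : ℂ) * θ)) • p θ) muC := fun hp =>
    integrable_exp_smul k hp
  have hle : ∀ ε : ℝ≥0∞, 0 < ε →
      ‖∫ θ in Ioc (-Real.pi) Real.pi, Complex.exp (-(Complex.I * ((k : ℕ) : ℂ) * θ)) • u θ‖ₑ
        ≤ C * ε := fun ε hε => by
    obtain ⟨p, hp, h1⟩ := happ ε hε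
    have hpc := continuous_of_mem_harmonicSpace hp
    have hpi : Integrable p muC := hpc.integrableOn_Icc.mono_set Ioc_subset_Icc_self
    have e : ∫ θ in Ioc (-Real.pi) Real.pi, Complex.exp (-(Complex.I * ((k : ℕ) : ℂ) * θ)) • u θ
        = ∫ θ in Ioc (-Real.pi) Real.pi,
          Complex.exp (-(Complex.I * ((k : ℕ) : ℂ) * θ)) • (u - p) θ := by
      simp only [Pi.sub_apply, smul_sub]
      rw [integral_sub (hint (hu.integrable hα₁ hα₂ hw hm)) (hint hpi),
        integral_exp_smul_eq_zero_of_mem hp, sub_zero]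
    rw [e]
    refine (enorm_integral_le_lintegral_enorm _).trans ?_
    have e2 : ∀ θ : ℝ, ‖Complex.exp (-(Complex.I * ((k : ℕ) : ℂ) * θ)) • (u - p) θ‖ₑ
        = ‖(u - p) θ‖ₑ := fun θ => by
      rw [enorm_smul, exp_neg_eq, ← ofReal_norm, norm_exp_I_mul_int, ENNReal.ofReal_one, one_mul]
    simp only [e2]
    refine (hCu _ (hu.1.sub hpc.aestronglyMeasurable)).trans ?_
    gcongr
  have hlim : Tendsto (fun ε : ℝ≥0∞ => C * ε) (𝓝[>] 0) (𝓝 0) := by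
    have := ENNReal.Tendsto.const_mul (tendsto_id (x := 𝓝 (0 : ℝ≥0∞))) (Or.inr hC)
    rw [mul_zero] at this
    exact this.mono_left nhdsWithin_le_nhds
  have h0 : ‖∫ θ in Ioc (-Real.pi) Real.pi,
      Complex.exp (-(Complex.I * ((k : ℕ) : ℂ) * θ)) • u θ‖ₑ ≤ 0 := by
    refine ge_of_tendsto hlim ?_
    filter_upwards [self_mem_nhdsWithin] with ε hε using hle ε hε
  exact enorm_eq_zero.1 (nonpos_iff_eq_zero.1 h0)

/-- The solution of the system is unique. -/
theorem IsSolution.unique (hα₁ : 1 < α) (hα₂ : α ≤ 2) (hf : IsDensity α f) (hg : IsDensity α g)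
    (hm : Minimality α (f + g)) {a : Fin (N + 1) → Fin T → ℂ} {h' : ℝ → Fin T → ℂ}
    {c c' : Fin (N + 1) → Fin T → ℂ} (hs : IsSolution α f g a h c)
    (hs' : IsSolution α f g a h' c') : h' =ᵐ[muC] h ∧ c' = c := by
  have hα0 : 0 < α := by linarith
  have hw := hf.add hg
  have hd := hw.memLalpha_sub hα₁.le hs'.memL hs.memL
  have hdi : Integrable (h' - h) muC := hs'.integrable.sub hs.integrable
  have hexp : ∀ (j : Fin (N + 1)) {p : ℝ → Fin T → ℂ}, Integrable p muC → Integrable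
      (fun θ : ℝ => Complex.exp (-(Complex.I * ((j : ℕ) : ℂ) * θ)) • p θ) muC := fun j p hp =>
    integrable_exp_smul j hp
  have hzero : ∀ j k, ∫ θ in Ioc (-Real.pi) Real.pi,
      (Complex.exp (-(Complex.I * ((j : Fin (N + 1)) : ℕ) * (θ : ℂ))) • (h' - h) θ) k = 0 :=
    fun j k => by
      have h1 : ∫ θ in Ioc (-Real.pi) Real.pi,
          Complex.exp (-(Complex.I * ((j : ℕ) : ℂ) * θ)) • (h' - h) θ = 0 := by
        simp only [Pi.sub_apply, smul_sub]
        rw [integral_sub (hexp j hs'.integrable) (hexp j hs.integrable), hs'.system, hs.system,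
          sub_zero]
      have h2 := congrFun h1 k
      rwa [eval_integral fun i => (hexp j hdi).eval i] at h2
  have hterm : ∀ j k, Integrable (fun θ : ℝ => (c - c') j k *
      (Complex.exp (-(Complex.I * ((j : Fin (N + 1)) : ℕ) * (θ : ℂ))) • (h' - h) θ) k) muC :=
    fun j k => ((hexp j hdi).eval k).const_mul _
  have hsum : ∀ θ : ℝ, (h' - h) θ ⬝ᵥ polyC (c - c') θ = ∑ j, ∑ k, (c - c') j k *
      (Complex.exp (-(Complex.I * ((j : Fin (N + 1)) : ℕ) * (θ : ℂ))) • (h' - h) θ) k := fun θ => by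
    simp only [polyC, dotProduct_sum, dotProduct_smul]
    refine Finset.sum_congr rfl fun j _ => ?_
    rw [dotProduct, Finset.smul_sum]
    refine Finset.sum_congr rfl fun k _ => ?_
    simp only [Pi.smul_apply, smul_eq_mul]
    ring
  have hint : Integrable (fun θ => (h' - h) θ ⬝ᵥ polyC (c - c') θ) muC := by
    simp only [hsum]
    exact integrable_finsetSum _ fun j _ => integrable_finsetSum _ fun k _ => hterm j k
  -- The frequencies $-j$ of $C_N-C_N'$ are exactly those tested by the system, where both solutions
  -- have zero coefficients.
  have hI : ∫ θ in Ioc (-Real.pi) Real.pi, (h' - h) θ ⬝ᵥ polyC (c - c') θ = 0 := by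
    simp only [hsum]
    rw [integral_finsetSum _ fun j _ => integrable_finsetSum _ fun k _ => hterm j k]
    refine Finset.sum_eq_zero fun j _ => ?_
    rw [integral_finsetSum _ fun k _ => hterm j k]
    refine Finset.sum_eq_zero fun k _ => ?_
    rw [integral_const_mul, hzero, mul_zero]
  have hpt : ∀ᵐ θ ∂muC, 0 ≤ ((h' - h) θ ⬝ᵥ polyC (c - c') θ).re ∧
      (((h' - h) θ ⬝ᵥ polyC (c - c') θ).re = 0 → alphaForm α (f + g) (h' - h) θ = 0) := by
    filter_upwards [hf.stable, hg.stable, hs.equation, hs'.equation] with θ h1 h2 h3 h4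
    -- Subtracting the equations and writing $h'-h=(A_N-h)-(A_N-h')$ for the part with $f$ yields
    -- one monotonicity expression for $f$ and one for $g$, both with nonnegative real part.
    have e : (h' - h) θ ⬝ᵥ polyC (c - c') θ
        = (pform α (f θ) ((polyA a θ - h θ) - (polyA a θ - h' θ)) (polyA a θ - h θ)
          - pform α (f θ) ((polyA a θ - h θ) - (polyA a θ - h' θ)) (polyA a θ - h' θ))
          + (pform α (g θ) (h' θ - h θ) (h' θ) - pform α (g θ) (h' θ - h θ) (h θ)) := by
      rw [polyC_sub, ← h3, ← h4, sub_sub_sub_cancel_left]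
      simp only [pform, Pi.sub_apply, dotProduct_sub]
      ring
    have hf' := h1.re_pform_sub hα₁ (polyA a θ - h θ) (polyA a θ - h' θ)
    have hg' := h2.re_pform_sub hα₁ (h' θ) (h θ)
    rw [e, Complex.add_re]
    refine ⟨add_nonneg hf'.1 hg'.1, fun h0 => ?_⟩
    have h5 := hf'.2 (by linarith [hf'.1, hg'.1])
    have h6 := hg'.2 (by linarith [hf'.1, hg'.1])
    rw [sub_sub_sub_cancel_left] at h5
    rw [alphaForm_add_matrix, alphaForm_eq_pform, alphaForm_eq_pform, Pi.sub_apply, h5, h6,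
      add_zero]
  have hre : ∫ θ in Ioc (-Real.pi) Real.pi, ((h' - h) θ ⬝ᵥ polyC (c - c') θ).re = 0 := by
    have := integral_re hint
    rw [hI] at this
    simpa using this
  have hae := (integral_eq_zero_iff_of_nonneg_ae (hpt.mono fun θ h => h.1) hint.re).1 hre
  have hform : ∀ᵐ θ ∂muC, alphaForm α (f + g) (h' - h) θ = 0 := by
    filter_upwards [hpt, hae] with θ h1 h2 using h1.2 h2
  have hpow : lalphaPow α (f + g) (h' - h) = 0 := by
    rw [lalphaPow, lintegral_congr_ae (g := fun _ => 0), lintegral_zero]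
    filter_upwards [hform] with θ hθ
    rw [hθ, enorm_zero]
  have heq : h' =ᵐ[muC] h := by
    filter_upwards [hm.ae_eq_zero hα₁ hα₂ hw hd.1 hpow] with θ hθ
    exact sub_eq_zero.1 hθ
  refine ⟨heq, polyC_injective ?_⟩
  filter_upwards [heq, hs.equation, hs'.equation] with θ h1 h2 h3
  rw [← h2, ← h3, h1]

end

/-! ### The optimal estimate -/

section

variable {α : ℝ} {P : Measure Ω} {V : Submodule ℂ (Ω → ℂ)} {Y : Ω → ℂ}

/-- The closure is closed. A priori $Y$ is not known to be jointly stable with `V`; placing it in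
the closure of the closure makes the triangle inequality available. -/
theorem SaSSpace.mem_closure_of_forall [IsProbabilityMeasure P] (hα₁ : 1 ≤ α) (hα₂ : α ≤ 2)
    (hV : SaSSpace α P V)
    (h : ∀ ε : ℝ≥0∞, 0 < ε → ∃ X ∈ hV.closure hα₁ hα₂, stableNorm α P (Y - X) < ε) :
    Y ∈ hV.closure hα₁ hα₂ := by
  have hV' := hV.closure_saSSpace hα₁ hα₂
  have hY : Y ∈ hV'.closure hα₁ hα₂ := (hV'.mem_closure_iff hα₁ hα₂).2 h
  have hV'' := hV'.closure_saSSpace hα₁ hα₂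
  refine (hV.mem_closure_iff hα₁ hα₂).2 fun ε hε => ?_
  obtain ⟨X, hX, h1⟩ := h _ (ENNReal.half_pos hε.ne')
  obtain ⟨X', hX', h2⟩ := (hV.mem_closure_iff hα₁ hα₂).1 hX _ (ENNReal.half_pos hε.ne')
  refine ⟨X', hX', ?_⟩
  have hXm := hV'.le_closure hα₁ hα₂ hX
  have hXm' := hV'.le_closure hα₁ hα₂ (hV.le_closure hα₁ hα₂ hX')
  calc stableNorm α P (Y - X') = stableNorm α P ((Y - X) + (X - X')) := by
        rw [sub_add_sub_cancel]
    _ ≤ stableNorm α P (Y - X) + stableNorm α P (X - X') :=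
        hV''.stableNorm_add_le hα₁ (Submodule.sub_mem _ hY hXm) (Submodule.sub_mem _ hXm hXm')
    _ < ε / 2 + ε / 2 := ENNReal.add_lt_add h1 h2
    _ = ε := ENNReal.add_halves ε

theorem SaSSpace.closure_le_closure [IsProbabilityMeasure P] (hα₁ : 1 ≤ α) (hα₂ : α ≤ 2)
    {U : Submodule ℂ (Ω → ℂ)} (hU : SaSSpace α P U) (hV : SaSSpace α P V) (h : U ≤ V) :
    hU.closure hα₁ hα₂ ≤ hV.closure hα₁ hα₂ := fun Y hY =>
  (hV.mem_closure_iff hα₁ hα₂).2 fun ε hε => by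
    obtain ⟨X, hX, h1⟩ := (hU.mem_closure_iff hα₁ hα₂).1 hY ε hε
    exact ⟨X, h hX, h1⟩

end

section

variable {T N : ℕ} {α : ℝ} {P : Measure Ω} {ξ η : ℤ → Ω → ℂ} {Zξ Zη : ℝ → Ω → Fin T → ℂ}
  {f g : ℝ → Matrix (Fin T) (Fin T) ℂ}

theorem alphaForm_fin_one (hα : 0 < α) (w : ℝ → Matrix (Fin 1) (Fin 1) ℂ) (u : ℝ → Fin 1 → ℂ)
    (θ : ℝ) (k : Fin 1) : alphaForm α w u θ = ((‖u θ k‖ ^ α : ℝ) : ℂ) * w θ k k := by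
  obtain rfl : k = 0 := Subsingleton.elim _ _
  rw [← mul_signedPow_self hα]
  simp only [alphaForm, dotProduct, Matrix.mulVec, vecSignedPow, Fin.sum_univ_one]
  ring

/-- The optimal estimate is an integral of a function that satisfies the equation and the system
for the spectral characteristic. -/
theorem exists_optimal_estimate [IsProbabilityMeasure P] (hα₁ : 1 < α) (hα₂ : α ≤ 2) (hT : 1 ≤ T)
    (hξ : IsPeriodicallyHarmonizableWith α P T ξ Zξ f)
    (hη : IsPeriodicallyHarmonizableWith α P T η Zη g)
    (hindep : IndepFun (fun ω (n : ℤ) => ξ n ω) (fun ω (n : ℤ) => η n ω) P)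
    (hmin : Minimality α (f + g)) (a : Fin (N + 1) → Fin T → ℂ) :
    ∃ Y, IsOptimalEstimate α P (functional a ξ) (observed α P T N ξ η) Y ∧
      (∀ X, IsOptimalEstimate α P (functional a ξ) (observed α P T N ξ η) X → X =ᵐ[P] Y) ∧
      stableNorm α P (functional a ξ - Y) = stablePow α P (functional a ξ - Y) ^ (1 / α) ∧
      ∃ h c, IsSolution α f g a h c ∧ IsPairIntegral α P Zξ Zη f g h Y ∧
        ∀ ε : ℝ≥0∞, 0 < ε →
          ∃ p ∈ harmonicSpace T (Icc (0 : ℤ) N)ᶜ, lnorm α (f + g) (h - p) < ε := by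
  have hα0 : 0 < α := by linarith
  have hα' : 0 < 1 / α := by positivity
  have hI := hξ.indepProcesses hα₁ hα₂ hT hη hindep
  have hf := hI.left.isDensity hα₁ hα₂
  have hg := hI.right.isDensity hα₁ hα₂
  have hw := hf.add hg
  have hS := hI.saSSpace hα0
  have hle : observedSpan T N ξ η ≤ _ := fun X hX => by
    obtain ⟨p, -, hp⟩ := exists_harmonicSpace_isPairIntegral hα₁ hα₂ hT hξ hη hindep hX
    exact hI.mem_sup hp
  have hO := hS.mono hle
  have hA := hξ.isStochIntegral_functional hα₁ hα₂ a
  have hAS := hS.le_closure hα₁.le hα₂ (Submodule.mem_sup_left (hI.mem_left hA))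
  have hWS := hS.closure_saSSpace hα₁.le hα₂
  have hKW := hO.closure_le_closure hα₁.le hα₂ hS hle
  -- The projection takes place in the closure of the sum of the two independent spaces, which
  -- contains both the functional and the observations.
  obtain ⟨Y, hY, hYmin, hYu⟩ := hWS.exists_projection hα₁ hα₂ hKW
    (fun Y hY => hO.mem_closure_of_forall hα₁.le hα₂ hY) hAS
  have hmem : ∀ X, X ∈ observed α P T N ξ η ↔ X ∈ hO.closure hα₁.le hα₂ := fun X =>
    mem_observed_iff.trans (hO.mem_closure_iff hα₁.le hα₂).symm
  have hnorm : ∀ X ∈ hO.closure hα₁.le hα₂, stableNorm α P (functional a ξ - X)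
      = stablePow α P (functional a ξ - X) ^ (1 / α) := fun X hX =>
    (hWS.isSaS (Submodule.sub_mem _ hAS (hKW hX))).stableNorm_eq hα0
  refine ⟨Y, ⟨(hmem Y).2 hY, fun X hX => ?_⟩, fun X hX => ?_, hnorm Y hY, ?_⟩
  · have hX' := (hmem X).1 hX
    rw [hnorm Y hY, hnorm X hX']
    exact ENNReal.rpow_le_rpow (hYmin X hX') hα'.le
  · have hX' := (hmem X).1 hX.1
    have h1 := hX.2 Y ((hmem Y).2 hY)
    rw [hnorm Y hY, hnorm X hX', ENNReal.rpow_le_rpow_iff hα'] at h1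
    exact hYu X hX' h1
  -- Finite combinations of observations approximating $Y$ are integrals of polynomials without the
  -- frequencies $0,\dots,N$. Their integrands converge to `h`, so $Y$ is the integral of `h`, and
  -- `h` lies in the closed subspace.
  have happ : ∀ n : ℕ, ∃ X ∈ observedSpan T N ξ η,
      stableNorm α P (Y - X) < ((n : ℝ≥0∞) + 1)⁻¹ := fun n =>
    (hO.mem_closure_iff hα₁.le hα₂).1 hY _ (by simp)
  choose X hX hYX using happ
  choose p hp hpX using fun n => exists_harmonicSpace_isPairIntegral hα₁ hα₂ hT hξ hη hindep (hX n)
  have hlim : Tendsto (fun n => stableNorm α P (Y - X n)) atTop (𝓝 0) := by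
    have h0 : Tendsto (fun n : ℕ => ((n : ℝ≥0∞) + 1)⁻¹) atTop (𝓝 0) := by
      have := (tendsto_add_atTop_iff_nat 1).2 ENNReal.tendsto_inv_nat_nhds_zero
      simpa using this
    exact tendsto_of_tendsto_of_tendsto_of_le_of_le tendsto_const_nhds h0 (fun _ => zero_le)
      fun n => (hYX n).le
  obtain ⟨h, hh, hhp⟩ := hI.exists_isPairIntegral_of_tendsto hα₁ hα₂ hmin hpX hlim
  have hclose : ∀ ε : ℝ≥0∞, 0 < ε →
      ∃ p ∈ harmonicSpace T (Icc (0 : ℤ) N)ᶜ, lnorm α (f + g) (h - p) < ε := fun ε hε => by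
    obtain ⟨n, hn⟩ := (hhp.eventually (gt_mem_nhds hε)).exists
    exact ⟨p n, hp n, hn⟩
  have hhm := hI.memLalpha hα₁ hα₂ hh
  -- Adding to $Y$ the integral of `p` stays within the observed manifold, so optimality of $Y$ is
  -- minimality of the functional of integrands at `h`.
  obtain ⟨c, hc⟩ := exists_polyC_of_minimal (N := N) hα₁ hα₂ hf hg hA.1 hhm fun p hp => by
    obtain ⟨X, hX, hpX⟩ := exists_observedSpan_isPairIntegral hα₁ hα₂ hT hξ hη hindep hp
    have h1 := hYmin (Y + X) (Submodule.add_mem _ hY (hO.le_closure hα₁.le hα₂ hX))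
    rwa [hI.stablePow_sub hα₁ hα₂ hA hh,
      hI.stablePow_sub hα₁ hα₂ hA (hI.isPairIntegral_add hα₁ hα₂ hh hpX)] at h1
  exact ⟨h, c, ⟨hhm, hc, hhm.integrable hα₁ hα₂ hw hmin,
    integral_exp_smul_eq_zero hα₁ hα₂ hw hmin hhm hclose⟩, hh, hclose⟩

end

end StableInterp

end

theorem mainTheorem3 {Ω : Type*} [MeasurableSpace Ω] (P : Measure Ω) [IsProbabilityMeasure P]
    (α : ℝ) (hα₁ : 1 < α) (hα₂ : α ≤ 2) (T : ℕ) (hT : 1 ≤ T) (N : ℕ)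
    (ξ η : ℤ → Ω → ℂ) (Zξ Zη : ℝ → Ω → Fin T → ℂ) (f g : ℝ → Matrix (Fin T) (Fin T) ℂ)
    (hξ : StableInterp.IsPeriodicallyHarmonizableWith α P T ξ Zξ f)
    (hη : StableInterp.IsPeriodicallyHarmonizableWith α P T η Zη g)
    (hindep : IndepFun (fun ω (n : ℤ) => ξ n ω) (fun ω (n : ℤ) => η n ω) P)
    (hmin : StableInterp.Minimality α (f + g))
    (a : Fin (N + 1) → Fin T → ℂ) :
    ∃ Ahat : Ω → ℂ,
      -- the optimal estimate exists and is almost surely unique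
      StableInterp.IsOptimalEstimate α P (StableInterp.functional a ξ)
        (StableInterp.observed α P T N ξ η) Ahat ∧
      (∀ Y, StableInterp.IsOptimalEstimate α P (StableInterp.functional a ξ)
        (StableInterp.observed α P T N ξ η) Y → Y =ᵐ[P] Ahat) ∧
      ∃ (h : ℝ → Fin T → ℂ) (c : Fin (N + 1) → Fin T → ℂ),
        -- the spectral characteristic and the coefficients solve the system, and it determines them
        StableInterp.IsSolution α f g a h c ∧
        (∀ (h' : ℝ → Fin T → ℂ) (c' : Fin (N + 1) → Fin T → ℂ),
          StableInterp.IsSolution α f g a h' c' →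
            h' =ᵐ[volume.restrict (Ioc (-Real.pi) Real.pi)] h ∧ c' = c) ∧
        StableInterp.MemLalphaN α N (f + g) h ∧
        -- the estimate is the integral of the spectral characteristic
        StableInterp.IsStochIntegral α P (Zξ + Zη) (f + g) h Ahat ∧
        -- the error of the estimate
        IntegrableOn (StableInterp.alphaForm α f (StableInterp.polyA a - h))
          (Ioc (-Real.pi) Real.pi) ∧
        IntegrableOn (StableInterp.alphaForm α g h) (Ioc (-Real.pi) Real.pi) ∧
        StableInterp.stableNorm α P (StableInterp.functional a ξ - Ahat) ≠ ⊤ ∧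
        (((StableInterp.stableNorm α P (StableInterp.functional a ξ - Ahat)).toReal ^ α : ℝ) : ℂ) =
          (∫ θ in Ioc (-Real.pi) Real.pi,
            StableInterp.alphaForm α f (StableInterp.polyA a - h) θ) +
          (∫ θ in Ioc (-Real.pi) Real.pi, StableInterp.alphaForm α g h θ) ∧
        -- the error in the case of period one
        (T = 1 → ∀ k : Fin T,
          (((StableInterp.stableNorm α P
              (StableInterp.functional a ξ - Ahat)).toReal ^ α : ℝ) : ℂ) =
            (∫ θ in Ioc (-Real.pi) Real.pi,
              ((‖StableInterp.polyA a θ k - h θ k‖ ^ α : ℝ) : ℂ) * f θ k k) +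
            (∫ θ in Ioc (-Real.pi) Real.pi, ((‖h θ k‖ ^ α : ℝ) : ℂ) * g θ k k)) := by
  have hα0 : 0 < α := by linarith
  have hα' : 0 < 1 / α := by positivity
  have hI := hξ.indepProcesses hα₁ hα₂ hT hη hindep
  have hf := hI.left.isDensity hα₁ hα₂
  have hg := hI.right.isDensity hα₁ hα₂
  obtain ⟨Y, hY, hYu, hn, h, c, hs, hh, hclose⟩ :=
    StableInterp.exists_optimal_estimate hα₁ hα₂ hT hξ hη hindep hmin a
  obtain ⟨hhf, hhg⟩ := hf.memLalpha_left hα0 hg hs.memL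
  have hA := hξ.isStochIntegral_functional hα₁ hα₂ a
  have hAh := hf.memLalpha_sub hα₁.le hA.1 hhf
  -- Independence splits the error into the part of $\xi$ with integrand $A_N-h$ and the part of
  -- $\eta$ with integrand $-h$; the sign does not affect the norm.
  rw [hI.stablePow_sub hα₁ hα₂ hA hh] at hn
  have hfin := ENNReal.add_ne_top.2 ⟨hAh.2.ne, hhg.2.ne⟩
  have herr : (((StableInterp.stableNorm α P
      (StableInterp.functional a ξ - Y)).toReal ^ α : ℝ) : ℂ) =
      (∫ θ in Ioc (-Real.pi) Real.pi,
        StableInterp.alphaForm α f (StableInterp.polyA a - h) θ) +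
      (∫ θ in Ioc (-Real.pi) Real.pi, StableInterp.alphaForm α g h θ) := by
    rw [hn, ENNReal.toReal_rpow, ← ENNReal.rpow_mul, one_div_mul_cancel hα0.ne', ENNReal.rpow_one,
      ENNReal.toReal_add hAh.2.ne hhg.2.ne, Complex.ofReal_add, hf.integral_alphaForm hα0 hAh.1,
      hg.integral_alphaForm hα0 hhg.1]
  refine ⟨Y, hY, hYu, h, c, hs, fun h' c' => StableInterp.IsSolution.unique hα₁ hα₂ hf hg hmin hs,
    ⟨hs.memL, fun ε hε => ?_⟩, hI.isStochIntegral_add hα₁ hα₂ hh fun ε hε => ?_,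
    hAh.integrable_alphaForm hf, hhg.integrable_alphaForm hg,
    by rw [hn]; exact ENNReal.rpow_ne_top_of_nonneg hα'.le hfin, herr, ?_⟩
  · obtain ⟨p, hp, h1⟩ := hclose (ε ^ (1 / α)) (ENNReal.rpow_pos_of_nonneg hε hα'.le)
    exact ⟨p, hp, (ENNReal.rpow_lt_rpow_iff hα').1 h1⟩
  · obtain ⟨p, hp, h1⟩ := hclose ε hε
    exact ⟨p, StableInterp.continuous_of_mem_harmonicSpace hp, h1⟩
  · rintro rfl k
    rw [herr]
    simp only [StableInterp.alphaForm_fin_one hα0 _ _ _ k, Pi.sub_apply]
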